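/- Let $\mathbb{k}$ be a field of characteristic $0$ (for instance $\mathbb R$). Work with differential polynomials over $\mathbb{k}$ in two dependent variables $u,v$ of $x$ (write $u_x,u_{xx},u_{nx},\dots$ for derivatives), with total derivative $D_x$, modulo total derivatives: $\int f\,dx=0$ means $f=D_xh$ for some $h$. Let $\delta_u,\delta_v$ be the variational derivatives. Consider the system $u_t=F_u$, $v_t=F_v$, where $$\begin{aligned} F_u={}&u_{5x}-30vv_{4x}+5u_{x}u_{3x}-5u^{2}u_{3x}+15v^{2}u_{3x}-75v_{x}v_{3x}+60uvv_{3x}+90v^{2}v_{3x} \\ &\quad +5u_{xx}^{2}-20uu_{x}u_{xx}+60vv_{x}u_{xx}-45v_{xx}^{2}+90vu_{x}v_{xx}+90uv_{x}v_{xx} \\ &\quad +540vv_{x}v_{xx}+30u^{2}vv_{xx}-180uv^{2}v_{xx}-90v^{3}v_{xx}-5u_{x}^{3}+45u_{x}v_{x}^{2} \\ &\quad +60uvu_{x}v_{x}-180v^{2}u_{x}v_{x}+5u^{4}u_{x}-90u^{2}v^{2}u_{x}+45v^{4}u_{x} \\ &\quad +180v_{x}^{3}+30u^{2}v_{x}^{2}-360uvv_{x}^{2}-270v^{2}v_{x}^{2}-60u^{3}vv_{x}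 \\ &\quad +180uv^{3}v_{x} \\ F_v={}&-9v_{5x}+10vu_{4x}+25v_{x}u_{3x}+20uvu_{3x}+30v^{2}u_{3x}+15u_{x}v_{3x}+90v_{x}v_{3x} \\ &\quad +15u^{2}v_{3x}+15v^{2}v_{3x}+30u_{xx}v_{xx}+50vu_{x}u_{xx}-10u^{2}vu_{xx}+50uv_{x}u_{xx} \\ &\quad +60vv_{x}u_{xx}+60uv^{2}u_{xx}+30v^{3}u_{xx}+90v_{xx}^{2}+60uu_{x}v_{xx}+60vv_{x}v_{xx} \\ &\quad +45u_{x}^{2}v_{x}-20uvu_{x}^{2}+60v^{2}u_{x}^{2}-10u^{2}u_{x}v_{x}+90v^{2}u_{x}v_{x} \\ &\quad -20u^{3}vu_{x}+120uvu_{x}v_{x}+60uv^{3}u_{x}+15v_{x}^{3}-5u^{4}v_{x}+90u^{2}v^{2}v_{x} \\ &\quad -45v^{4}v_{x} \end{aligned}$$ Put $F_1=(F_u,F_v)^T$; below $u_t,v_t$ stand for $F_u,F_v$. Let $$\begin{aligned} \rho_1={}&3uu_{4x}-81vv_{4x}-5u^{2}u_{3x}+45v^{2}u_{3x}-90uvv_{3x}-270v^{2}v_{3x}-5u^{3}u_{xx}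 \\ &\quad +45uv^{2}u_{xx}+180v^{3}u_{xx}+135u^{2}vv_{xx}+45v^{3}v_{xx}+60u^{3}vv_{x} \\ &\quad -540u^{2}v^{2}v_{x}-540uv^{3}v_{x}+u^{6}-45u^{4}v^{2}+135u^{2}v^{4}-27v^{6} \end{aligned}$$ let $\rho_{-1}=\alpha$ be a constant, and let $$\mathrm J=\begin{pmatrix}3D_x&0\\0&D_x\end{pmatrix},\qquad \mathrm K=\begin{pmatrix}K_1&K_2\\-K_2^*&K_4\end{pmatrix},$$ $$\begin{aligned} K_1={}&2D_x^7+\alpha_1D_x^5+D_x^5\alpha_1+\alpha_2D_x^3+D_x^3\alpha_2+\alpha_3D_x+D_x\alpha_3+4u_xD_x^{-1}u_t+4u_tD_x^{-1}u_x,\\ K_2={}&-56D_x^6v+D_x^5\alpha_4+D_x^4\alpha_5+D_x^3\alpha_6+D_x^2\alpha_7+D_x\alpha_8+\alpha_9+4u_xD_x^{-1}v_t+4u_tD_x^{-1}v_x,\\ K_4={}&-18D_x^7+\alpha_{10}D_x^5+D_x^5\alpha_{10}+\alpha_{11}D_x^3+D_x^3\alpha_{11}+\alpha_{12}D_x+D_x\alpha_{12}+4v_xD_x^{-1}v_t+4v_tD_x^{-1}v_x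 \end{aligned}$$ (products are compositions of operators, ${}^*$ is the formal adjoint), with coefficients $$\begin{aligned} \alpha_{1}={}&6(u_{x}-u^{2}+11v^{2}) \\ \alpha_{2}={}&-16u_{3x}+20uu_{xx}-336vv_{xx}+29u_{x}^{2}-6u^{2}u_{x}-381v_{x}^{2}+9u^{4}-294u^{2}v^{2} \\ &\quad +264uvv_{x}+45v^{4}+234v^{2}u_{x}-180v^{2}v_{x} \\ \alpha_{3}={}&2(5u_{5x}+102vv_{4x}-25u_{x}u_{3x}+3u^{2}u_{3x}-117v^{2}u_{3x}+453v_{x}v_{3x}-72uvv_{3x} \\ &\quad +90v^{2}v_{3x}-21u_{xx}^{2}-600vv_{x}u_{xx}+8uu_{x}u_{xx}-8u^{3}u_{xx}+264uv^{2}u_{xx} \\ &\quad +351v_{xx}^{2}-498vu_{x}v_{xx}+540vv_{x}v_{xx}-306uv_{x}v_{xx}+174u^{2}vv_{xx} \\ &\quad -180uv^{2}v_{xx}-90v^{3}v_{xx}+6u_{x}^{3}-498u_{x}v_{x}^{2}+180v_{x}^{3} \\ &\quad +264u^{2}v_{x}^{2}-360uvv_{x}^{2}-270v^{2}v_{x}^{2}-2u^{6}+60u^{4}v^{2}-60u^{3}vv_{x}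 \\ &\quad -44u^{2}u_{x}^{2}-90u^{2}v^{4}+360u^{2}v^{2}v_{x}-6uu_{4x}+180uv^{3}v_{x} \\ &\quad +1116uvu_{x}v_{x}+294v^{2}u_{x}^{2}) \\ \alpha_{4}={}&4(53v_{x}+28uv+42v^{2}) \\ \alpha_{5}={}&2(-165v_{xx}-192vu_{x}-212uv_{x}-312vv_{x}+32u^{2}v-168uv^{2}-72v^{3}) \\ \alpha_{6}={}&4(66v_{3x}+141vu_{xx}+165uv_{xx}+90vv_{xx}+281u_{x}v_{x}+45v_{x}^{2}-32u^{3}v-37u^{2}v_{x} \\ &\quad -6u^{2}v^{2}+72uv^{3}-86uvu_{x}+312uvv_{x}-18v^{4}+246v^{2}u_{x}+177v^{2}v_{x}) \\ \alpha_{7}={}&2(-54v_{4x}-194vu_{3x}-264uv_{3x}-36vv_{3x}-557v_{x}u_{xx}+168uvu_{xx}-462v^{2}u_{xx} \\ &\quad -603u_{x}v_{xx}+162v_{x}v_{xx}+57u^{2}v_{xx}-360uvv_{xx}-63v^{2}v_{xx}-288v^{3}u_{x} \\ &\quad +184vu_{x}^{2}-1224vu_{x}v_{x}+108uv^{2}u_{x}+306uu_{x}v_{x}-180uv_{x}^{2}-246vv_{x}^{2}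 \\ &\quad +148u^{3}v_{x}+24u^{3}v^{2}+336u^{2}vu_{x}+24u^{2}vv_{x}-708uv^{2}v_{x}-36v^{3}v_{x} \\ &\quad -4u^{4}v+72uv^{4}+36v^{5}) \\ \alpha_{8}={}&2(9v_{5x}+46vu_{4x}+189v_{x}u_{3x}-80uvu_{3x}+138v^{2}u_{3x}+249u_{x}v_{3x}-90v_{x}v_{3x} \\ &\quad -15u^{2}v_{3x}+72uvv_{3x}-15v^{2}v_{3x}+300u_{xx}v_{xx}-90v_{xx}^{2}-174uu_{x}v_{xx} \\ &\quad +360vu_{x}v_{xx}-120vv_{x}v_{xx}-114u^{3}v_{xx}-324uv_{x}v_{xx}+126uv^{2}v_{xx} \\ &\quad -190u_{x}^{2}v_{x}+180u_{x}v_{x}^{2}-30v_{x}^{3}+8u^{5}v+4u^{4}v_{x}+36u^{3}vu_{x} \\ &\quad -48u^{3}vv_{x}-456u^{2}u_{x}v_{x}-192u^{2}v^{2}u_{x}-60u^{2}v^{2}v_{x}-174u^{2}vu_{xx} \\ &\quad +108uv_{4x}-204uv_{x}u_{xx}-72uv^{5}-60uv^{3}u_{x}+72uv^{3}v_{x}-144uv^{2}u_{xx}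 \\ &\quad -308uvu_{x}^{2}-168uvu_{x}v_{x}+492uvv_{x}^{2}-72v^{4}u_{x}+114v^{3}u_{xx} \\ &\quad -84v^{2}u_{x}^{2}+648v^{2}u_{x}v_{x}+180v^{2}v_{x}^{2}-222vu_{x}u_{xx}+564vv_{x}u_{xx}) \\ \alpha_{9}={}&4(-9uv_{5x}+v_{x}u_{4x}+10uvu_{4x}+20u^{2}vu_{3x}+25uv_{x}u_{3x}+30uv^{2}u_{3x}+15u^{3}v_{3x} \\ &\quad +15uu_{x}v_{3x}+90uv_{x}v_{3x}+15uv^{2}v_{3x}-30vv_{x}v_{3x}+5u_{x}v_{x}u_{xx} \\ &\quad +30uu_{xx}v_{xx}+90uv_{xx}^{2}-45v_{x}^{2}v_{xx}+60u^{2}u_{x}v_{xx}+120uvv_{x}v_{xx} \\ &\quad +90v^{2}v_{x}v_{xx}+30u^{2}vv_{x}^{2}+30vu_{x}v_{x}^{2}+30uv_{x}^{3}-4u^{5}v_{x} \\ &\quad -20u^{4}vu_{x}-10u^{3}u_{x}v_{x}+60u^{3}v^{2}v_{x}-10u^{3}vu_{xx}+45u^{2}v_{x}u_{xx} \\ &\quad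 +60u^{2}v^{3}u_{x}+60u^{2}v^{2}u_{xx}-20u^{2}vu_{x}^{2}+120u^{2}vu_{x}v_{x} \\ &\quad +40uu_{x}^{2}v_{x}+30uv^{3}u_{xx}+60uv^{2}u_{x}^{2}+90uv^{2}u_{x}v_{x}-180uv^{2}v_{x}^{2} \\ &\quad +50uvu_{x}u_{xx}+60uvv_{x}u_{xx}-90v^{3}v_{x}^{2}+15v^{2}v_{x}u_{xx}+180vv_{x}^{3}) \\ \alpha_{10}={}&2(9u_{x}+54v_{x}+9u^{2}+13v^{2}) \\ \alpha_{11}={}&-36u_{3x}-288v_{3x}-72uu_{xx}+72vu_{xx}-68vv_{xx}-81u_{x}^{2}-36u_{x}v_{x}-18u^{2}u_{x} \\ &\quad +144uvu_{x}+62v^{2}u_{x}-275v_{x}^{2}-36u^{2}v_{x}-192v^{2}v_{x}-9u^{4}+62u^{2}v^{2} \\ &\quad -69v^{4} \\ \alpha_{12}={}&2(9u_{5x}+90v_{5x}+18uu_{4x}-36vu_{4x}+26vv_{4x}+81u_{x}u_{3x}-54v_{x}u_{3x}+9u^{2}u_{3x} \\ &\quad -72uvu_{3x}-51v^{2}u_{3x}+18u_{x}v_{3x}+239v_{x}v_{3x}+18u^{2}v_{3x}+96v^{2}v_{3x}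 \\ &\quad +63u_{xx}^{2}+54uu_{x}u_{xx}-216vu_{x}u_{xx}-108uv_{x}u_{xx}-154vv_{x}u_{xx} \\ &\quad +18u^{3}u_{xx}-102uv^{2}u_{xx}-60v^{3}u_{xx}+231v_{xx}^{2}-92vu_{x}v_{xx}+396vv_{x}v_{xx} \\ &\quad -92u^{2}vv_{xx}+108v^{3}v_{xx}+18u_{x}^{3}-92v^{2}u_{x}^{2}-108u_{x}^{2}v_{x} \\ &\quad +54u^{2}u_{x}^{2}-62u_{x}v_{x}^{2}+192v_{x}^{3}+20u^{2}v^{2}u_{x}-120uv^{3}u_{x} \\ &\quad -308uvu_{x}v_{x}-60v^{4}u_{x}+384v^{2}v_{x}^{2}+18v^{6}+10u^{4}v^{2}-62u^{2}v_{x}^{2} \\ &\quad -60u^{2}v^{4}) \end{aligned}$$ Then the following hold. 1. For $v=0$ the second equation becomes $0=0$ and the first one becomes the Kupershmidt equation $u_t=u_{5x}+5u_{x}u_{3x}+5u_{xx}^2-5u^2u_{3x}-20uu_{x}u_{xx}-5u_{x}^3+5u^4u_{x}$. 2. The system has the two Hamiltonian forms $$F_1=\mathrm J\begin{pmatrix}\delta_u\\\delta_v\end{pmatrix}\int\tfrac1{18}\rho_1\,dx,\qquad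 F_1=\mathrm K\begin{pmatrix}\delta_u\\\delta_v\end{pmatrix}\int\rho_{-1}\,dx .$$ In the second one $D_x^{-1}g$ denotes any primitive of $g$, with a free integration constant: since the gradient of $\int\rho_{-1}\,dx$ is $0$, the assertion is that $F_1$ is one of the values of $\mathrm K$ at $0$. 3. $\mathrm J$ and $\mathrm K$ form a compatible pair of Hamiltonian operators: $\mathrm J$, $\mathrm K$ and $\mathrm K+\lambda\mathrm J$, for every constant $\lambda\in\mathbb{k}$, are skew-adjoint and their functional trivectors vanish. That is, for $H=\mathrm J$, $\mathrm K$ or $\mathrm K+\lambda\mathrm J$ and arbitrary covectors $P,Q,R$, $$\int\left(P\cdot HQ+Q\cdot HP\right)dx=0,$$ $$\int\left(P\cdot\mathrm{pr}\,\mathbf v_{HR}(H)\,Q+Q\cdot\mathrm{pr}\,\mathbf v_{HP}(H)\,R+R\cdot\mathrm{pr}\,\mathbf v_{HQ}(H)\,P\right)dx=0,$$ where $\mathrm{pr}\,\mathbf v_X(H)$ is obtained from $H$ by letting the prolonged evolutionary vector field with characteristic $X$ act on the coefficients of $H$. Here $P,Q,R$ are pairs of independent differential indeterminates. For $\mathrm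 K$ and $\mathrm K+\lambda\mathrm J$ one adjoins, for each covector $S\in\{P,Q,R\}$, the potentials $D_x^{-1}(u_xS_1+v_xS_2)$ and $D_x^{-1}(u_tS_1+v_tS_2)$ as new variables; the remaining expressions $D_x^{-1}(\cdot)$ that arise from varying the coefficients to the right of $D_x^{-1}$ are removed by the rule $\int f\,D_x^{-1}g\,dx=-\int (D_x^{-1}f)\,g\,dx$. -/

import Mathlib

open MvPolynomial

noncomputable section

/-! ## Differential polynomials in `u, v` -/

/-- Differential polynomials in the two dependent variables; the variable `(i, n)` is the `n`-th
`x`-derivative of `u` (if `i = 0`) or of `v` (if `i = 1`). -/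
abbrev DiffPoly (R : Type*) [CommRing R] : Type _ := MvPolynomial (Fin 2 × ℕ) R

/-- The jet variables: `jet R 0 n` is `u_{nx}`, `jet R 1 n` is `v_{nx}`. -/
def jet (R : Type*) [CommRing R] (i : Fin 2) (n : ℕ) : DiffPoly R := X (i, n)

/-- The total `x`-derivative `D_x`. -/
def totalDeriv (R : Type*) [CommRing R] : Derivation R (DiffPoly R) (DiffPoly R) :=
  mkDerivation R fun p => jet R p.1 (p.2 + 1)

/-- The variational derivatives `(δ_u, δ_v)` of the functional `∫ ρ dx`:
`δ_i ∫ ρ = ∑ₙ (-D_x)ⁿ (∂ρ / ∂u_i^{(n)})`, a finite sum. -/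
def varDeriv {R : Type*} [CommRing R] (ρ : DiffPoly R) (i : Fin 2) : DiffPoly R :=
  ∑ᶠ n : ℕ, (-1) ^ n * (totalDeriv R)^[n] (pderiv (i, n) ρ)

/-- The substitution `v = 0` (with all derivatives of `v`). -/
def setVZero (R : Type*) [CommRing R] : DiffPoly R →ₐ[R] DiffPoly R :=
  aeval fun p => if p.1 = 0 then jet R p.1 p.2 else 0

/-! ## Scalar differential operators -/

/-- Scalar differential operators with coefficients in `DiffPoly R`, written as expressions in
multiplication operators and `D_x`. An operator enters everything below only through its action
`DiffOp.act`. -/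
inductive DiffOp (R : Type*) [CommRing R]
  | coeff (a : DiffPoly R)
  | der
  | add (L M : DiffOp R)
  | comp (L M : DiffOp R)

namespace DiffOp

variable {R : Type*} [CommRing R]

instance : Add (DiffOp R) := ⟨add⟩

/-- The product is the composition of operators. -/
instance : Mul (DiffOp R) := ⟨comp⟩

instance : Neg (DiffOp R) := ⟨fun L => comp (coeff (-1)) L⟩

instance : Zero (DiffOp R) := ⟨coeff 0⟩

/-- Iterated composition. -/
def npow (L : DiffOp R) : ℕ → DiffOp R
  | 0 => coeff 1
  | n + 1 => comp L (npow L n)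

instance : Pow (DiffOp R) ℕ := ⟨npow⟩

/-- Formal adjoint: `a* = a`, `D_x* = -D_x`, `(L M)* = M* L*`. -/
def adjoint : DiffOp R → DiffOp R
  | coeff a => coeff a
  | der => -der
  | add L M => add (adjoint L) (adjoint M)
  | comp L M => comp (adjoint M) (adjoint L)

/-- Action on a differential ring `B` with derivation `d` that contains the differential
polynomials through `e`. -/
def act {B : Type*} [CommRing B] (e : DiffPoly R →+* B) (d : B → B) : DiffOp R → B → B
  | coeff a, f => e a * f
  | der, f => d f
  | add L M, f => act e d L f + act e d M f
  | comp L M, f => act e d L (act e d M f)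

end DiffOp

/-- Value of a matrix differential operator on a vector of differential polynomials. -/
def applyLocal {R : Type*} [CommRing R] (L : Matrix (Fin 2) (Fin 2) (DiffOp R))
    (G : Fin 2 → DiffPoly R) (i : Fin 2) : DiffPoly R :=
  ∑ j, (L i j).act (RingHom.id _) (totalDeriv R) (G j)

/-! ## Weakly nonlocal matrix operators -/

/-- Weakly nonlocal `2 × 2` matrix operators
`(i, j) ↦ L i j + ∑ a b, S a b • (w a i) D_x⁻¹ (w b j)`
with prescribed vectors `w 0, …, w (m - 1)` in the nonlocal tail. -/
structure WNLOp {R : Type*} [CommRing R] {m : ℕ} (w : Fin m → Fin 2 → DiffPoly R) where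
  /-- The local part. -/
  loc : Matrix (Fin 2) (Fin 2) (DiffOp R)
  /-- The constant coefficients of the nonlocal tail. -/
  tail : Matrix (Fin m) (Fin m) R

/-- The variables of the universal differential ring in which an operator with tail vectors
`w 0, …, w (m - 1)` is evaluated on three arbitrary covectors `P₀, P₁, P₂`. -/
inductive ExtVar (m : ℕ)
  /-- `n`-th derivative of the dependent variable `i` (`u` or `v`). -/
  | fld (i : Fin 2) (n : ℕ)
  /-- `n`-th derivative of the component `i` of the covector `P_s`. -/
  | cov (s : Fin 3) (i : Fin 2) (n : ℕ)
  /-- The potential `D_x⁻¹ (w a · P_s)`. -/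
  | pot (s : Fin 3) (a : Fin m)

/-- The ring of differential polynomials in `u, v`, in three arbitrary covectors `P₀, P₁, P₂`
and in the potentials `D_x⁻¹ (w a · P_s)`. -/
abbrev ExtPoly (R : Type*) [CommRing R] (m : ℕ) : Type _ := MvPolynomial (ExtVar m) R

namespace WNLOp

variable {R : Type*} [CommRing R] {m : ℕ} {w : Fin m → Fin 2 → DiffPoly R}

instance : Add (WNLOp w) := ⟨fun K L => ⟨fun i j => K.loc i j + L.loc i j, K.tail + L.tail⟩⟩

instance : SMul R (WNLOp w) :=
  ⟨fun c K => ⟨fun i j => DiffOp.coeff (C c) * K.loc i j, c • K.tail⟩⟩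

/-- A local operator, seen as a weakly nonlocal one with zero tail. -/
def ofLocal (w : Fin m → Fin 2 → DiffPoly R) (L : Matrix (Fin 2) (Fin 2) (DiffOp R)) :
    WNLOp w := ⟨L, 0⟩

/-- `F = K G` for vectors of differential polynomials. As usual `D_x⁻¹ g` stands for any
differential polynomial `r` with `D_x r = g`, so that integration constants are free and `K G` may
have several values; all occurrences of the same `D_x⁻¹ (w a · G)` get the same primitive. -/
def IsValue (K : WNLOp w) (G F : Fin 2 → DiffPoly R) : Prop :=
  ∃ r : Fin m → DiffPoly R, (∀ a, totalDeriv R (r a) = ∑ i, w a i * G i) ∧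
    ∀ i, F i = applyLocal K.loc G i + ∑ a, ∑ b, C (K.tail a b) * w a i * r b

/-- Differential polynomials in `u, v` inside the universal ring. -/
def emb (R : Type*) [CommRing R] (m : ℕ) : DiffPoly R →ₐ[R] ExtPoly R m :=
  rename fun p => ExtVar.fld p.1 p.2

/-- The component `i` of the covector `P_s`. -/
def cov (R : Type*) [CommRing R] (m : ℕ) (s : Fin 3) (i : Fin 2) : ExtPoly R m :=
  X (ExtVar.cov s i 0)

/-- The total derivative `D_x` on the universal ring; it sends the potential with index `(s, a)` to
`w a · P_s`. -/
def extDeriv (w : Fin m → Fin 2 → DiffPoly R) : Derivation R (ExtPoly R m) (ExtPoly R m) :=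
  mkDerivation R fun
    | .fld i n => X (ExtVar.fld i (n + 1))
    | .cov s i n => X (ExtVar.cov s i (n + 1))
    | .pot s a => ∑ i, emb R m (w a i) * cov R m s i

/-- The prolonged evolutionary vector field with characteristic `Q`: it commutes with `D_x`, sends
`u` to `Q 0` and `v` to `Q 1`, and does not act on the covectors. (It is only applied to
expressions without potentials.) -/
def evol (w : Fin m → Fin 2 → DiffPoly R) (Q : Fin 2 → ExtPoly R m) :
    Derivation R (ExtPoly R m) (ExtPoly R m) :=
  mkDerivation R fun
    | .fld i n => (extDeriv w)^[n] (Q i)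
    | .cov _ _ _ => 0
    | .pot _ _ => 0

/-- Value of the local part of `K` on the covector `P_s`. -/
def locValue (K : WNLOp w) (s : Fin 3) (i : Fin 2) : ExtPoly R m :=
  ∑ j, (K.loc i j).act (emb R m : DiffPoly R →+* ExtPoly R m) (extDeriv w) (cov R m s j)

/-- The value `K P_s` on the covector `P_s`. -/
def value (K : WNLOp w) (s : Fin 3) (i : Fin 2) : ExtPoly R m :=
  K.locValue s i +
    ∑ a, ∑ b, C (K.tail a b) * emb R m (w a i) * X (ExtVar.pot s b)

/-- A density of the functional `∫ P_t · K P_s dx`. -/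
def pairing (K : WNLOp w) (t s : Fin 3) : ExtPoly R m :=
  ∑ i, cov R m t i * K.value s i

/-- A density of the functional `∫ P_t · pr v_Q (K) P_s dx` with `Q = K P_r`, where `pr v_Q (K)` is
the operator obtained from `K` by letting the vector field `pr v_Q` act on its coefficients.
For the tail the product rule gives two summands,
`∫ P_t · pr v_Q (w a) D_x⁻¹ (w b · P_s) dx` and `∫ P_t · w a D_x⁻¹ (pr v_Q (w b) · P_s) dx`;
the second is integrated by parts to `- ∫ D_x⁻¹ (w a · P_t) (pr v_Q (w b) · P_s) dx`. -/
def variation (K : WNLOp w) (t s r : Fin 3) : ExtPoly R m :=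
  ∑ i, cov R m t i * evol w (K.value r) (K.locValue s i) +
    ∑ a, ∑ b, C (K.tail a b) *
      ((∑ i, cov R m t i * evol w (K.value r) (emb R m (w a i))) * X (ExtVar.pot s b) -
        X (ExtVar.pot t a) * ∑ i, evol w (K.value r) (emb R m (w b i)) * cov R m s i)

/-- A density of the functional trivector `pr v_{Kθ} (½ ∫ θ ∧ Kθ dx)` of `K`, evaluated (up to a
constant factor) on three arbitrary covectors `P = P₀`, `Q = P₁`, `R = P₂`, that is
`∫ [P · pr v_{KR} (K) Q + Q · pr v_{KP} (K) R + R · pr v_{KQ} (K) P] dx`. -/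
def trivector (K : WNLOp w) : ExtPoly R m :=
  K.variation 0 1 2 + K.variation 1 2 0 + K.variation 2 0 1

/-- The functional trivector of `K` vanishes: its density is a total derivative. -/
def TrivectorVanishes (K : WNLOp w) : Prop :=
  ∃ h, K.trivector = extDeriv w h

/-- `K` is skew-adjoint: `∫ (P · K Q + Q · K P) dx = 0` for arbitrary covectors `P, Q`. -/
def IsSkewAdjoint (K : WNLOp w) : Prop :=
  ∃ h, K.pairing 0 1 + K.pairing 1 0 = extDeriv w h

/-- Hamiltonian operators. -/
def IsHamiltonian (K : WNLOp w) : Prop :=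
  K.IsSkewAdjoint ∧ K.TrivectorVanishes

end WNLOp

/-! ## The system and its two operators -/

/-! The new system. Here and below `u n` and `v n` stand for the `n`-th `x`-derivatives of `u` and
`v`; they may be taken in any commutative ring. -/

/-- Right-hand side of the equation for `u_t`. -/
def flowU {A : Type*} [CommRing A] (u v : ℕ → A) : A :=
  u 5 - 30 * v 0 * v 4 + 5 * u 1 * u 3 - 5 * u 0 ^ 2 * u 3 + 15 * v 0 ^ 2 * u 3
    - 75 * v 1 * v 3 + 60 * u 0 * v 0 * v 3 + 90 * v 0 ^ 2 * v 3 + 5 * u 2 ^ 2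
    - 20 * u 0 * u 1 * u 2 + 60 * v 0 * v 1 * u 2 - 45 * v 2 ^ 2 + 90 * v 0 * u 1 * v 2
    + 90 * u 0 * v 1 * v 2 + 540 * v 0 * v 1 * v 2 + 30 * u 0 ^ 2 * v 0 * v 2
    - 180 * u 0 * v 0 ^ 2 * v 2 - 90 * v 0 ^ 3 * v 2 - 5 * u 1 ^ 3 + 45 * u 1 * v 1 ^ 2
    + 60 * u 0 * v 0 * u 1 * v 1 - 180 * v 0 ^ 2 * u 1 * v 1 + 5 * u 0 ^ 4 * u 1
    - 90 * u 0 ^ 2 * v 0 ^ 2 * u 1 + 45 * v 0 ^ 4 * u 1 + 180 * v 1 ^ 3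
    + 30 * u 0 ^ 2 * v 1 ^ 2 - 360 * u 0 * v 0 * v 1 ^ 2 - 270 * v 0 ^ 2 * v 1 ^ 2
    - 60 * u 0 ^ 3 * v 0 * v 1 + 180 * u 0 * v 0 ^ 3 * v 1

/-- Right-hand side of the equation for `v_t`. -/
def flowV {A : Type*} [CommRing A] (u v : ℕ → A) : A :=
  -9 * v 5 + 10 * v 0 * u 4 + 25 * v 1 * u 3 + 20 * u 0 * v 0 * u 3 + 30 * v 0 ^ 2 * u 3
    + 15 * u 1 * v 3 + 90 * v 1 * v 3 + 15 * u 0 ^ 2 * v 3 + 15 * v 0 ^ 2 * v 3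
    + 30 * u 2 * v 2 + 50 * v 0 * u 1 * u 2 - 10 * u 0 ^ 2 * v 0 * u 2 + 50 * u 0 * v 1 * u 2
    + 60 * v 0 * v 1 * u 2 + 60 * u 0 * v 0 ^ 2 * u 2 + 30 * v 0 ^ 3 * u 2 + 90 * v 2 ^ 2
    + 60 * u 0 * u 1 * v 2 + 60 * v 0 * v 1 * v 2 + 45 * u 1 ^ 2 * v 1
    - 20 * u 0 * v 0 * u 1 ^ 2 + 60 * v 0 ^ 2 * u 1 ^ 2 - 10 * u 0 ^ 2 * u 1 * v 1
    + 90 * v 0 ^ 2 * u 1 * v 1 - 20 * u 0 ^ 3 * v 0 * u 1 + 120 * u 0 * v 0 * u 1 * v 1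
    + 60 * u 0 * v 0 ^ 3 * u 1 + 15 * v 1 ^ 3 - 5 * u 0 ^ 4 * v 1
    + 90 * u 0 ^ 2 * v 0 ^ 2 * v 1 - 45 * v 0 ^ 4 * v 1

/-- Right-hand side of the Kupershmidt equation. -/
def kupershmidt {A : Type*} [CommRing A] (u : ℕ → A) : A :=
  u 5 + 5 * u 1 * u 3 + 5 * u 2 ^ 2 - 5 * u 0 ^ 2 * u 3 - 20 * u 0 * u 1 * u 2 - 5 * u 1 ^ 3
    + 5 * u 0 ^ 4 * u 1

/-- The conserved density `ρ₁` (before normalization by `1 / 18`). -/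
def rho1 {A : Type*} [CommRing A] (u v : ℕ → A) : A :=
  3 * u 0 * u 4 - 81 * v 0 * v 4 - 5 * u 0 ^ 2 * u 3 + 45 * v 0 ^ 2 * u 3
    - 90 * u 0 * v 0 * v 3 - 270 * v 0 ^ 2 * v 3 - 5 * u 0 ^ 3 * u 2 + 45 * u 0 * v 0 ^ 2 * u 2
    + 180 * v 0 ^ 3 * u 2 + 135 * u 0 ^ 2 * v 0 * v 2 + 45 * v 0 ^ 3 * v 2
    + 60 * u 0 ^ 3 * v 0 * v 1 - 540 * u 0 ^ 2 * v 0 ^ 2 * v 1 - 540 * u 0 * v 0 ^ 3 * v 1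
    + u 0 ^ 6 - 45 * u 0 ^ 4 * v 0 ^ 2 + 135 * u 0 ^ 2 * v 0 ^ 4 - 27 * v 0 ^ 6

/-! Coefficients of the operator `K`. -/

def alpha1 {A : Type*} [CommRing A] (u v : ℕ → A) : A :=
  6 * (u 1 - u 0 ^ 2 + 11 * v 0 ^ 2)

def alpha2 {A : Type*} [CommRing A] (u v : ℕ → A) : A :=
  -16 * u 3 + 20 * u 0 * u 2 - 336 * v 0 * v 2 + 29 * u 1 ^ 2 - 6 * u 0 ^ 2 * u 1
    - 381 * v 1 ^ 2 + 9 * u 0 ^ 4 - 294 * u 0 ^ 2 * v 0 ^ 2 + 264 * u 0 * v 0 * v 1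
    + 45 * v 0 ^ 4 + 234 * v 0 ^ 2 * u 1 - 180 * v 0 ^ 2 * v 1

def alpha3 {A : Type*} [CommRing A] (u v : ℕ → A) : A :=
  2 * (5 * u 5 + 102 * v 0 * v 4 - 25 * u 1 * u 3 + 3 * u 0 ^ 2 * u 3 - 117 * v 0 ^ 2 * u 3
    + 453 * v 1 * v 3 - 72 * u 0 * v 0 * v 3 + 90 * v 0 ^ 2 * v 3 - 21 * u 2 ^ 2
    - 600 * v 0 * v 1 * u 2 + 8 * u 0 * u 1 * u 2 - 8 * u 0 ^ 3 * u 2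
    + 264 * u 0 * v 0 ^ 2 * u 2 + 351 * v 2 ^ 2 - 498 * v 0 * u 1 * v 2 + 540 * v 0 * v 1 * v 2
    - 306 * u 0 * v 1 * v 2 + 174 * u 0 ^ 2 * v 0 * v 2 - 180 * u 0 * v 0 ^ 2 * v 2
    - 90 * v 0 ^ 3 * v 2 + 6 * u 1 ^ 3 - 498 * u 1 * v 1 ^ 2 + 180 * v 1 ^ 3
    + 264 * u 0 ^ 2 * v 1 ^ 2 - 360 * u 0 * v 0 * v 1 ^ 2 - 270 * v 0 ^ 2 * v 1 ^ 2
    - 2 * u 0 ^ 6 + 60 * u 0 ^ 4 * v 0 ^ 2 - 60 * u 0 ^ 3 * v 0 * v 1 - 44 * u 0 ^ 2 * u 1 ^ 2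
    - 90 * u 0 ^ 2 * v 0 ^ 4 + 360 * u 0 ^ 2 * v 0 ^ 2 * v 1 - 6 * u 0 * u 4
    + 180 * u 0 * v 0 ^ 3 * v 1 + 1116 * u 0 * v 0 * u 1 * v 1 + 294 * v 0 ^ 2 * u 1 ^ 2)

def alpha4 {A : Type*} [CommRing A] (u v : ℕ → A) : A :=
  4 * (53 * v 1 + 28 * u 0 * v 0 + 42 * v 0 ^ 2)

def alpha5 {A : Type*} [CommRing A] (u v : ℕ → A) : A :=
  2 * (-165 * v 2 - 192 * v 0 * u 1 - 212 * u 0 * v 1 - 312 * v 0 * v 1 + 32 * u 0 ^ 2 * v 0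
    - 168 * u 0 * v 0 ^ 2 - 72 * v 0 ^ 3)

def alpha6 {A : Type*} [CommRing A] (u v : ℕ → A) : A :=
  4 * (66 * v 3 + 141 * v 0 * u 2 + 165 * u 0 * v 2 + 90 * v 0 * v 2 + 281 * u 1 * v 1
    + 45 * v 1 ^ 2 - 32 * u 0 ^ 3 * v 0 - 37 * u 0 ^ 2 * v 1 - 6 * u 0 ^ 2 * v 0 ^ 2
    + 72 * u 0 * v 0 ^ 3 - 86 * u 0 * v 0 * u 1 + 312 * u 0 * v 0 * v 1 - 18 * v 0 ^ 4
    + 246 * v 0 ^ 2 * u 1 + 177 * v 0 ^ 2 * v 1)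

def alpha7 {A : Type*} [CommRing A] (u v : ℕ → A) : A :=
  2 * (-54 * v 4 - 194 * v 0 * u 3 - 264 * u 0 * v 3 - 36 * v 0 * v 3 - 557 * v 1 * u 2
    + 168 * u 0 * v 0 * u 2 - 462 * v 0 ^ 2 * u 2 - 603 * u 1 * v 2 + 162 * v 1 * v 2
    + 57 * u 0 ^ 2 * v 2 - 360 * u 0 * v 0 * v 2 - 63 * v 0 ^ 2 * v 2 - 288 * v 0 ^ 3 * u 1
    + 184 * v 0 * u 1 ^ 2 - 1224 * v 0 * u 1 * v 1 + 108 * u 0 * v 0 ^ 2 * u 1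
    + 306 * u 0 * u 1 * v 1 - 180 * u 0 * v 1 ^ 2 - 246 * v 0 * v 1 ^ 2 + 148 * u 0 ^ 3 * v 1
    + 24 * u 0 ^ 3 * v 0 ^ 2 + 336 * u 0 ^ 2 * v 0 * u 1 + 24 * u 0 ^ 2 * v 0 * v 1
    - 708 * u 0 * v 0 ^ 2 * v 1 - 36 * v 0 ^ 3 * v 1 - 4 * u 0 ^ 4 * v 0 + 72 * u 0 * v 0 ^ 4
    + 36 * v 0 ^ 5)

def alpha8 {A : Type*} [CommRing A] (u v : ℕ → A) : A :=
  2 * (9 * v 5 + 46 * v 0 * u 4 + 189 * v 1 * u 3 - 80 * u 0 * v 0 * u 3 + 138 * v 0 ^ 2 * u 3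
    + 249 * u 1 * v 3 - 90 * v 1 * v 3 - 15 * u 0 ^ 2 * v 3 + 72 * u 0 * v 0 * v 3
    - 15 * v 0 ^ 2 * v 3 + 300 * u 2 * v 2 - 90 * v 2 ^ 2 - 174 * u 0 * u 1 * v 2
    + 360 * v 0 * u 1 * v 2 - 120 * v 0 * v 1 * v 2 - 114 * u 0 ^ 3 * v 2
    - 324 * u 0 * v 1 * v 2 + 126 * u 0 * v 0 ^ 2 * v 2 - 190 * u 1 ^ 2 * v 1
    + 180 * u 1 * v 1 ^ 2 - 30 * v 1 ^ 3 + 8 * u 0 ^ 5 * v 0 + 4 * u 0 ^ 4 * v 1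
    + 36 * u 0 ^ 3 * v 0 * u 1 - 48 * u 0 ^ 3 * v 0 * v 1 - 456 * u 0 ^ 2 * u 1 * v 1
    - 192 * u 0 ^ 2 * v 0 ^ 2 * u 1 - 60 * u 0 ^ 2 * v 0 ^ 2 * v 1 - 174 * u 0 ^ 2 * v 0 * u 2
    + 108 * u 0 * v 4 - 204 * u 0 * v 1 * u 2 - 72 * u 0 * v 0 ^ 5 - 60 * u 0 * v 0 ^ 3 * u 1
    + 72 * u 0 * v 0 ^ 3 * v 1 - 144 * u 0 * v 0 ^ 2 * u 2 - 308 * u 0 * v 0 * u 1 ^ 2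
    - 168 * u 0 * v 0 * u 1 * v 1 + 492 * u 0 * v 0 * v 1 ^ 2 - 72 * v 0 ^ 4 * u 1
    + 114 * v 0 ^ 3 * u 2 - 84 * v 0 ^ 2 * u 1 ^ 2 + 648 * v 0 ^ 2 * u 1 * v 1
    + 180 * v 0 ^ 2 * v 1 ^ 2 - 222 * v 0 * u 1 * u 2 + 564 * v 0 * v 1 * u 2)

def alpha9 {A : Type*} [CommRing A] (u v : ℕ → A) : A :=
  4 * (-9 * u 0 * v 5 + v 1 * u 4 + 10 * u 0 * v 0 * u 4 + 20 * u 0 ^ 2 * v 0 * u 3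
    + 25 * u 0 * v 1 * u 3 + 30 * u 0 * v 0 ^ 2 * u 3 + 15 * u 0 ^ 3 * v 3
    + 15 * u 0 * u 1 * v 3 + 90 * u 0 * v 1 * v 3 + 15 * u 0 * v 0 ^ 2 * v 3
    - 30 * v 0 * v 1 * v 3 + 5 * u 1 * v 1 * u 2 + 30 * u 0 * u 2 * v 2 + 90 * u 0 * v 2 ^ 2
    - 45 * v 1 ^ 2 * v 2 + 60 * u 0 ^ 2 * u 1 * v 2 + 120 * u 0 * v 0 * v 1 * v 2
    + 90 * v 0 ^ 2 * v 1 * v 2 + 30 * u 0 ^ 2 * v 0 * v 1 ^ 2 + 30 * v 0 * u 1 * v 1 ^ 2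
    + 30 * u 0 * v 1 ^ 3 - 4 * u 0 ^ 5 * v 1 - 20 * u 0 ^ 4 * v 0 * u 1
    - 10 * u 0 ^ 3 * u 1 * v 1 + 60 * u 0 ^ 3 * v 0 ^ 2 * v 1 - 10 * u 0 ^ 3 * v 0 * u 2
    + 45 * u 0 ^ 2 * v 1 * u 2 + 60 * u 0 ^ 2 * v 0 ^ 3 * u 1 + 60 * u 0 ^ 2 * v 0 ^ 2 * u 2
    - 20 * u 0 ^ 2 * v 0 * u 1 ^ 2 + 120 * u 0 ^ 2 * v 0 * u 1 * v 1 + 40 * u 0 * u 1 ^ 2 * v 1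
    + 30 * u 0 * v 0 ^ 3 * u 2 + 60 * u 0 * v 0 ^ 2 * u 1 ^ 2 + 90 * u 0 * v 0 ^ 2 * u 1 * v 1
    - 180 * u 0 * v 0 ^ 2 * v 1 ^ 2 + 50 * u 0 * v 0 * u 1 * u 2 + 60 * u 0 * v 0 * v 1 * u 2
    - 90 * v 0 ^ 3 * v 1 ^ 2 + 15 * v 0 ^ 2 * v 1 * u 2 + 180 * v 0 * v 1 ^ 3)

def alpha10 {A : Type*} [CommRing A] (u v : ℕ → A) : A :=
  2 * (9 * u 1 + 54 * v 1 + 9 * u 0 ^ 2 + 13 * v 0 ^ 2)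

def alpha11 {A : Type*} [CommRing A] (u v : ℕ → A) : A :=
  -36 * u 3 - 288 * v 3 - 72 * u 0 * u 2 + 72 * v 0 * u 2 - 68 * v 0 * v 2 - 81 * u 1 ^ 2
    - 36 * u 1 * v 1 - 18 * u 0 ^ 2 * u 1 + 144 * u 0 * v 0 * u 1 + 62 * v 0 ^ 2 * u 1
    - 275 * v 1 ^ 2 - 36 * u 0 ^ 2 * v 1 - 192 * v 0 ^ 2 * v 1 - 9 * u 0 ^ 4
    + 62 * u 0 ^ 2 * v 0 ^ 2 - 69 * v 0 ^ 4

def alpha12 {A : Type*} [CommRing A] (u v : ℕ → A) : A :=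
  2 * (9 * u 5 + 90 * v 5 + 18 * u 0 * u 4 - 36 * v 0 * u 4 + 26 * v 0 * v 4 + 81 * u 1 * u 3
    - 54 * v 1 * u 3 + 9 * u 0 ^ 2 * u 3 - 72 * u 0 * v 0 * u 3 - 51 * v 0 ^ 2 * u 3
    + 18 * u 1 * v 3 + 239 * v 1 * v 3 + 18 * u 0 ^ 2 * v 3 + 96 * v 0 ^ 2 * v 3 + 63 * u 2 ^ 2
    + 54 * u 0 * u 1 * u 2 - 216 * v 0 * u 1 * u 2 - 108 * u 0 * v 1 * u 2
    - 154 * v 0 * v 1 * u 2 + 18 * u 0 ^ 3 * u 2 - 102 * u 0 * v 0 ^ 2 * u 2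
    - 60 * v 0 ^ 3 * u 2 + 231 * v 2 ^ 2 - 92 * v 0 * u 1 * v 2 + 396 * v 0 * v 1 * v 2
    - 92 * u 0 ^ 2 * v 0 * v 2 + 108 * v 0 ^ 3 * v 2 + 18 * u 1 ^ 3 - 92 * v 0 ^ 2 * u 1 ^ 2
    - 108 * u 1 ^ 2 * v 1 + 54 * u 0 ^ 2 * u 1 ^ 2 - 62 * u 1 * v 1 ^ 2 + 192 * v 1 ^ 3
    + 20 * u 0 ^ 2 * v 0 ^ 2 * u 1 - 120 * u 0 * v 0 ^ 3 * u 1 - 308 * u 0 * v 0 * u 1 * v 1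
    - 60 * v 0 ^ 4 * u 1 + 384 * v 0 ^ 2 * v 1 ^ 2 + 18 * v 0 ^ 6 + 10 * u 0 ^ 4 * v 0 ^ 2
    - 62 * u 0 ^ 2 * v 1 ^ 2 - 60 * u 0 ^ 2 * v 0 ^ 4)

/-- The right-hand side `F₁ = (u_t, v_t)` of the system as a vector of differential polynomials. -/
def flow (R : Type*) [CommRing R] : Fin 2 → DiffPoly R :=
  ![flowU (jet R 0) (jet R 1), flowV (jet R 0) (jet R 1)]

/-- `J = diag (3 D_x, D_x)`. -/
def opJ (R : Type*) [CommRing R] : Matrix (Fin 2) (Fin 2) (DiffOp R) :=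
  !![.coeff 3 * .der, 0; 0, .der]

/-- The local part of `K₁`. -/
def opK1 (R : Type*) [CommRing R] : DiffOp R :=
  let a1 := DiffOp.coeff (alpha1 (jet R 0) (jet R 1))
  let a2 := DiffOp.coeff (alpha2 (jet R 0) (jet R 1))
  let a3 := DiffOp.coeff (alpha3 (jet R 0) (jet R 1))
  .coeff 2 * .der ^ 7 + a1 * .der ^ 5 + .der ^ 5 * a1 + a2 * .der ^ 3 + .der ^ 3 * a2
    + a3 * .der + .der * a3

/-- The local part of `K₂`. -/
def opK2 (R : Type*) [CommRing R] : DiffOp R :=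
  .coeff (-56) * .der ^ 6 * .coeff (jet R 1 0)
    + .der ^ 5 * .coeff (alpha4 (jet R 0) (jet R 1))
    + .der ^ 4 * .coeff (alpha5 (jet R 0) (jet R 1))
    + .der ^ 3 * .coeff (alpha6 (jet R 0) (jet R 1))
    + .der ^ 2 * .coeff (alpha7 (jet R 0) (jet R 1))
    + .der * .coeff (alpha8 (jet R 0) (jet R 1))
    + .coeff (alpha9 (jet R 0) (jet R 1))

/-- The local part of `K₄`. -/
def opK4 (R : Type*) [CommRing R] : DiffOp R :=
  let a10 := DiffOp.coeff (alpha10 (jet R 0) (jet R 1))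
  let a11 := DiffOp.coeff (alpha11 (jet R 0) (jet R 1))
  let a12 := DiffOp.coeff (alpha12 (jet R 0) (jet R 1))
  .coeff (-18) * .der ^ 7 + a10 * .der ^ 5 + .der ^ 5 * a10 + a11 * .der ^ 3 + .der ^ 3 * a11
    + a12 * .der + .der * a12

/-- The vectors `(u_x, v_x)` and `(u_t, v_t)` in the nonlocal tail of `K`, where `u_t, v_t` stand
for the right-hand side of the system. -/
def tailK (R : Type*) [CommRing R] : Fin 2 → Fin 2 → DiffPoly R :=
  ![![jet R 0 1, jet R 1 1], flow R]

/-- The operator `K = (K₁, K₂; -K₂*, K₄)`. Its tail is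
`4 (u_x, v_x)ᵀ D_x⁻¹ (u_t, v_t) + 4 (u_t, v_t)ᵀ D_x⁻¹ (u_x, v_x)`; this includes the tail of
`-K₂*`, since `-(f D_x⁻¹ g)* = g D_x⁻¹ f`. -/
def opK (R : Type*) [CommRing R] : WNLOp (tailK R) where
  loc := !![opK1 R, opK2 R; -(opK2 R).adjoint, opK4 R]
  tail := !![0, 4; 4, 0]

end

noncomputable section


/-! ## Calculus of differential operators -/

namespace DiffOp

section Action

variable {R : Type*} [CommRing R] {B : Type*} [CommRing B] [Algebra R B]
  (e : DiffPoly R →+* B) (d : Derivation R B B)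

/-! The reduction to the Kupershmidt equation and the two Hamiltonian forms are direct calculations.
The substance is the vanishing of the trivectors of `K` and `K + λ J`. Expanding them would be
enormous, so they are killed by a symmetry argument that needs only one finite calculation,
quadratic in the data of the system.

Let `w 0 = (u_x, v_x)` and `w 1 = F₁` be the tail vectors. They are commuting flows. Call `K`
invariant under a flow `W` with Fréchet derivative `L` if `K_t = L K + K L*`. Equivalently, when
covectors evolve by `P_t = -L* P`, the vector `K P` evolves by `L`. Under translation this is
automatic, since the Lie derivative is then `D_x`. Under `F₁` the nonlocal terms match because the
flows commute, and what is left is an identity between local operators (`isInvariant_of_loc`). It is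
linear in the operator and holds for `J` too, hence for `K + λ J`.

The trivector `T` of an invariant skew operator is itself invariant (`integral_lieDeriv_trivector`):
its Lie derivative reduces to second Fréchet derivatives of `W`, which cancel by symmetry.
Invariance under the tail flows also makes the coefficient of every potential of `P₂` in `T` a total
derivative. Integration by parts therefore gives `T = ∫ P₂ · E` with `E` bilinear in `P₀, P₁`, and
invariance of `T` becomes the evolution equation `E_t = L E` (`exists_trivector_eq`).

Now regard `E` as an operator on `P₀` with coefficients linear in `P₁`. The linear parts of the flow
are `c_0 u_{5x}` and `c_1 v_{5x}` with `c = (1, -9)`. Let `a` be the coefficient of the highest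
derivative of `P₀` in the entry `(i, j)`. The top order of `E_t = L E` gives `(c_j - c_i) a = 0`,
which kills the off-diagonal entries. On the diagonal the next order gives `5 c_j D_x a = 0`. An
expression linear in a covector is never a nonzero constant, provided that the tail vectors are
linearly independent, so `a = 0`. Descending through all orders, including those carried by the
potentials, gives `E = 0` (`eq_zero_of_lieDeriv_eq`).

The remaining identity is checked by kernel evaluation of sparse polynomials with integer
coefficients, with a soundness relation `Den` that transports the result to any commutative ring. -/

@[simp] theorem act_coeff (a : DiffPoly R) (f : B) : (coeff a).act e d f = e a * f := rfl

@[simp] theorem act_der (f : B) : (der : DiffOp R).act e d f = d f := rfl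

@[simp] theorem act_add (L M : DiffOp R) (f : B) :
    (L + M).act e d f = L.act e d f + M.act e d f := rfl

@[simp] theorem act_mul (L M : DiffOp R) (f : B) :
    (L * M).act e d f = L.act e d (M.act e d f) := rfl

@[simp] theorem act_neg (L : DiffOp R) (f : B) : (-L).act e d f = -L.act e d f := by
  change e (-1) * L.act e d f = _
  simp

@[simp] theorem act_zero (f : B) : (0 : DiffOp R).act e d f = 0 := by
  change e 0 * f = 0
  simp

@[simp] theorem act_pow (L : DiffOp R) (n : ℕ) (f : B) :
    (L ^ n).act e d f = (L.act e d)^[n] f := by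
  induction n generalizing f with
  | zero =>
    change e 1 * f = f
    simp
  | succ n ih =>
    change L.act e d ((L ^ n).act e d f) = _
    rw [ih, Function.iterate_succ_apply']

@[simp] theorem adjoint_coeff (a : DiffPoly R) : (coeff a).adjoint = coeff a := rfl

@[simp] theorem adjoint_der : (der : DiffOp R).adjoint = -der := rfl

@[simp] theorem adjoint_add (L M : DiffOp R) : (L + M).adjoint = L.adjoint + M.adjoint := rfl

@[simp] theorem adjoint_mul (L M : DiffOp R) : (L * M).adjoint = M.adjoint * L.adjoint := rfl

@[simp] theorem adjoint_zero : (0 : DiffOp R).adjoint = 0 := rfl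

/-- Negation is composition with the coefficient `-1` on the left, so its adjoint carries `-1` on
the right. The two sides are different expressions and agree only through their action, by
linearity. -/
theorem act_adjoint_neg (L : DiffOp R) (f : B) :
    (-L).adjoint.act e d f = -L.adjoint.act e d f := by
  change L.adjoint.act e d (e (-1) * f) = _
  have h : ∀ (L : DiffOp R) (f : B), L.act e d (e (-1) * f) = -L.act e d f := by
    intro L
    induction L with
    | coeff a => intro f; simp
    | der => intro f; simp
    | add L M hL hM =>
      intro f
      change L.act e d _ + M.act e d _ = -(L.act e d _ + M.act e d _)
      rw [hL, hM, neg_add]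
    | comp L M hL hM =>
      intro f
      change L.act e d (M.act e d _) = -(L.act e d (M.act e d _))
      have := hL (M.act e d f)
      rw [hM]
      rw [← this]
      simp
  exact h _ f

/-- The action of a differential operator, as a linear map. -/
def actₗ : DiffOp R → B →ₗ[R] B
  | coeff a => LinearMap.mulLeft R (e a)
  | der => d.toLinearMap
  | add L M => actₗ L + actₗ M
  | comp L M => actₗ L ∘ₗ actₗ M

theorem actₗ_apply (L : DiffOp R) (f : B) : actₗ e d L f = L.act e d f := by
  induction L generalizing f with
  | coeff a => rfl
  | der => rfl
  | add L M hL hM =>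
    change actₗ e d L f + actₗ e d M f = L.act e d f + M.act e d f
    rw [hL, hM]
  | comp L M hL hM =>
    change actₗ e d L (actₗ e d M f) = L.act e d (M.act e d f)
    rw [hL, hM]

theorem act_map_add (L : DiffOp R) (f g : B) :
    L.act e d (f + g) = L.act e d f + L.act e d g := by
  simp only [← actₗ_apply, map_add]

theorem act_map_neg (L : DiffOp R) (f : B) : L.act e d (-f) = -L.act e d f := by
  simp only [← actₗ_apply, map_neg]

theorem act_map_zero (L : DiffOp R) : L.act e d 0 = 0 := by
  simp only [← actₗ_apply, map_zero]

theorem act_map_smul (L : DiffOp R) (r : R) (f : B) :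
    L.act e d (r • f) = r • L.act e d f := by
  simp only [← actₗ_apply, map_smul]

theorem act_map_sum {ι : Type*} (L : DiffOp R) (s : Finset ι) (f : ι → B) :
    L.act e d (∑ i ∈ s, f i) = ∑ i ∈ s, L.act e d (f i) := by
  simp only [← actₗ_apply, map_sum]

theorem act_adjoint_adjoint (L : DiffOp R) (f : B) :
    L.adjoint.adjoint.act e d f = L.act e d f := by
  induction L generalizing f with
  | coeff a => rfl
  | der =>
    change (-der : DiffOp R).adjoint.act e d f = _
    rw [act_adjoint_neg]
    simp
  | add L M hL hM =>
    change L.adjoint.adjoint.act e d f + M.adjoint.adjoint.act e d f = L.act e d f + M.act e d f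
    rw [hL, hM]
  | comp L M hL hM =>
    change L.adjoint.adjoint.act e d (M.adjoint.adjoint.act e d f) = L.act e d (M.act e d f)
    rw [hL, hM]

/-- The bilinear concomitant: `(L f) g - f (L* g)` is the total derivative of `conc L f g`. -/
def conc : DiffOp R → B → B → B
  | coeff _, _, _ => 0
  | der, f, g => f * g
  | add L M, f, g => conc L f g + conc M f g
  | comp L M, f, g => conc L (M.act e d f) g + conc M f (L.adjoint.act e d g)

/-- Green's identity. For a composition the two fluxes telescope: `L` is moved off `M f` first, then
`M` off `f`. -/
theorem deriv_conc (L : DiffOp R) (f g : B) :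
    d (L.conc e d f g) = L.act e d f * g - f * L.adjoint.act e d g := by
  induction L generalizing f g with
  | coeff a =>
    change d 0 = e a * f * g - f * (e a * g)
    rw [map_zero]; ring
  | der =>
    change d (f * g) = d f * g - f * (-der : DiffOp R).act e d g
    simp only [Derivation.leibniz, smul_eq_mul, act_neg, act_der]; ring
  | add L M hL hM =>
    change d (conc e d L f g + conc e d M f g) = (L.act e d f + M.act e d f) * g -
      f * (L.adjoint.act e d g + M.adjoint.act e d g)
    rw [map_add, hL, hM]; ring
  | comp L M hL hM =>
    change d (conc e d L (M.act e d f) g + conc e d M f (L.adjoint.act e d g)) =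
      L.act e d (M.act e d f) * g - f * M.adjoint.act e d (L.adjoint.act e d g)
    rw [map_add, hL, hM]; ring

theorem conc_add_left (L : DiffOp R) (f f' g : B) :
    L.conc e d (f + f') g = L.conc e d f g + L.conc e d f' g := by
  induction L generalizing f f' g with
  | coeff a => simp [conc]
  | der => simp [conc, add_mul]
  | add L M hL hM => simp only [conc, hL, hM]; ring
  | comp L M hL hM => simp only [conc, act_map_add, hL, hM]; ring

theorem conc_smul_left (L : DiffOp R) (r : R) (f g : B) :
    L.conc e d (r • f) g = r • L.conc e d f g := by
  induction L generalizing f g with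
  | coeff a => simp [conc]
  | der => simp [conc]
  | add L M hL hM => simp only [conc, hL, hM, smul_add]
  | comp L M hL hM => simp only [conc, act_map_smul, hL, hM, smul_add]

theorem conc_zero_left (L : DiffOp R) (g : B) : L.conc e d 0 g = 0 := by
  simpa using conc_smul_left e d L 0 0 g

theorem conc_zero_right (L : DiffOp R) (f : B) : L.conc e d f 0 = 0 := by
  induction L generalizing f with
  | coeff a => simp [conc]
  | der => simp [conc]
  | add L M hL hM => simp only [conc, hL, hM, add_zero]
  | comp L M hL hM => simp only [conc, act_map_zero, hL, hM, add_zero]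

theorem conc_sum_left {ι : Type*} (L : DiffOp R) (s : Finset ι) (f : ι → B) (g : B) :
    L.conc e d (∑ i ∈ s, f i) g = ∑ i ∈ s, L.conc e d (f i) g := by
  classical
  induction s using Finset.induction_on with
  | empty => simp [conc_zero_left]
  | insert a s ha ih => rw [Finset.sum_insert ha, Finset.sum_insert ha, conc_add_left, ih]

/-- The part of `L (f p)` in which at least one derivative falls on `p`, as a function of
`g = d p`. -/
def leib : DiffOp R → B → B → B
  | coeff _, _, _ => 0
  | der, f, g => f * g
  | add L M, f, g => leib L f g + leib M f g
  | comp L M, f, g => leib L (M.act e d f) g + L.act e d (leib M f g)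

/-- Meant for `p` a potential: the undifferentiated `p` is the only nonlocal term, and everything
else depends on `p` only through the local expression `d p`. -/
theorem act_mul_eq_leib (L : DiffOp R) (f p : B) :
    L.act e d (f * p) = L.act e d f * p + L.leib e d f (d p) := by
  induction L generalizing f with
  | coeff a =>
    change e a * (f * p) = e a * f * p + 0
    ring
  | der =>
    change d (f * p) = d f * p + f * d p
    simp only [Derivation.leibniz, smul_eq_mul]; ring
  | add L M hL hM =>
    change L.act e d (f * p) + M.act e d (f * p) = (L.act e d f + M.act e d f) * p +
      (L.leib e d f (d p) + M.leib e d f (d p))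
    rw [hL, hM]; ring
  | comp L M hL hM =>
    change L.act e d (M.act e d (f * p)) = L.act e d (M.act e d f) * p +
      (L.leib e d (M.act e d f) (d p) + L.act e d (M.leib e d f (d p)))
    rw [hM, act_map_add, hL]; ring

theorem leib_add_right (L : DiffOp R) (f g g' : B) :
    L.leib e d f (g + g') = L.leib e d f g + L.leib e d f g' := by
  induction L generalizing f g g' with
  | coeff a => simp [leib]
  | der => simp [leib, mul_add]
  | add L M hL hM => simp only [leib, hL, hM]; ring
  | comp L M hL hM => simp only [leib, act_map_add, hL, hM]; ring

theorem leib_zero_right (L : DiffOp R) (f : B) : L.leib e d f 0 = 0 := by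
  simpa using leib_add_right e d L f 0 0

theorem leib_sum_right {ι : Type*} (L : DiffOp R) (s : Finset ι) (f : B) (g : ι → B) :
    L.leib e d f (∑ i ∈ s, g i) = ∑ i ∈ s, L.leib e d f (g i) := by
  classical
  induction s using Finset.induction_on with
  | empty => simp [leib_zero_right]
  | insert a s ha ih => rw [Finset.sum_insert ha, Finset.sum_insert ha, leib_add_right, ih]

/-- `vary δ L` is the operator obtained from `L` by letting `δ` act on its coefficients. -/
def vary (δ : Derivation R B B) : DiffOp R → B → B
  | coeff a, f => δ (e a) * f
  | der, _ => 0
  | add L M, f => vary δ L f + vary δ M f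
  | comp L M, f => vary δ L (M.act e d f) + L.act e d (vary δ M f)

theorem act_mem (S : Subalgebra R B) (he : ∀ a, e a ∈ S) (hd : ∀ f ∈ S, d f ∈ S) (L : DiffOp R)
    {f : B} (hf : f ∈ S) : L.act e d f ∈ S := by
  induction L generalizing f with
  | coeff a => exact S.mul_mem (he a) hf
  | der => exact hd f hf
  | add L M hL hM => exact S.add_mem (hL hf) (hM hf)
  | comp L M hL hM => exact hL (hM hf)

theorem conc_mem (S : Subalgebra R B) (he : ∀ a, e a ∈ S) (hd : ∀ f ∈ S, d f ∈ S) (L : DiffOp R)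
    {f g : B} (hf : f ∈ S) (hg : g ∈ S) : L.conc e d f g ∈ S := by
  induction L generalizing f g with
  | coeff a => exact S.zero_mem
  | der => exact S.mul_mem hf hg
  | add L M hL hM => exact S.add_mem (hL hf hg) (hM hf hg)
  | comp L M hL hM =>
    exact S.add_mem (hL (act_mem e d S he hd M hf) hg) (hM hf (act_mem e d S he hd _ hg))

variable {e d} in
/-- The product rule for a derivation that commutes with `d` on a differential subalgebra. -/
theorem deriv_act_of_mem (δ : Derivation R B B) (S : Subalgebra R B) (he : ∀ a, e a ∈ S)
    (hd : ∀ f ∈ S, d f ∈ S) (hδ : ∀ f ∈ S, δ (d f) = d (δ f)) (L : DiffOp R) {f : B} (hf : f ∈ S) :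
    δ (L.act e d f) = L.vary e d δ f + L.act e d (δ f) := by
  induction L generalizing f with
  | coeff a =>
    change δ (e a * f) = δ (e a) * f + e a * δ f
    simp only [Derivation.leibniz, smul_eq_mul]; ring
  | der =>
    change δ (d f) = 0 + d (δ f)
    rw [hδ f hf, zero_add]
  | add L M hL hM =>
    change δ (L.act e d f + M.act e d f) = (L.vary e d δ f + M.vary e d δ f) +
      (L.act e d (δ f) + M.act e d (δ f))
    rw [map_add, hL hf, hM hf]; ring
  | comp L M hL hM =>
    change δ (L.act e d (M.act e d f)) = (L.vary e d δ (M.act e d f) +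
      L.act e d (M.vary e d δ f)) + L.act e d (M.act e d (δ f))
    rw [hL (act_mem e d S he hd M hf), hM hf, act_map_add]; ring

theorem vary_eq_zero {δ : Derivation R B B} (hδ : ∀ a, δ (e a) = 0) (L : DiffOp R) (f : B) :
    L.vary e d δ f = 0 := by
  induction L generalizing f with
  | coeff a => simp [vary, hδ]
  | der => rfl
  | add L M hL hM => simp [vary, hL, hM]
  | comp L M hL hM => simp [vary, hL, hM, act_map_zero]

variable {e d} in
/-- A derivation that commutes with `d` and kills the coefficients commutes with operators. -/
theorem deriv_act (δ : Derivation R B B) (he : ∀ a, δ (e a) = 0)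
    (hδ : ∀ f, δ (d f) = d (δ f)) (L : DiffOp R) (f : B) :
    δ (L.act e d f) = L.act e d (δ f) := by
  rw [deriv_act_of_mem δ ⊤ (fun _ => trivial) (fun _ _ => trivial) (fun f _ => hδ f) L trivial,
    vary_eq_zero e d he, zero_add]

variable {e d} in
theorem deriv_conc_of_commute (δ : Derivation R B B) (he : ∀ a, δ (e a) = 0)
    (hδ : ∀ f, δ (d f) = d (δ f)) (L : DiffOp R) (f g : B) :
    δ (L.conc e d f g) = L.conc e d (δ f) g + L.conc e d f (δ g) := by
  induction L generalizing f g with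
  | coeff a => simp [conc]
  | der => simp only [conc, Derivation.leibniz, smul_eq_mul]; ring
  | add L M hL hM => simp only [conc, map_add, hL, hM]; ring
  | comp L M hL hM =>
    simp only [conc, map_add, hL, hM, deriv_act δ he hδ]; ring

end Action

/-! ### Functionals: densities modulo total derivatives -/

section Quotient

variable {R : Type*} [CommRing R] {B : Type*} [CommRing B] [Algebra R B]
  (e : DiffPoly R →+* B) (d : Derivation R B B)

/-- The class of a density modulo total derivatives. -/
def integral : B →ₗ[R] B ⧸ LinearMap.range d.toLinearMap :=
  (LinearMap.range d.toLinearMap).mkQ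

theorem integral_eq_zero_iff {f : B} : integral d f = 0 ↔ ∃ h, f = d h := by
  rw [integral, Submodule.mkQ_apply, Submodule.Quotient.mk_eq_zero, LinearMap.mem_range]
  exact ⟨fun ⟨h, hh⟩ => ⟨h, hh.symm⟩, fun ⟨h, hh⟩ => ⟨h, hh.symm⟩⟩

@[simp] theorem integral_deriv (f : B) : integral d (d f) = 0 :=
  (integral_eq_zero_iff d).2 ⟨f, rfl⟩

theorem integral_deriv_mul (f g : B) : integral d (d f * g) = -integral d (f * d g) := by
  rw [eq_neg_iff_add_eq_zero, ← map_add, integral_eq_zero_iff]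
  exact ⟨f * g, by simp only [Derivation.leibniz, smul_eq_mul]; ring⟩

theorem integral_mul_deriv (f g : B) : integral d (f * d g) = -integral d (d f * g) := by
  rw [integral_deriv_mul, neg_neg]

/-- Integration by parts. -/
theorem integral_act_mul (L : DiffOp R) (f g : B) :
    integral d (L.act e d f * g) = integral d (f * L.adjoint.act e d g) := by
  rw [← sub_eq_zero, ← map_sub, ← deriv_conc, integral_deriv]

theorem integral_mul_act (L : DiffOp R) (f g : B) :
    integral d (f * L.act e d g) = integral d (L.adjoint.act e d f * g) := by
  rw [mul_comm, integral_act_mul, mul_comm]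

/-- Varying the coefficients commutes with taking the adjoint, because `d` itself has nothing to
vary. -/
theorem integral_mul_vary (δ : Derivation R B B) (L : DiffOp R) (f g : B) :
    integral d (g * L.vary e d δ f) = integral d (f * L.adjoint.vary e d δ g) := by
  induction L generalizing f g with
  | coeff a =>
    change integral d (g * (δ (e a) * f)) = integral d (f * (δ (e a) * g))
    congr 1; ring
  | der =>
    change integral d (g * 0) = integral d (f * (δ (e (-1)) * d g + e (-1) * 0))
    simp
  | add L M hL hM =>
    change integral d (g * (L.vary e d δ f + M.vary e d δ f)) =
      integral d (f * (L.adjoint.vary e d δ g + M.adjoint.vary e d δ g))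
    simp only [mul_add, map_add, hL, hM]
  | comp L M hL hM =>
    change integral d (g * (L.vary e d δ (M.act e d f) + L.act e d (M.vary e d δ f))) =
      integral d (f * (M.adjoint.vary e d δ (L.adjoint.act e d g) +
        M.adjoint.act e d (L.adjoint.vary e d δ g)))
    simp only [mul_add, map_add, hL]
    rw [integral_mul_act e d L, hM, integral_act_mul, add_comm]

end Quotient

end DiffOp


/-! ## The universal differential ring -/

namespace WNLOp

variable {R : Type*} [CommRing R] {m : ℕ}

@[simp] theorem emb_C (r : R) : emb R m (C r) = C r := by simp [emb]

@[simp] theorem emb_jet (i : Fin 2) (n : ℕ) : emb R m (jet R i n) = X (ExtVar.fld i n) := by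
  simp [emb, jet]

@[simp] theorem totalDeriv_jet (i : Fin 2) (n : ℕ) :
    totalDeriv R (jet R i n) = jet R i (n + 1) := by
  simp [totalDeriv, jet]

variable (w : Fin m → Fin 2 → DiffPoly R)

@[simp] theorem extDeriv_fld (i : Fin 2) (n : ℕ) :
    extDeriv w (X (ExtVar.fld i n)) = X (ExtVar.fld i (n + 1)) := by simp [extDeriv]

@[simp] theorem extDeriv_cov (s : Fin 3) (i : Fin 2) (n : ℕ) :
    extDeriv w (X (ExtVar.cov s i n)) = X (ExtVar.cov s i (n + 1)) := by simp [extDeriv]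

@[simp] theorem extDeriv_pot (s : Fin 3) (a : Fin m) :
    extDeriv w (X (ExtVar.pot s a)) = ∑ i, emb R m (w a i) * cov R m s i := by
  simp [extDeriv]

theorem iterate_extDeriv_fld (i : Fin 2) (n k : ℕ) :
    (extDeriv w)^[n] (X (ExtVar.fld i k)) = X (ExtVar.fld i (k + n)) := by
  induction n with
  | zero => rfl
  | succ n ih => rw [Function.iterate_succ_apply', ih, extDeriv_fld, add_assoc]

theorem iterate_extDeriv_cov (s : Fin 3) (i : Fin 2) (n : ℕ) :
    (extDeriv w)^[n] (cov R m s i) = X (ExtVar.cov s i n) := by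
  induction n with
  | zero => rfl
  | succ n ih => rw [Function.iterate_succ_apply', ih, extDeriv_cov]

@[simp] theorem evol_fld (Q : Fin 2 → ExtPoly R m) (i : Fin 2) (n : ℕ) :
    evol w Q (X (ExtVar.fld i n)) = (extDeriv w)^[n] (Q i) := by simp [evol]

@[simp] theorem evol_cov (Q : Fin 2 → ExtPoly R m) (s : Fin 3) (i : Fin 2) (n : ℕ) :
    evol w Q (X (ExtVar.cov s i n)) = 0 := by simp [evol]

@[simp] theorem evol_cov' (Q : Fin 2 → ExtPoly R m) (s : Fin 3) (i : Fin 2) :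
    evol w Q (cov R m s i) = 0 := evol_cov w Q s i 0

@[simp] theorem evol_pot (Q : Fin 2 → ExtPoly R m) (s : Fin 3) (a : Fin m) :
    evol w Q (X (ExtVar.pot s a)) = 0 := by simp [evol]

/-- Differential polynomials: it is enough to compare derivations along `emb` on jets. -/
theorem eq_on_emb {D₁ D₂ : Derivation R (ExtPoly R m) (ExtPoly R m)}
    (h : ∀ i n, D₁ (X (ExtVar.fld i n)) = D₂ (X (ExtVar.fld i n))) (f : DiffPoly R) :
    D₁ (emb R m f) = D₂ (emb R m f) := by
  induction f using MvPolynomial.induction_on with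
  | C r => simp
  | add p q hp hq => simp only [map_add, hp, hq]
  | mul_X p v hp =>
    have : emb R m (X v) = X (ExtVar.fld v.1 v.2) := by simp [emb]
    simp only [map_mul, Derivation.leibniz, hp, this, h]

theorem extDeriv_emb (f : DiffPoly R) :
    extDeriv w (emb R m f) = emb R m (totalDeriv R f) := by
  induction f using MvPolynomial.induction_on with
  | C r =>
    simp only [emb_C, derivation_C, map_zero]
  | add p q hp hq => simp only [map_add, hp, hq]
  | mul_X p v hp =>
    have h1 : emb R m (X v) = X (ExtVar.fld v.1 v.2) := by simp [emb]
    have h2 : totalDeriv R (X v) = jet R v.1 (v.2 + 1) := by simp [totalDeriv]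
    simp only [map_mul, Derivation.leibniz, hp, h1, h2, smul_eq_mul, map_add, extDeriv_fld,
      emb_jet]

theorem _root_.Derivation.finset_sum_apply {R B ι : Type*} [CommRing R] [CommRing B] [Algebra R B]
    (s : Finset ι) (D : ι → Derivation R B B) (f : B) : (∑ i ∈ s, D i) f = ∑ i ∈ s, D i f := by
  classical
  induction s using Finset.induction_on with
  | empty => simp
  | insert a s ha ih => rw [Finset.sum_insert ha, Finset.sum_insert ha, Derivation.add_apply, ih]

/-- The commutator of an evolutionary vector field with the total derivative. -/
theorem evol_extDeriv (Q : Fin 2 → ExtPoly R m) (f : ExtPoly R m) :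
    evol w Q (extDeriv w f) = extDeriv w (evol w Q f) +
      ∑ s, ∑ a, (∑ i, evol w Q (emb R m (w a i)) * cov R m s i) *
        pderiv (ExtVar.pot s a) f := by
  -- Both sides are derivations, so it is enough to compare them on variables. They differ from zero
  -- only on potentials: the field kills the potential but not its derivative `w a · P_s`.
  have key : ⁅evol w Q, extDeriv w⁆ = ∑ s : Fin 3, ∑ a : Fin m,
      (∑ i, evol w Q (emb R m (w a i)) * cov R m s i) •
        (pderiv (ExtVar.pot s a) : Derivation R (ExtPoly R m) (ExtPoly R m)) := by
    classical
    apply derivation_ext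
    intro v
    rw [Derivation.commutator_apply]
    simp only [Derivation.finset_sum_apply, Derivation.smul_apply,
      smul_eq_mul]
    cases v with
    | fld i n =>
      simp only [extDeriv_fld, evol_fld, Function.iterate_succ_apply', sub_self]
      symm
      refine Finset.sum_eq_zero fun s _ => Finset.sum_eq_zero fun a _ => ?_
      rw [pderiv_X_of_ne (by simp), mul_zero]
    | cov s i n =>
      simp only [extDeriv_cov, evol_cov, map_zero, sub_self]
      symm
      refine Finset.sum_eq_zero fun s _ => Finset.sum_eq_zero fun a _ => ?_
      rw [pderiv_X_of_ne (by simp), mul_zero]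
    | pot s a =>
      simp only [extDeriv_pot, evol_pot, map_zero, sub_zero, map_sum, Derivation.leibniz,
        smul_eq_mul, evol_cov', mul_zero, zero_add]
      rw [Finset.sum_eq_single s, Finset.sum_eq_single a]
      · rw [pderiv_X_self, mul_one]
        exact Finset.sum_congr rfl fun i _ => mul_comm _ _
      · intro b _ hb
        rw [pderiv_X_of_ne (by simpa using hb.symm), mul_zero]
      · simp
      · intro t _ ht
        refine Finset.sum_eq_zero fun b _ => ?_
        rw [pderiv_X_of_ne (by simpa using fun h => absurd h.symm ht), mul_zero]
      · simp
  have := DFunLike.congr_fun key f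
  simp only [Derivation.commutator_apply, Derivation.finset_sum_apply, Derivation.smul_apply, smul_eq_mul] at this
  rw [← this]; ring

theorem pderiv_pot_emb (s : Fin 3) (a : Fin m) (f : DiffPoly R) :
    pderiv (ExtVar.pot s a) (emb R m f) = 0 := by
  have := eq_on_emb (D₁ := pderiv (ExtVar.pot s a)) (D₂ := (0 : Derivation R (ExtPoly R m) _))
    (fun i n => by rw [pderiv_X_of_ne (by simp)]; rfl) f
  simpa using this

theorem pderiv_cov_emb (s : Fin 3) (i : Fin 2) (n : ℕ) (f : DiffPoly R) :
    pderiv (ExtVar.cov s i n) (emb R m f) = 0 := by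
  have := eq_on_emb (D₁ := pderiv (ExtVar.cov s i n)) (D₂ := (0 : Derivation R (ExtPoly R m) _))
    (fun i n => by rw [pderiv_X_of_ne (by simp)]; rfl) f
  simpa using this

theorem pderiv_pot_cov (s t : Fin 3) (a : Fin m) (i : Fin 2) :
    pderiv (ExtVar.pot s a) (cov R m t i) = 0 := pderiv_X_of_ne (by simp)

/-- The total derivative of a potential contains no potential, so `D_x` is constant in these
variables. -/
theorem pderiv_pot_extDeriv (s : Fin 3) (a : Fin m) (f : ExtPoly R m) :
    pderiv (ExtVar.pot s a) (extDeriv w f) = extDeriv w (pderiv (ExtVar.pot s a) f) := by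
  classical
  have key : ⁅(pderiv (ExtVar.pot s a) : Derivation R (ExtPoly R m) (ExtPoly R m)),
      extDeriv w⁆ = 0 := by
    apply derivation_ext
    intro v
    rw [Derivation.commutator_apply]
    cases v with
    | fld i n => simp
    | cov t i n => simp
    | pot t b =>
      simp only [extDeriv_pot, map_sum, Derivation.leibniz, pderiv_pot_emb, pderiv_pot_cov,
        pderiv_X, Pi.single_apply]
      split_ifs <;> simp
  have := DFunLike.congr_fun key f
  simp only [Derivation.commutator_apply] at this
  exact sub_eq_zero.1 this

/-- The elements of the universal ring that do not involve potentials. -/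
def potFree (R : Type*) [CommRing R] (m : ℕ) : Subalgebra R (ExtPoly R m) where
  carrier := {f | ∀ s a, pderiv (ExtVar.pot s a) f = 0}
  mul_mem' := by
    intro f g hf hg s a
    simp [Derivation.leibniz, hf s a, hg s a]
  add_mem' := by
    intro f g hf hg s a
    simp [hf s a, hg s a]
  algebraMap_mem' := by
    intro r s a
    simp

theorem emb_mem_potFree (f : DiffPoly R) : emb R m f ∈ potFree R m :=
  fun s a => pderiv_pot_emb s a f

theorem cov_mem_potFree (s : Fin 3) (i : Fin 2) : cov R m s i ∈ potFree R m :=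
  fun t a => pderiv_pot_cov t s a i

theorem extDeriv_mem_potFree {f : ExtPoly R m} (hf : f ∈ potFree R m) :
    extDeriv w f ∈ potFree R m := fun s a => by
  rw [pderiv_pot_extDeriv, hf s a, map_zero]

theorem iterate_extDeriv_mem_potFree {f : ExtPoly R m} (hf : f ∈ potFree R m) (n : ℕ) :
    (extDeriv w)^[n] f ∈ potFree R m := by
  induction n with
  | zero => exact hf
  | succ n ih =>
    rw [Function.iterate_succ_apply']
    exact extDeriv_mem_potFree w ih

theorem evol_extDeriv_of_mem (Q : Fin 2 → ExtPoly R m) {f : ExtPoly R m}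
    (hf : f ∈ potFree R m) : evol w Q (extDeriv w f) = extDeriv w (evol w Q f) := by
  rw [evol_extDeriv]
  simp [hf _ _]

theorem act_mem_potFree (L : DiffOp R) {f : ExtPoly R m} (hf : f ∈ potFree R m) :
    L.act (emb R m : DiffPoly R →+* ExtPoly R m) (extDeriv w) f ∈ potFree R m :=
  DiffOp.act_mem _ (extDeriv w) _ emb_mem_potFree (fun _ => extDeriv_mem_potFree w) L hf

theorem conc_mem_potFree (L : DiffOp R) {f g : ExtPoly R m} (hf : f ∈ potFree R m)
    (hg : g ∈ potFree R m) :
    L.conc (emb R m : DiffPoly R →+* ExtPoly R m) (extDeriv w) f g ∈ potFree R m :=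
  DiffOp.conc_mem _ (extDeriv w) _ emb_mem_potFree (fun _ => extDeriv_mem_potFree w) L hf hg

theorem evol_act (Q : Fin 2 → ExtPoly R m) (L : DiffOp R) {f : ExtPoly R m}
    (hf : f ∈ potFree R m) :
    evol w Q (L.act (emb R m : DiffPoly R →+* ExtPoly R m) (extDeriv w) f) =
      L.vary (emb R m : DiffPoly R →+* ExtPoly R m) (extDeriv w) (evol w Q) f +
        L.act (emb R m : DiffPoly R →+* ExtPoly R m) (extDeriv w) (evol w Q f) :=
  DiffOp.deriv_act_of_mem (evol w Q) _ emb_mem_potFree (fun _ => extDeriv_mem_potFree w)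
    (fun _ hf => evol_extDeriv_of_mem w Q hf) L hf

/-! ### Linearization -/

/-- The expansion of an evolutionary vector field in partial derivatives. -/
theorem exists_evol_emb_eq (f : DiffPoly R) : ∃ N₀, ∀ N ≥ N₀, ∀ Q : Fin 2 → ExtPoly R m,
    evol w Q (emb R m f) =
      ∑ k, ∑ n ∈ Finset.range N, emb R m (pderiv (k, n) f) * (extDeriv w)^[n] (Q k) := by
  classical
  induction f using MvPolynomial.induction_on with
  | C r => exact ⟨0, fun N _ Q => by simp⟩
  | add p q hp hq =>
    obtain ⟨N₁, h₁⟩ := hp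
    obtain ⟨N₂, h₂⟩ := hq
    refine ⟨max N₁ N₂, fun N hN Q => ?_⟩
    rw [map_add, map_add, h₁ N (le_trans (le_max_left _ _) hN),
      h₂ N (le_trans (le_max_right _ _) hN)]
    simp only [map_add, add_mul, Finset.sum_add_distrib]
  | mul_X p v hp =>
    obtain ⟨N₁, h₁⟩ := hp
    refine ⟨max N₁ (v.2 + 1), fun N hN Q => ?_⟩
    have hX : emb R m (X v) = X (ExtVar.fld v.1 v.2) := by simp [emb]
    have hv : v.2 ∈ Finset.range N :=
      Finset.mem_range.2 (lt_of_lt_of_le (Nat.lt_succ_self _) (le_trans (le_max_right _ _) hN))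
    have hsum : ∑ k, ∑ n ∈ Finset.range N,
        emb R m (p * pderiv (k, n) (X v)) * (extDeriv w)^[n] (Q k) =
          emb R m p * (extDeriv w)^[v.2] (Q v.1) := by
      rw [Finset.sum_eq_single v.1, Finset.sum_eq_single v.2]
      · rw [show ((v.1, v.2) : Fin 2 × ℕ) = v from rfl, pderiv_X_self, mul_one]
      · intro n _ hn
        rw [pderiv_X_of_ne (by intro h; exact hn (by rw [h]))]; simp
      · intro h; exact absurd hv h
      · intro k _ hk
        refine Finset.sum_eq_zero fun n _ => ?_
        rw [pderiv_X_of_ne (by intro h; exact hk (by rw [h]))]; simp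
      · simp
    rw [map_mul, Derivation.leibniz, hX, evol_fld, h₁ N (le_trans (le_max_left _ _) hN)]
    simp only [smul_eq_mul, Derivation.leibniz, map_add, add_mul, Finset.sum_add_distrib]
    rw [hsum]
    congr 1
    simp only [Finset.mul_sum, map_mul, hX]
    exact Finset.sum_congr rfl fun k _ => Finset.sum_congr rfl fun n _ => by ring

/-- The truncated Fréchet derivative `∑_{n < N} (∂f / ∂u_k^{(n)}) D_xⁿ`. -/
def linOp (f : DiffPoly R) (k : Fin 2) : ℕ → DiffOp R
  | 0 => 0
  | n + 1 => linOp f k n + DiffOp.coeff (pderiv (k, n) f) * DiffOp.der ^ n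

theorem act_linOp {B : Type*} [CommRing B] [Algebra R B] (e : DiffPoly R →+* B)
    (d : Derivation R B B) (f : DiffPoly R) (k : Fin 2) (N : ℕ) (g : B) :
    (linOp f k N).act e d g = ∑ n ∈ Finset.range N, e (pderiv (k, n) f) * d^[n] g := by
  induction N with
  | zero => simp [linOp]
  | succ N ih =>
    rw [Finset.sum_range_succ, ← ih]
    simp only [linOp, DiffOp.act_add, DiffOp.act_mul, DiffOp.act_coeff, DiffOp.act_pow]
    rfl

theorem vary_pow_der {B : Type*} [CommRing B] [Algebra R B] (e : DiffPoly R →+* B)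
    (d δ : Derivation R B B) (n : ℕ) (g : B) : (DiffOp.der ^ n).vary e d δ g = 0 := by
  induction n generalizing g with
  | zero =>
    change δ (e 1) * g = 0
    simp
  | succ n ih =>
    change 0 + d ((DiffOp.der ^ n).vary e d δ g) = 0
    rw [ih]; simp

theorem vary_linOp {B : Type*} [CommRing B] [Algebra R B] (e : DiffPoly R →+* B)
    (d δ : Derivation R B B) (f : DiffPoly R) (k : Fin 2) (N : ℕ) (g : B) :
    (linOp f k N).vary e d δ g = ∑ n ∈ Finset.range N, δ (e (pderiv (k, n) f)) * d^[n] g := by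
  induction N with
  | zero =>
    change δ (e 0) * g = _
    simp
  | succ N ih =>
    rw [Finset.sum_range_succ, ← ih]
    change (linOp f k N).vary e d δ g + (δ (e (pderiv (k, N) f)) * (DiffOp.der ^ N).act e d g +
      e (pderiv (k, N) f) * (DiffOp.der ^ N).vary e d δ g) = _
    rw [vary_pow_der, mul_zero, add_zero, DiffOp.act_pow]
    rfl

theorem evol_emb_eq_linOp {f : DiffPoly R} {N : ℕ} (hN : ∀ k, ∀ n ≥ N, pderiv (k, n) f = 0)
    (Q : Fin 2 → ExtPoly R m) : evol w Q (emb R m f) = ∑ k, (linOp f k N).act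
      (emb R m : DiffPoly R →+* ExtPoly R m) (extDeriv w) (Q k) := by
  obtain ⟨N₀, h⟩ := exists_evol_emb_eq w f
  rw [h (max N₀ N) (le_max_left _ _) Q]
  refine Finset.sum_congr rfl fun k _ => ?_
  rw [act_linOp]
  refine (Finset.sum_subset (Finset.range_mono (le_max_right _ _)) ?_).symm
  intro n _ hn
  rw [hN k n (by simpa using hn)]
  simp

theorem pderiv_comm (f : DiffPoly R) (v v' : Fin 2 × ℕ) :
    pderiv v (pderiv v' f) = pderiv v' (pderiv v f) := by
  classical
  have key : ⁅(pderiv v : Derivation R (DiffPoly R) (DiffPoly R)),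
      (pderiv v' : Derivation R (DiffPoly R) (DiffPoly R))⁆ = 0 := by
    apply derivation_ext
    intro i
    rw [Derivation.commutator_apply]
    simp only [pderiv_X, Pi.single_apply]
    split_ifs <;> simp
  have := DFunLike.congr_fun key f
  simp only [Derivation.commutator_apply] at this
  exact sub_eq_zero.1 this

/-- The second Fréchet derivative is symmetric. -/
theorem sum_vary_linOp_comm {f : DiffPoly R} {N : ℕ}
    (hN : ∀ k, ∀ n ≥ N, pderiv (k, n) f = 0) (Q Q' : Fin 2 → ExtPoly R m) :
    ∑ k, (linOp f k N).vary (emb R m : DiffPoly R →+* ExtPoly R m) (extDeriv w)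
        (evol w Q) (Q' k) =
      ∑ k, (linOp f k N).vary (emb R m : DiffPoly R →+* ExtPoly R m) (extDeriv w)
        (evol w Q') (Q k) := by
  classical
  have h : ∀ k n, ∃ N₀, ∀ N' ≥ N₀, ∀ Q : Fin 2 → ExtPoly R m,
      evol w Q (emb R m (pderiv (k, n) f)) = ∑ l, ∑ n' ∈ Finset.range N',
        emb R m (pderiv (l, n') (pderiv (k, n) f)) * (extDeriv w)^[n'] (Q l) := fun k n =>
    exists_evol_emb_eq w _
  choose M hM using h
  -- A single truncation order beyond all those involved puts both differentiations over the same
  -- index set, so that they can be interchanged.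
  set T := max N (∑ k, ∑ n ∈ Finset.range N, M k n) with hT
  have expand : ∀ Q Q' : Fin 2 → ExtPoly R m, ∑ k, (linOp f k N).vary
      (emb R m : DiffPoly R →+* ExtPoly R m) (extDeriv w) (evol w Q) (Q' k) =
      ∑ k, ∑ n ∈ Finset.range T, ∑ l, ∑ n' ∈ Finset.range T,
        emb R m (pderiv (l, n') (pderiv (k, n) f)) * (extDeriv w)^[n'] (Q l) *
          (extDeriv w)^[n] (Q' k) := by
    intro Q Q'
    refine Finset.sum_congr rfl fun k _ => ?_
    rw [vary_linOp]
    rw [← Finset.sum_subset (Finset.range_mono (le_max_left N _))]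
    · refine Finset.sum_congr rfl fun n hn => ?_
      change evol w Q (emb R m (pderiv (k, n) f)) * _ = _
      rw [hM k n T, Finset.sum_mul]
      · exact Finset.sum_congr rfl fun l _ => by rw [Finset.sum_mul]
      · refine le_trans ?_ (le_max_right _ _)
        refine le_trans ?_ (Finset.single_le_sum (fun _ _ => Nat.zero_le _) (Finset.mem_univ k))
        exact Finset.single_le_sum (f := fun n => M k n) (fun _ _ => Nat.zero_le _) hn
    · intro n _ hn
      refine Finset.sum_eq_zero fun l _ => Finset.sum_eq_zero fun n' _ => ?_
      rw [hN k n (by simpa using hn)]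
      simp
  rw [expand, expand]
  have swap : ∀ F : Fin 2 → ℕ → Fin 2 → ℕ → ExtPoly R m,
      ∑ k, ∑ n ∈ Finset.range T, ∑ l, ∑ n' ∈ Finset.range T, F k n l n' =
        ∑ k, ∑ n ∈ Finset.range T, ∑ l, ∑ n' ∈ Finset.range T, F l n' k n := by
    intro F
    have h := Finset.sum_comm (s := (Finset.univ : Finset (Fin 2)) ×ˢ Finset.range T)
      (t := (Finset.univ : Finset (Fin 2)) ×ˢ Finset.range T)
      (f := fun x y => F x.1 x.2 y.1 y.2)
    simpa only [Finset.sum_product] using h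
  rw [swap]
  refine Finset.sum_congr rfl fun k _ => Finset.sum_congr rfl fun n _ =>
    Finset.sum_congr rfl fun l _ => Finset.sum_congr rfl fun n' _ => ?_
  rw [pderiv_comm]; ring

end WNLOp


/-! ## Lie derivatives along symmetries -/

namespace WNLOp

variable {R : Type*} [CommRing R] {m : ℕ}

/-- The inclusion of differential polynomials as a ring homomorphism. -/
abbrev embHom (R : Type*) [CommRing R] (m : ℕ) : DiffPoly R →+* ExtPoly R m :=
  (emb R m : DiffPoly R →+* ExtPoly R m)

theorem embHom_apply (f : DiffPoly R) : embHom R m f = emb R m f := rfl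

variable (w : Fin m → Fin 2 → DiffPoly R)

/-- Action of a differential operator on the universal ring. -/
abbrev extAct (L : DiffOp R) (f : ExtPoly R m) : ExtPoly R m :=
  L.act (embHom R m) (extDeriv w) f

/-- Concomitant on the universal ring. -/
abbrev extConc (L : DiffOp R) (f g : ExtPoly R m) : ExtPoly R m :=
  L.conc (embHom R m) (extDeriv w) f g

/-- Variation of an operator on the universal ring. -/
abbrev extVary (δ : Derivation R (ExtPoly R m) (ExtPoly R m)) (L : DiffOp R) (f : ExtPoly R m) :
    ExtPoly R m :=
  L.vary (embHom R m) (extDeriv w) δ f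

/-- `L* P_s` for a matrix operator `L`. -/
def adjCov (L : Fin 2 → Fin 2 → DiffOp R) (s : Fin 3) (i : Fin 2) : ExtPoly R m :=
  ∑ j, extAct w (L j i).adjoint (cov R m s j)

/-- The concomitant of `w a` and `P_s` with respect to a matrix operator `L`. -/
def potConc (L : Fin 2 → Fin 2 → DiffOp R) (s : Fin 3) (a : Fin m) : ExtPoly R m :=
  ∑ j, ∑ i, extConc w (L j i) (emb R m (w a i)) (cov R m s j)

/-- The Lie derivative along the flow `u_t = W` with linearization `L`: covectors evolve by
`P_t = - L* P`, and potentials accordingly. -/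
def lieDeriv (W : Fin 2 → DiffPoly R) (L : Fin 2 → Fin 2 → DiffOp R) :
    Derivation R (ExtPoly R m) (ExtPoly R m) :=
  mkDerivation R fun
    | .fld i n => (extDeriv w)^[n] (emb R m (W i))
    | .cov s i n => (extDeriv w)^[n] (-adjCov w L s i)
    | .pot s a => potConc w L s a

/-- `L` is the linearization of `W`, and `W` commutes with the flows `w a`. -/
structure IsSymmetry (W : Fin 2 → DiffPoly R) (L : Fin 2 → Fin 2 → DiffOp R) : Prop where
  lin : ∀ (Q : Fin 2 → ExtPoly R m) i, evol w Q (emb R m (W i)) = ∑ j, extAct w (L i j) (Q j)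
  comm : ∀ a j, evol w (fun i => emb R m (w a i)) (emb R m (W j)) =
    evol w (fun i => emb R m (W i)) (emb R m (w a j))
  second : ∀ (Q Q' : Fin 2 → ExtPoly R m) i, ∑ k, extVary w (evol w Q) (L i k) (Q' k) =
    ∑ k, extVary w (evol w Q') (L i k) (Q k)

variable {w} {W : Fin 2 → DiffPoly R} {L : Fin 2 → Fin 2 → DiffOp R}

theorem adjCov_mem_potFree (s : Fin 3) (i : Fin 2) : adjCov w L s i ∈ potFree R m :=
  Subalgebra.sum_mem _ fun _ _ => act_mem_potFree w _ (cov_mem_potFree _ _)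

theorem potConc_mem_potFree (s : Fin 3) (a : Fin m) : potConc w L s a ∈ potFree R m :=
  Subalgebra.sum_mem _ fun _ _ => Subalgebra.sum_mem _ fun _ _ =>
    conc_mem_potFree w _ (emb_mem_potFree _) (cov_mem_potFree _ _)

theorem lieDeriv_fld (i : Fin 2) (n : ℕ) :
    lieDeriv w W L (X (ExtVar.fld i n)) = (extDeriv w)^[n] (emb R m (W i)) := by
  simp [lieDeriv]

theorem lieDeriv_cov_var (s : Fin 3) (i : Fin 2) (n : ℕ) :
    lieDeriv w W L (X (ExtVar.cov s i n)) = (extDeriv w)^[n] (-adjCov w L s i) := by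
  simp [lieDeriv]

theorem lieDeriv_cov (s : Fin 3) (i : Fin 2) :
    lieDeriv w W L (cov R m s i) = -adjCov w L s i := lieDeriv_cov_var s i 0

theorem lieDeriv_pot (s : Fin 3) (a : Fin m) :
    lieDeriv w W L (X (ExtVar.pot s a)) = potConc w L s a := by
  simp [lieDeriv]

theorem lieDeriv_emb (f : DiffPoly R) :
    lieDeriv w W L (emb R m f) = evol w (fun i => emb R m (W i)) (emb R m f) :=
  eq_on_emb (fun i n => by rw [lieDeriv_fld, evol_fld]) f

/-- This is the time derivative of `w a · P_s`. Green's identity produces `(L w a) · P_s - w a · L*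
P_s`, and `L w a` is the evolution of `w a` along `W` because the two flows commute. -/
theorem extDeriv_potConc (hW : IsSymmetry w W L) (s : Fin 3) (a : Fin m) :
    extDeriv w (potConc w L s a) =
      ∑ i, (evol w (fun i => emb R m (W i)) (emb R m (w a i)) * cov R m s i -
        emb R m (w a i) * adjCov w L s i) := by
  simp only [potConc, map_sum, DiffOp.deriv_conc, Finset.sum_sub_distrib]
  congr 1
  · refine Finset.sum_congr rfl fun j _ => ?_
    rw [← Finset.sum_mul, ← hW.comm a j, hW.lin]
  · rw [Finset.sum_comm]
    refine Finset.sum_congr rfl fun i _ => ?_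
    rw [adjCov, Finset.mul_sum]

/-- On fields and covectors this is built into the definition. On potentials it is the reason for
choosing the concomitant as their time derivative. -/
theorem lieDeriv_extDeriv (hW : IsSymmetry w W L) (f : ExtPoly R m) :
    lieDeriv w W L (extDeriv w f) = extDeriv w (lieDeriv w W L f) := by
  have key : ⁅lieDeriv w W L, extDeriv w⁆ = 0 := by
    apply derivation_ext
    intro v
    rw [Derivation.commutator_apply]
    cases v with
    | fld i n => simp [lieDeriv_fld, Function.iterate_succ_apply']
    | cov s i n =>
      simp only [extDeriv_cov, lieDeriv_cov_var, Function.iterate_succ_apply', sub_self,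
        Derivation.coe_zero, Pi.zero_apply]
    | pot s a =>
      rw [extDeriv_pot, lieDeriv_pot, extDeriv_potConc hW, map_sum, ← Finset.sum_sub_distrib]
      simp only [Derivation.coe_zero, Pi.zero_apply]
      refine Finset.sum_eq_zero fun i _ => ?_
      rw [Derivation.leibniz, lieDeriv_emb, lieDeriv_cov, smul_eq_mul, smul_eq_mul]; ring
  have := DFunLike.congr_fun key f
  rw [Derivation.commutator_apply] at this
  exact sub_eq_zero.1 this

theorem iterate_lieDeriv_extDeriv (hW : IsSymmetry w W L) (f : ExtPoly R m) (n : ℕ) :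
    lieDeriv w W L ((extDeriv w)^[n] f) = (extDeriv w)^[n] (lieDeriv w W L f) := by
  induction n with
  | zero => rfl
  | succ n ih => rw [Function.iterate_succ_apply', lieDeriv_extDeriv hW, ih,
      Function.iterate_succ_apply']

theorem pderiv_pot_lieDeriv (s : Fin 3) (a : Fin m) (f : ExtPoly R m) :
    pderiv (ExtVar.pot s a) (lieDeriv w W L f) =
      lieDeriv w W L (pderiv (ExtVar.pot s a) f) := by
  classical
  have key : ⁅(pderiv (ExtVar.pot s a) : Derivation R (ExtPoly R m) (ExtPoly R m)),
      lieDeriv w W L⁆ = 0 := by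
    apply derivation_ext
    intro v
    rw [Derivation.commutator_apply]
    cases v with
    | fld i n =>
      rw [lieDeriv_fld, pderiv_X_of_ne (by simp), map_zero,
        iterate_extDeriv_mem_potFree w (emb_mem_potFree _) n s a]
      simp
    | cov t i n =>
      rw [lieDeriv_cov_var, pderiv_X_of_ne (by simp), map_zero,
        iterate_extDeriv_mem_potFree w (Subalgebra.neg_mem _ (adjCov_mem_potFree _ _)) n s a]
      simp
    | pot t b =>
      rw [lieDeriv_pot, potConc_mem_potFree t b s a, pderiv_X, Pi.single_apply]
      split_ifs <;> simp
  have := DFunLike.congr_fun key f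
  rw [Derivation.commutator_apply] at this
  exact sub_eq_zero.1 this

theorem lieDeriv_mem_potFree {f : ExtPoly R m} (hf : f ∈ potFree R m) :
    lieDeriv w W L f ∈ potFree R m := fun s a => by
  rw [pderiv_pot_lieDeriv, hf s a, map_zero]

/-! ### The trivector of an invariant operator is invariant -/

variable (K : WNLOp w)

theorem value_eq (s : Fin 3) (i : Fin 2) :
    K.value s i = ∑ j, extAct w (K.loc i j) (cov R m s j) +
      ∑ a, ∑ b, K.tail a b • (emb R m (w a i) * X (ExtVar.pot s b)) := by
  rw [value, locValue]
  congr 1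
  refine Finset.sum_congr rfl fun a _ => Finset.sum_congr rfl fun b _ => ?_
  rw [mul_assoc, C_mul']

theorem locValue_mem_potFree (s : Fin 3) (i : Fin 2) : K.locValue s i ∈ potFree R m :=
  Subalgebra.sum_mem _ fun _ _ => act_mem_potFree w _ (cov_mem_potFree _ _)

theorem pderiv_pot_value (t s : Fin 3) (b : Fin m) (i : Fin 2) :
    pderiv (ExtVar.pot t b) (K.value s i) =
      if t = s then ∑ a, K.tail a b • emb R m (w a i) else 0 := by
  classical
  rw [value, map_add, locValue_mem_potFree K s i t b, zero_add, map_sum]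
  have h : ∀ a, pderiv (ExtVar.pot t b)
      (∑ c, C (K.tail a c) * emb R m (w a i) * X (ExtVar.pot s c) : ExtPoly R m) =
        if t = s then K.tail a b • emb R m (w a i) else 0 := by
    intro a
    rw [map_sum]
    have h2 : ∀ c, pderiv (ExtVar.pot t b)
        (C (K.tail a c) * emb R m (w a i) * X (ExtVar.pot s c) : ExtPoly R m) =
          if c = b then (if t = s then K.tail a b • emb R m (w a i) else 0) else 0 := by
      intro c
      rw [mul_assoc, C_mul', Derivation.map_smul, Derivation.leibniz, pderiv_pot_emb, smul_zero, add_zero,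
        pderiv_X, Pi.single_apply, smul_eq_mul]
      by_cases hc : c = b
      · subst hc
        by_cases hs : t = s
        · subst hs; simp
        · simp [hs]
          intro h
          exact absurd h.symm hs
      · have : ¬ (ExtVar.pot s c : ExtVar m) = ExtVar.pot t b := by
          simp [hc]
        simp [hc, this]
    simp only [h2, Finset.sum_ite_eq', Finset.mem_univ, if_true]
  simp only [h]
  split_ifs <;> simp

/-- The evolutionary field kills covectors and potentials, so all summands but the one integrated by
parts form the variation of the whole pairing. -/
theorem variation_eq (t s r : Fin 3) :
    K.variation t s r = evol w (K.value r) (∑ i, cov R m t i * K.value s i) -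
      ∑ a, ∑ b, K.tail a b • (X (ExtVar.pot t a) *
        ∑ i, evol w (K.value r) (emb R m (w b i)) * cov R m s i) := by
  have h1 : evol w (K.value r) (∑ i, cov R m t i * K.value s i) =
      ∑ i, cov R m t i * evol w (K.value r) (K.locValue s i) +
        ∑ a, ∑ b, K.tail a b • ((∑ i, cov R m t i * evol w (K.value r) (emb R m (w a i))) *
          X (ExtVar.pot s b)) := by
    have h2 : ∀ i, evol w (K.value r) (cov R m t i * K.value s i) =
        cov R m t i * evol w (K.value r) (K.locValue s i) +
          ∑ a, ∑ b, K.tail a b • (cov R m t i * evol w (K.value r) (emb R m (w a i)) *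
            X (ExtVar.pot s b)) := by
      intro i
      rw [Derivation.leibniz, evol_cov', smul_zero, add_zero, smul_eq_mul, value, map_add,
        mul_add]
      congr 1
      simp only [map_sum, Finset.mul_sum]
      refine Finset.sum_congr rfl fun a _ => Finset.sum_congr rfl fun b _ => ?_
      rw [mul_assoc (C _), C_mul', Derivation.map_smul, Derivation.leibniz, evol_pot, smul_zero, zero_add,
        smul_eq_mul, mul_smul_comm]
      congr 1; ring
    rw [map_sum, Finset.sum_congr rfl fun i _ => h2 i, Finset.sum_add_distrib]
    congr 1
    rw [Finset.sum_comm]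
    refine Finset.sum_congr rfl fun a _ => ?_
    rw [Finset.sum_comm]
    refine Finset.sum_congr rfl fun b _ => ?_
    rw [Finset.sum_mul, Finset.smul_sum]
  rw [h1, variation, add_sub_assoc]
  congr 1
  rw [← Finset.sum_sub_distrib]
  refine Finset.sum_congr rfl fun a _ => ?_
  rw [← Finset.sum_sub_distrib]
  refine Finset.sum_congr rfl fun b _ => ?_
  rw [C_mul', smul_sub]

/-- The local part is skew-adjoint and the tail is symmetric. -/
structure IsSkew : Prop where
  loc : ∀ i j (f : ExtPoly R m), extAct w (K.loc i j).adjoint f = -extAct w (K.loc j i) f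
  tail : ∀ a b, K.tail a b = K.tail b a

/-- `K` is invariant under the flow `W`. -/
def IsInvariant (W : Fin 2 → DiffPoly R) (L : Fin 2 → Fin 2 → DiffOp R) : Prop :=
  ∀ s i, lieDeriv w W L (K.value s i) = ∑ j, extAct w (L i j) (K.value s j)

variable {K}

/-- `P_t` evolves by `-L*` and `K P_s` by `L`, so the pairing is conserved, with the concomitant as
flux. -/
theorem lieDeriv_pairing (hK : K.IsInvariant W L) (t s : Fin 3) :
    lieDeriv w W L (∑ i, cov R m t i * K.value s i) =
      extDeriv w (∑ i, ∑ j, extConc w (L i j) (K.value s j) (cov R m t i)) := by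
  simp only [map_sum, DiffOp.deriv_conc, Finset.sum_sub_distrib, Derivation.leibniz,
    lieDeriv_cov, smul_eq_mul, hK s, Finset.sum_add_distrib]
  rw [sub_eq_add_neg]
  congr 1
  · refine Finset.sum_congr rfl fun i _ => ?_
    rw [Finset.mul_sum]
    exact Finset.sum_congr rfl fun j _ => mul_comm _ _
  · rw [Finset.sum_comm, ← Finset.sum_neg_distrib]
    refine Finset.sum_congr rfl fun i _ => ?_
    rw [adjCov, mul_neg, Finset.mul_sum]

/-- The flux of the conserved pairing contains potentials, and evolutionary fields commute with
`D_x` only up to derivatives in the potentials. This is the resulting correction. -/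
theorem pderiv_pot_sum_conc (t s r : Fin 3) (b : Fin m) :
    pderiv (ExtVar.pot r b) (∑ i, ∑ j, extConc w (L i j) (K.value s j) (cov R m t i)) =
      if r = s then ∑ a, K.tail a b • potConc w L t a else 0 := by
  have h : ∀ i j, pderiv (ExtVar.pot r b) (extConc w (L i j) (K.value s j) (cov R m t i)) =
      if r = s then ∑ a, K.tail a b • extConc w (L i j) (emb R m (w a j)) (cov R m t i)
        else 0 := by
    intro i j
    rw [extConc, DiffOp.deriv_conc_of_commute (e := embHom R m) _ (fun c => pderiv_pot_emb r b c)
      (pderiv_pot_extDeriv w r b), pderiv_pot_cov, DiffOp.conc_zero_right, add_zero,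
      pderiv_pot_value]
    split_ifs
    · simp only [DiffOp.conc_sum_left, DiffOp.conc_smul_left]
    · rw [DiffOp.conc_zero_left]
  simp only [map_sum, h]
  split_ifs
  · simp only [potConc, Finset.smul_sum]
    rw [Finset.sum_comm (s := (Finset.univ : Finset (Fin m)))]
    refine Finset.sum_congr rfl fun i _ => ?_
    rw [Finset.sum_comm]
  · simp

/-- Modulo total derivatives. -/
abbrev extInt (w : Fin m → Fin 2 → DiffPoly R) :
    ExtPoly R m →ₗ[R] ExtPoly R m ⧸ LinearMap.range (extDeriv w).toLinearMap :=
  DiffOp.integral (extDeriv w)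

theorem extInt_pot_mul_extDeriv (t : Fin 3) (a : Fin m) (f : ExtPoly R m) :
    extInt w (X (ExtVar.pot t a) * extDeriv w f) =
      -extInt w ((∑ i, emb R m (w a i) * cov R m t i) * f) := by
  rw [extInt, DiffOp.integral_mul_deriv, extDeriv_pot]

/-- Skew-symmetry of `K`, applied to an arbitrary vector. -/
theorem IsSkew.integral_cov_mul (hs : K.IsSkew) (t : Fin 3) (M : Fin 2 → ExtPoly R m) :
    extInt w (∑ i, cov R m t i * ∑ j, extAct w (K.loc i j) (M j)) -
      extInt w (∑ a, ∑ b, K.tail a b • (X (ExtVar.pot t a) * ∑ i, emb R m (w b i) * M i)) =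
        -extInt w (∑ i, M i * K.value t i) := by
  have h1 : extInt w (∑ i, cov R m t i * ∑ j, extAct w (K.loc i j) (M j)) =
      -extInt w (∑ i, M i * K.locValue t i) := by
    simp only [Finset.mul_sum, map_sum, locValue]
    rw [Finset.sum_comm, ← Finset.sum_neg_distrib]
    refine Finset.sum_congr rfl fun j _ => ?_
    rw [← Finset.sum_neg_distrib]
    refine Finset.sum_congr rfl fun i _ => ?_
    have := hs.loc i j (cov R m t i)
    rw [extInt, DiffOp.integral_mul_act, show DiffOp.act _ _ (K.loc i j).adjoint _ = _ from this,
      neg_mul, map_neg, mul_comm]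
  have h2 : ∑ a, ∑ b, K.tail a b • (X (ExtVar.pot t a) * ∑ i, emb R m (w b i) * M i) =
      ∑ i, M i * ∑ a, ∑ b, C (K.tail a b) * emb R m (w a i) * X (ExtVar.pot t b) := by
    simp only [Finset.mul_sum, Finset.smul_sum]
    rw [Finset.sum_comm]
    rw [Finset.sum_comm (s := (Finset.univ : Finset (Fin 2)))]
    refine Finset.sum_congr rfl fun a _ => ?_
    rw [Finset.sum_comm (s := (Finset.univ : Finset (Fin 2)))]
    refine Finset.sum_congr rfl fun b _ => Finset.sum_congr rfl fun i _ => ?_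
    rw [hs.tail b a, mul_assoc (C _), C_mul', mul_smul_comm]
    congr 1; ring
  rw [h1, h2, ← neg_add', ← map_add, ← Finset.sum_add_distrib]
  simp only [← mul_add]
  rfl

/-- The commutator of the Lie derivative with an evolutionary field. -/
theorem commutator_fld (hW : IsSymmetry w W L) (hK : K.IsInvariant W L) (r : Fin 3)
    (f : DiffPoly R) : ⁅lieDeriv w W L, evol w (K.value r)⁆ (emb R m f) = 0 := by
  have hit : ∀ (Q : Fin 2 → ExtPoly R m) (g : DiffPoly R) n,
      evol w Q ((extDeriv w)^[n] (emb R m g)) = (extDeriv w)^[n] (evol w Q (emb R m g)) := by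
    intro Q g n
    induction n with
    | zero => rfl
    | succ n ih =>
      rw [Function.iterate_succ_apply', evol_extDeriv_of_mem w Q
        (iterate_extDeriv_mem_potFree w (emb_mem_potFree g) n), ih, Function.iterate_succ_apply']
  have := eq_on_emb (D₁ := ⁅lieDeriv w W L, evol w (K.value r)⁆)
    (D₂ := (0 : Derivation R (ExtPoly R m) (ExtPoly R m))) (fun i n => by
      rw [Derivation.commutator_apply, evol_fld, lieDeriv_fld, iterate_lieDeriv_extDeriv hW, hit,
        hK r i, hW.lin]
      simp) f
  simpa using this

theorem commutator_cov (r s : Fin 3) (i : Fin 2) :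
    ⁅lieDeriv w W L, evol w (K.value r)⁆ (cov R m s i) =
      evol w (K.value r) (adjCov w L s i) := by
  rw [Derivation.commutator_apply, evol_cov', lieDeriv_cov]
  simp

theorem commutator_pot (r s : Fin 3) (a : Fin m) :
    ⁅lieDeriv w W L, evol w (K.value r)⁆ (X (ExtVar.pot s a)) =
      -evol w (K.value r) (potConc w L s a) := by
  rw [Derivation.commutator_apply, evol_pot, lieDeriv_pot]
  simp

theorem commutator_extDeriv (hW : IsSymmetry w W L) (r : Fin 3) {f : ExtPoly R m}
    (hf : f ∈ potFree R m) : ⁅lieDeriv w W L, evol w (K.value r)⁆ (extDeriv w f) =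
      extDeriv w (⁅lieDeriv w W L, evol w (K.value r)⁆ f) := by
  simp only [Derivation.commutator_apply]
  rw [evol_extDeriv_of_mem w _ hf, lieDeriv_extDeriv hW, lieDeriv_extDeriv hW,
    evol_extDeriv_of_mem w _ (lieDeriv_mem_potFree hf), map_sub]

theorem commutator_act (hW : IsSymmetry w W L) (hK : K.IsInvariant W L) (r : Fin 3)
    (M : DiffOp R) {f : ExtPoly R m} (hf : f ∈ potFree R m) :
    ⁅lieDeriv w W L, evol w (K.value r)⁆ (extAct w M f) =
      extAct w M (⁅lieDeriv w W L, evol w (K.value r)⁆ f) := by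
  rw [extAct, DiffOp.deriv_act_of_mem (e := embHom R m) _ (potFree R m) emb_mem_potFree
    (fun _ => extDeriv_mem_potFree w) (fun _ hf => commutator_extDeriv hW r hf) M hf,
    DiffOp.vary_eq_zero (embHom R m) _ (fun a => commutator_fld hW hK r a), zero_add]

/-- The flow of `W` maps the variation of `K` to second variations of `W`. -/
theorem integral_lieDeriv_variation (hW : IsSymmetry w W L) (hs : K.IsSkew)
    (hK : K.IsInvariant W L) (t s r : Fin 3) :
    extInt w (lieDeriv w W L (K.variation t s r)) =
      extInt w (∑ i, evol w (K.value r) (adjCov w L t i) * K.value s i) -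
        extInt w (∑ i, evol w (K.value r) (adjCov w L s i) * K.value t i) := by
  set E := evol w (K.value r) with hE
  -- Invariance says that `K P_r` evolves by `L`, so this commutator kills all fields. It acts only
  -- through `P ↦ E (L* P)` and through minus the variation of the concomitant on potentials.
  set δ := ⁅lieDeriv w W L, E⁆ with hδ
  have hcomm : ∀ f, lieDeriv w W L (E f) = E (lieDeriv w W L f) + δ f := by
    intro f
    rw [hδ, Derivation.commutator_apply]; ring
  -- the first term
  have h1 : lieDeriv w W L (E (∑ i, cov R m t i * K.value s i)) =
      extDeriv w (E (∑ i, ∑ j, extConc w (L i j) (K.value s j) (cov R m t i))) +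
        ∑ a, ∑ b, K.tail a b • (potConc w L t a * ∑ i, E (emb R m (w b i)) * cov R m s i) +
          δ (∑ i, cov R m t i * K.value s i) := by
    rw [hcomm, lieDeriv_pairing hK, hE, evol_extDeriv]
    congr 2
    simp only [pderiv_pot_sum_conc, mul_ite, mul_zero]
    rw [Finset.sum_eq_single s]
    · simp only [if_true]
      rw [Finset.sum_comm (s := (Finset.univ : Finset (Fin m)))]
      refine Finset.sum_congr rfl fun b _ => ?_
      rw [Finset.mul_sum]
      refine Finset.sum_congr rfl fun a _ => ?_
      rw [mul_smul_comm, mul_comm]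
    · intro s' _ hs'
      simp [hs']
    · simp
  -- the variation of the potentials
  have h2 : ∀ b, lieDeriv w W L (∑ i, E (emb R m (w b i)) * cov R m s i) =
      extDeriv w (E (potConc w L s b)) + ∑ i, emb R m (w b i) * E (adjCov w L s i) := by
    intro b
    have h3 : ∑ i, E (emb R m (w b i)) * cov R m s i =
        E (extDeriv w (X (ExtVar.pot s b))) := by
      rw [extDeriv_pot, map_sum]
      refine Finset.sum_congr rfl fun i _ => ?_
      rw [Derivation.leibniz, hE, evol_cov', smul_zero, zero_add, smul_eq_mul, mul_comm]
    rw [h3, hcomm, lieDeriv_extDeriv hW, lieDeriv_pot, hE,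
      evol_extDeriv_of_mem w _ (potConc_mem_potFree s b), extDeriv_pot, map_sum]
    congr 1
    refine Finset.sum_congr rfl fun i _ => ?_
    rw [Derivation.leibniz, hδ, hE, commutator_cov, commutator_fld hW hK, smul_zero, add_zero,
      smul_eq_mul]
  -- the commutator
  have h4 : ∀ i, δ (K.value s i) = ∑ j, extAct w (K.loc i j) (E (adjCov w L s j)) -
      ∑ a, ∑ b, K.tail a b • (emb R m (w a i) * E (potConc w L s b)) := by
    intro i
    rw [value_eq, map_add, map_sum, map_sum, sub_eq_add_neg, ← Finset.sum_neg_distrib]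
    congr 1
    · refine Finset.sum_congr rfl fun j _ => ?_
      rw [hδ, hE, commutator_act hW hK r _ (cov_mem_potFree s j), commutator_cov]
    · refine Finset.sum_congr rfl fun a _ => ?_
      rw [map_sum, ← Finset.sum_neg_distrib]
      refine Finset.sum_congr rfl fun b _ => ?_
      rw [Derivation.map_smul, Derivation.leibniz, hδ, hE, commutator_fld hW hK, commutator_pot, smul_zero,
        add_zero, smul_eq_mul, mul_neg, smul_neg]
  have h5 : δ (∑ i, cov R m t i * K.value s i) =
      ∑ i, E (adjCov w L t i) * K.value s i +
        ∑ i, cov R m t i * ∑ j, extAct w (K.loc i j) (E (adjCov w L s j)) -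
          ∑ a, ∑ b, K.tail a b • ((∑ i, emb R m (w a i) * cov R m t i) *
            E (potConc w L s b)) := by
    have h6 : ∑ a, ∑ b, K.tail a b • ((∑ i, emb R m (w a i) * cov R m t i) *
            E (potConc w L s b)) = ∑ i, cov R m t i *
              ∑ a, ∑ b, K.tail a b • (emb R m (w a i) * E (potConc w L s b)) := by
      simp only [Finset.mul_sum, Finset.sum_mul, Finset.smul_sum]
      rw [Finset.sum_comm (s := (Finset.univ : Finset (Fin 2)))]
      refine Finset.sum_congr rfl fun a _ => ?_
      rw [Finset.sum_comm (s := (Finset.univ : Finset (Fin 2)))]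
      refine Finset.sum_congr rfl fun b _ => Finset.sum_congr rfl fun i _ => ?_
      rw [mul_smul_comm]
      congr 1; ring
    rw [h6, add_sub_assoc, ← Finset.sum_sub_distrib, ← Finset.sum_add_distrib, map_sum]
    refine Finset.sum_congr rfl fun i _ => ?_
    rw [Derivation.leibniz, h4, hδ, hE, commutator_cov, smul_eq_mul, smul_eq_mul]
    ring
  rw [variation_eq, map_sub, h1, h5]
  have h7 : lieDeriv w W L (∑ a, ∑ b, K.tail a b • (X (ExtVar.pot t a) *
      ∑ i, E (emb R m (w b i)) * cov R m s i)) =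
      ∑ a, ∑ b, K.tail a b • (potConc w L t a * ∑ i, E (emb R m (w b i)) * cov R m s i) +
        (∑ a, ∑ b, K.tail a b • (X (ExtVar.pot t a) * extDeriv w (E (potConc w L s b))) +
          ∑ a, ∑ b, K.tail a b • (X (ExtVar.pot t a) *
            ∑ i, emb R m (w b i) * E (adjCov w L s i))) := by
    simp only [map_sum (lieDeriv w W L), Derivation.map_smul, ← Finset.sum_add_distrib]
    refine Finset.sum_congr rfl fun a _ => Finset.sum_congr rfl fun b _ => ?_
    rw [Derivation.leibniz, h2, lieDeriv_pot, ← smul_add, ← smul_add]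
    refine congrArg (K.tail a b • ·) ?_
    rw [smul_eq_mul, smul_eq_mul]
    ring
  have h8 : extInt w (∑ a, ∑ b, K.tail a b • (X (ExtVar.pot t a) *
      extDeriv w (E (potConc w L s b)))) =
      -extInt w (∑ a, ∑ b, K.tail a b • ((∑ i, emb R m (w a i) * cov R m t i) *
            E (potConc w L s b))) := by
    rw [map_sum, map_sum, ← Finset.sum_neg_distrib]
    refine Finset.sum_congr rfl fun a _ => ?_
    rw [map_sum, map_sum, ← Finset.sum_neg_distrib]
    refine Finset.sum_congr rfl fun b _ => ?_
    rw [LinearMap.map_smul, LinearMap.map_smul, extInt_pot_mul_extDeriv, smul_neg]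
  -- Skew-symmetry moves `K` from `E (L* P_s)` to `P_t`. It uses up the local term and the tail term
  -- that are left, and produces the second integral of the claim.
  have h9 := hs.integral_cov_mul t (fun i => E (adjCov w L s i))
  rw [h7]
  simp only [map_sub, map_add, h8, DiffOp.integral_deriv]
  rw [sub_eq_iff_eq_add] at h9
  rw [h9]
  abel

/-- The covector is not varied, so the field acts on the coefficients of `L*` only, and integration
by parts turns this into the variation of `L`: a second Fréchet derivative of the flow, contracted
with `P_t`. -/
theorem integral_evol_adjCov (K : WNLOp w) (t s r : Fin 3) :
    extInt w (∑ i, evol w (K.value r) (adjCov w L t i) * K.value s i) =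
      extInt w (∑ j, cov R m t j *
        ∑ i, extVary w (evol w (K.value r)) (L j i) (K.value s i)) := by
  have h : ∀ i, evol w (K.value r) (adjCov w L t i) =
      ∑ j, extVary w (evol w (K.value r)) (L j i).adjoint (cov R m t j) := by
    intro i
    rw [adjCov, map_sum]
    refine Finset.sum_congr rfl fun j _ => ?_
    rw [extAct, evol_act w _ _ (cov_mem_potFree t j), evol_cov', DiffOp.act_map_zero, add_zero]
  simp only [h, Finset.sum_mul, Finset.mul_sum, map_sum (extInt w)]
  rw [Finset.sum_comm]
  refine Finset.sum_congr rfl fun j _ => Finset.sum_congr rfl fun i _ => ?_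
  rw [extInt, DiffOp.integral_mul_vary, mul_comm]

/-- The trivector of an invariant operator is invariant. -/
theorem integral_lieDeriv_trivector (hW : IsSymmetry w W L) (hs : K.IsSkew)
    (hK : K.IsInvariant W L) : extInt w (lieDeriv w W L K.trivector) = 0 := by
  have h : ∀ t s r, extInt w (lieDeriv w W L (K.variation t s r)) =
      extInt w (∑ j, cov R m t j *
        ∑ i, extVary w (evol w (K.value r)) (L j i) (K.value s i)) -
      extInt w (∑ j, cov R m s j *
        ∑ i, extVary w (evol w (K.value r)) (L j i) (K.value t i)) := by
    intro t s r
    rw [integral_lieDeriv_variation hW hs hK, integral_evol_adjCov, integral_evol_adjCov]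
  -- By symmetry of the second Fréchet derivative the two vectors `K P_r` and `K P_s` may be
  -- exchanged; the six terms of the cyclic sum then cancel in pairs.
  have hc : ∀ t s r, extInt w (∑ j, cov R m t j *
        ∑ i, extVary w (evol w (K.value r)) (L j i) (K.value s i)) =
      extInt w (∑ j, cov R m t j *
        ∑ i, extVary w (evol w (K.value s)) (L j i) (K.value r i)) := by
    intro t s r
    exact congrArg (extInt w) (Finset.sum_congr rfl fun j _ =>
      congrArg (cov R m t j * ·) (hW.second (K.value r) (K.value s) j))
  rw [trivector, map_add, map_add, map_add, map_add, h, h, h, hc 0 1 2, hc 1 0 2, hc 2 0 1]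
  abel

end WNLOp


/-! ## The grading by the three covectors -/

/-- By the Leibniz rule, a shift of weight that is uniform on the variables is the shift on every
monomial. -/
theorem Derivation.isWeightedHomogeneous_apply {R σ M : Type*} [CommRing R] [AddCommMonoid M]
    {wt : σ → M} {δ : M} (D : Derivation R (MvPolynomial σ R) (MvPolynomial σ R))
    (hD : ∀ v, (D (X v)).IsWeightedHomogeneous wt (wt v + δ)) {f : MvPolynomial σ R} {n : M}
    (hf : f.IsWeightedHomogeneous wt n) : (D f).IsWeightedHomogeneous wt (n + δ) := by
  have key : ∀ (s : σ →₀ ℕ) (r : R),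
      (D (monomial s r)).IsWeightedHomogeneous wt (Finsupp.weight wt s + δ) := by
    intro s
    induction s using Finsupp.induction_linear with
    | zero =>
      intro r
      change (D (C r)).IsWeightedHomogeneous wt _
      rw [derivation_C]
      exact isWeightedHomogeneous_zero R wt _
    | add s t hs ht =>
      intro r
      have h : monomial (s + t) r = monomial s r * (monomial t 1 : MvPolynomial σ R) := by
        rw [monomial_mul, mul_one]
      rw [h, Derivation.leibniz, smul_eq_mul, smul_eq_mul, map_add]
      refine IsWeightedHomogeneous.add ?_ ?_
      · rw [add_assoc]
        exact (isWeightedHomogeneous_monomial wt s r rfl).mul (ht 1)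
      · rw [add_comm (Finsupp.weight wt s), add_assoc]
        exact (isWeightedHomogeneous_monomial wt t 1 rfl).mul (hs r)
    | single v k =>
      intro r
      have h : monomial (Finsupp.single v k) r = C r * (X v ^ k : MvPolynomial σ R) := by
        rw [X_pow_eq_monomial, C_mul_monomial, mul_one]
      rw [h, ← smul_eq_C_mul, Derivation.map_smul, smul_eq_C_mul, Derivation.leibniz_pow]
      refine IsWeightedHomogeneous.C_mul ?_ r
      rcases k with _ | k
      · simpa using isWeightedHomogeneous_zero R wt _
      · rw [nsmul_eq_mul, smul_eq_mul, Nat.add_sub_cancel, ← C_eq_coe_nat]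
        refine IsWeightedHomogeneous.C_mul ?_ _
        have h2 : Finsupp.weight wt (Finsupp.single v (k + 1)) + δ = k • wt v + (wt v + δ) := by
          rw [Finsupp.weight_single, succ_nsmul, add_assoc]
        rw [h2]
        exact ((isWeightedHomogeneous_X R wt v).pow k).mul (hD v)
  induction hf using IsWeightedHomogeneous.induction_on with
  | zero => rw [map_zero]; exact isWeightedHomogeneous_zero R wt _
  | add p q hp hq h1 h2 => rw [map_add]; exact h1.add h2
  | monomial d r hr => rw [← hr]; exact key d r

theorem Derivation.weightedHomogeneousComponent_comm {R σ M : Type*} [CommRing R]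
    [AddCommMonoid M] {wt : σ → M} (D : Derivation R (MvPolynomial σ R) (MvPolynomial σ R))
    (hD : ∀ v, (D (X v)).IsWeightedHomogeneous wt (wt v)) (f : MvPolynomial σ R) (n : M) :
    weightedHomogeneousComponent wt n (D f) = D (weightedHomogeneousComponent wt n f) := by
  classical
  induction f using MvPolynomial.monomial_add_induction_on with
  | C a =>
    rw [derivation_C, map_zero, weightedHomogeneousComponent_of_mem
      (isWeightedHomogeneous_C wt a)]
    split_ifs <;> simp
  | monomial_add d r f hd hr ih =>
    have h1 := isWeightedHomogeneous_monomial wt d r rfl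
    have h2 := D.isWeightedHomogeneous_apply (δ := 0) (by simpa using hD) h1
    rw [add_zero] at h2
    rw [map_add, map_add, map_add, map_add, ih, weightedHomogeneousComponent_of_mem h1,
      weightedHomogeneousComponent_of_mem h2]
    split_ifs <;> simp

theorem MvPolynomial.derivation_eq_sum_vars {R σ : Type*} [CommRing R]
    (D : Derivation R (MvPolynomial σ R) (MvPolynomial σ R)) (f : MvPolynomial σ R) :
    D f = ∑ v ∈ f.vars, pderiv v f * D (X v) := by
  classical
  have h := derivation_eq_of_forall_mem_vars (D₁ := D)
    (D₂ := ∑ v ∈ f.vars, D (X v) • pderiv v) (f := f) (fun i hi => by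
      rw [Derivation.finset_sum_apply, Finset.sum_eq_single i]
      · rw [Derivation.smul_apply, pderiv_X_self, smul_eq_mul, mul_one]
      · intro j _ hj
        rw [Derivation.smul_apply, pderiv_X_of_ne hj.symm, smul_zero]
      · exact fun h => absurd hi h)
  rw [h, Derivation.finset_sum_apply]
  exact Finset.sum_congr rfl fun v _ => by rw [Derivation.smul_apply, smul_eq_mul, mul_comm]

/-- A homogeneous polynomial of nonzero degree is determined by its partial derivatives. -/
theorem MvPolynomial.IsWeightedHomogeneous.eq_zero_of_pderiv {R σ ι : Type*} [CommRing R]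
    [IsDomain R] [CharZero R] {wt : σ → ι → ℕ} {n : ι → ℕ} {s : ι} (hn : n s ≠ 0)
    {f : MvPolynomial σ R} (hf : f.IsWeightedHomogeneous wt n)
    (h : ∀ v, wt v s ≠ 0 → pderiv v f = 0) : f = 0 := by
  classical
  ext d
  rw [coeff_zero]
  by_contra hd
  have hw := hf hd
  have : ∃ v ∈ d.support, wt v s ≠ 0 := by
    by_contra! hv
    apply hn
    rw [← hw, Finsupp.weight_apply, Finsupp.sum, Finset.sum_apply]
    exact Finset.sum_eq_zero fun v hv' => by simp [hv v hv']
  obtain ⟨v, hv, hvs⟩ := this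
  have h1 := congrArg (coeff (d - Finsupp.single v 1)) (h v hvs)
  rw [coeff_pderiv, coeff_zero] at h1
  have hle : Finsupp.single v 1 ≤ d := by
    rw [Finsupp.single_le_iff]
    exact Nat.one_le_iff_ne_zero.2 (Finsupp.mem_support_iff.1 hv)
  rw [tsub_add_cancel_of_le hle] at h1
  rcases mul_eq_zero.1 h1 with h1 | h1
  · exact hd h1
  · exact Nat.cast_add_one_ne_zero _ h1

namespace WNLOp

variable {R : Type*} [CommRing R] {m : ℕ}

/-- The degrees in the three covectors. -/
def covDeg : ExtVar m → Fin 3 → ℕ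
  | .fld _ _ => 0
  | .cov s _ _ => Pi.single s 1
  | .pot s _ => Pi.single s 1

/-- `f` is homogeneous of the given degrees in the three covectors. -/
abbrev HasDeg (f : ExtPoly R m) (n : Fin 3 → ℕ) : Prop := f.IsWeightedHomogeneous covDeg n

theorem hasDeg_X (v : ExtVar m) : HasDeg (X v : ExtPoly R m) (covDeg v) :=
  isWeightedHomogeneous_X R covDeg v

theorem hasDeg_cov (s : Fin 3) (i : Fin 2) : HasDeg (cov R m s i) (Pi.single s 1) :=
  hasDeg_X (ExtVar.cov s i 0)

theorem hasDeg_pot (s : Fin 3) (a : Fin m) :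
    HasDeg (X (ExtVar.pot s a) : ExtPoly R m) (Pi.single s 1) :=
  hasDeg_X (ExtVar.pot s a)

theorem hasDeg_emb (f : DiffPoly R) : HasDeg (emb R m f) 0 := by
  induction f using MvPolynomial.induction_on with
  | C r => rw [emb_C]; exact isWeightedHomogeneous_C covDeg r
  | add p q hp hq => rw [map_add]; exact hp.add hq
  | mul_X p v hp =>
    have h1 : emb R m (X v) = X (ExtVar.fld v.1 v.2) := by simp [emb]
    rw [map_mul, h1]
    exact hp.mul (hasDeg_X (ExtVar.fld v.1 v.2))

theorem hasDeg_sum {ι : Type*} {s : Finset ι} {f : ι → ExtPoly R m} {n : Fin 3 → ℕ}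
    (h : ∀ i ∈ s, HasDeg (f i) n) : HasDeg (∑ i ∈ s, f i) n :=
  Submodule.sum_mem (weightedHomogeneousSubmodule R covDeg n) h

theorem hasDeg_mul {f g : ExtPoly R m} {n n' n'' : Fin 3 → ℕ} (hf : HasDeg f n)
    (hg : HasDeg g n') (h : n + n' = n'') : HasDeg (f * g) n'' := h ▸ hf.mul hg

theorem hasDeg_emb_mul (f : DiffPoly R) {g : ExtPoly R m} {n : Fin 3 → ℕ} (hg : HasDeg g n) :
    HasDeg (emb R m f * g) n := hasDeg_mul (hasDeg_emb f) hg (zero_add n)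

theorem hasDeg_zero (n : Fin 3 → ℕ) : HasDeg (0 : ExtPoly R m) n :=
  isWeightedHomogeneous_zero R covDeg n

variable {w : Fin m → Fin 2 → DiffPoly R}

theorem hasDeg_extDeriv_X (v : ExtVar m) : HasDeg (extDeriv w (X v)) (covDeg v) := by
  cases v with
  | fld i n => rw [extDeriv_fld]; exact hasDeg_X (ExtVar.fld i (n + 1))
  | cov s i n => rw [extDeriv_cov]; exact hasDeg_X (ExtVar.cov s i (n + 1))
  | pot s a =>
    rw [extDeriv_pot]
    exact hasDeg_sum fun i _ => hasDeg_emb_mul _ (hasDeg_cov s i)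

theorem hasDeg_extDeriv {f : ExtPoly R m} {n : Fin 3 → ℕ} (hf : HasDeg f n) :
    HasDeg (extDeriv w f) n := by
  simpa using (extDeriv w).isWeightedHomogeneous_apply (δ := 0)
    (by simpa using hasDeg_extDeriv_X) hf

theorem hasDeg_iterate_extDeriv {f : ExtPoly R m} {n : Fin 3 → ℕ} (hf : HasDeg f n) (k : ℕ) :
    HasDeg ((extDeriv w)^[k] f) n := by
  induction k with
  | zero => exact hf
  | succ k ih => rw [Function.iterate_succ_apply']; exact hasDeg_extDeriv ih

theorem hasDeg_act (L : DiffOp R) {f : ExtPoly R m} {n : Fin 3 → ℕ} (hf : HasDeg f n) :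
    HasDeg (extAct w L f) n := by
  induction L generalizing f with
  | coeff a => exact hasDeg_emb_mul a hf
  | der => exact hasDeg_extDeriv hf
  | add L M hL hM => exact (hL hf).add (hM hf)
  | comp L M hL hM => exact hL (hM hf)

theorem hasDeg_conc (L : DiffOp R) {f g : ExtPoly R m} {n n' n'' : Fin 3 → ℕ} (hf : HasDeg f n)
    (hg : HasDeg g n') (h : n + n' = n'') : HasDeg (extConc w L f g) n'' := by
  induction L generalizing f g with
  | coeff a => exact hasDeg_zero _
  | der => exact hasDeg_mul hf hg h
  | add L M hL hM => exact (hL hf hg).add (hM hf hg)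
  | comp L M hL hM => exact (hL (hasDeg_act M hf) hg).add (hM hf (hasDeg_act _ hg))

theorem hasDeg_evol {Q : Fin 2 → ExtPoly R m} {δ : Fin 3 → ℕ} (hQ : ∀ i, HasDeg (Q i) δ)
    {f : ExtPoly R m} {n n' : Fin 3 → ℕ} (hf : HasDeg f n) (h : n + δ = n') :
    HasDeg (evol w Q f) n' := by
  rw [← h]
  refine (evol w Q).isWeightedHomogeneous_apply (fun v => ?_) hf
  cases v with
  | fld i n =>
    rw [evol_fld]
    exact hasDeg_iterate_extDeriv (by simpa [covDeg] using hQ i) n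
  | cov s i n => rw [evol_cov]; exact hasDeg_zero _
  | pot s a => rw [evol_pot]; exact hasDeg_zero _

theorem hasDeg_adjCov (L : Fin 2 → Fin 2 → DiffOp R) (s : Fin 3) (i : Fin 2) :
    HasDeg (adjCov w L s i) (Pi.single s 1) :=
  hasDeg_sum fun j _ => hasDeg_act _ (hasDeg_cov s j)

theorem hasDeg_lieDeriv {W : Fin 2 → DiffPoly R} {L : Fin 2 → Fin 2 → DiffOp R}
    {f : ExtPoly R m} {n : Fin 3 → ℕ} (hf : HasDeg f n) : HasDeg (lieDeriv w W L f) n := by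
  rw [← add_zero n]
  refine (lieDeriv w W L).isWeightedHomogeneous_apply (fun v => ?_) hf
  rw [add_zero]
  cases v with
  | fld i n => rw [lieDeriv_fld]; exact hasDeg_iterate_extDeriv (hasDeg_emb _) n
  | cov s i n =>
    rw [lieDeriv_cov_var]
    exact hasDeg_iterate_extDeriv (hasDeg_adjCov L s i).neg n
  | pot s a =>
    rw [lieDeriv_pot]
    exact hasDeg_sum fun j _ => hasDeg_sum fun i _ =>
      hasDeg_conc _ (hasDeg_emb _) (hasDeg_cov s j) (zero_add _)

variable (K : WNLOp w)

theorem hasDeg_locValue (s : Fin 3) (i : Fin 2) : HasDeg (K.locValue s i) (Pi.single s 1) :=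
  hasDeg_sum fun j _ => hasDeg_act _ (hasDeg_cov s j)

theorem hasDeg_value (s : Fin 3) (i : Fin 2) : HasDeg (K.value s i) (Pi.single s 1) := by
  refine (hasDeg_locValue K s i).add (hasDeg_sum fun a _ => hasDeg_sum fun b _ => ?_)
  rw [mul_assoc]
  exact (hasDeg_emb_mul _ (hasDeg_pot s b)).C_mul _

theorem hasDeg_variation (t s r : Fin 3) :
    HasDeg (K.variation t s r) (Pi.single t 1 + (Pi.single s 1 + Pi.single r 1)) := by
  have hQ := fun i => hasDeg_value K r i
  refine IsWeightedHomogeneous.add (hasDeg_sum fun i _ => ?_)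
    (hasDeg_sum fun a _ => hasDeg_sum fun b _ => ?_)
  · exact (hasDeg_cov t i).mul (hasDeg_evol hQ (hasDeg_locValue K s i) rfl)
  · refine IsWeightedHomogeneous.C_mul (IsWeightedHomogeneous.sub ?_ ?_) _
    · refine hasDeg_mul (hasDeg_sum fun i _ => hasDeg_mul (hasDeg_cov t i)
        (hasDeg_evol hQ (hasDeg_emb _) (zero_add _)) rfl) (hasDeg_pot s b) ?_
      abel
    · refine hasDeg_mul (hasDeg_pot t a) (hasDeg_sum fun i _ => hasDeg_mul
        (hasDeg_evol hQ (hasDeg_emb _) (zero_add _)) (hasDeg_cov s i) rfl) ?_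
      abel

theorem hasDeg_trivector : HasDeg K.trivector 1 := by
  have h : ∀ t s r : Fin 3, Pi.single t 1 + (Pi.single s 1 + Pi.single r 1) = (1 : Fin 3 → ℕ) →
      HasDeg (K.variation t s r) 1 := fun t s r h => h ▸ hasDeg_variation K t s r
  exact ((h 0 1 2 (by decide)).add (h 1 2 0 (by decide))).add (h 2 0 1 (by decide))

/-- Since `D_x` preserves the degrees, it commutes with the projection to a homogeneous component,
so a primitive can be replaced by its component of the right degree. -/
theorem exists_hasDeg_extDeriv_eq {f h : ExtPoly R m} {n : Fin 3 → ℕ} (hf : HasDeg f n)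
    (hh : f = extDeriv w h) : ∃ h', HasDeg h' n ∧ f = extDeriv w h' := by
  refine ⟨weightedHomogeneousComponent covDeg n h,
    weightedHomogeneousComponent_isWeightedHomogeneous n h, ?_⟩
  rw [← (extDeriv w).weightedHomogeneousComponent_comm hasDeg_extDeriv_X, ← hh,
    weightedHomogeneousComponent_eq_self hf]

/-! ### The ladder of derivations `[Δ (n + 1), D] = Δ n` -/

variable (w) in
/-- The derivations `∂ / ∂P^{(n)}` of the component `j` of `P_s`, shifted by two and continued to
the potentials. -/
def ladder (s : Fin 3) (j : Fin 2) : ℕ → Derivation R (ExtPoly R m) (ExtPoly R m)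
  | 0 => -∑ a, extDeriv w (emb R m (w a j)) • pderiv (ExtVar.pot s a)
  | 1 => ∑ a, emb R m (w a j) • pderiv (ExtVar.pot s a)
  | n + 2 => pderiv (ExtVar.cov s j n)

theorem ladder_zero (s : Fin 3) (j : Fin 2) (f : ExtPoly R m) : ladder w s j 0 f =
    -∑ a, extDeriv w (emb R m (w a j)) * pderiv (ExtVar.pot s a) f := by
  simp [ladder, Derivation.finset_sum_apply]

theorem ladder_one (s : Fin 3) (j : Fin 2) (f : ExtPoly R m) : ladder w s j 1 f =
    ∑ a, emb R m (w a j) * pderiv (ExtVar.pot s a) f := by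
  simp [ladder, Derivation.finset_sum_apply]

theorem ladder_add_two (s : Fin 3) (j : Fin 2) (n : ℕ) (f : ExtPoly R m) :
    ladder w s j (n + 2) f = pderiv (ExtVar.cov s j n) f := rfl

theorem ladder_emb (s : Fin 3) (j : Fin 2) (n : ℕ) (f : DiffPoly R) :
    ladder w s j n (emb R m f) = 0 := by
  match n with
  | 0 => simp [ladder_zero, pderiv_pot_emb]
  | 1 => simp [ladder_one, pderiv_pot_emb]
  | n + 2 => exact pderiv_cov_emb s j n f

theorem ladder_X_cov (s t : Fin 3) (j i : Fin 2) (n k : ℕ) :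
    ladder w s j n (X (ExtVar.cov t i k)) = if t = s ∧ i = j ∧ n = k + 2 then 1 else 0 := by
  classical
  match n with
  | 0 => simp [ladder_zero]
  | 1 => simp [ladder_one]
  | n + 2 =>
    rw [ladder_add_two, pderiv_X, Pi.single_apply]
    congr 1
    simp [eq_comm]

/-- An expression linear in `P_s` is an operator applied to `P_s`, where a potential is `D⁻¹ w = w
D⁻¹ - w' D⁻² + ⋯`. The ladder with index `n + 2` reads off the coefficient of `Dⁿ`, and indices `1`
and `0` those of `D⁻¹` and `D⁻²`. Composition with `D_x` differentiates each coefficient and adds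
the one below it. -/
theorem ladder_extDeriv (s : Fin 3) (j : Fin 2) (n : ℕ) (f : ExtPoly R m) :
    ladder w s j (n + 1) (extDeriv w f) =
      extDeriv w (ladder w s j (n + 1) f) + ladder w s j n f := by
  classical
  match n with
  | 0 =>
    rw [ladder_zero, ladder_one, ladder_one, map_sum, ← sub_eq_add_neg, ← Finset.sum_sub_distrib]
    refine Finset.sum_congr rfl fun a _ => ?_
    rw [pderiv_pot_extDeriv, Derivation.leibniz, smul_eq_mul, smul_eq_mul]; ring
  | 1 =>
    have key : ⁅(ladder w s j 2), extDeriv w⁆ = ladder w s j 1 := by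
      apply derivation_ext
      intro v
      rw [Derivation.commutator_apply]
      cases v with
      | fld i k =>
        rw [← emb_jet, extDeriv_emb]
        simp only [ladder_emb, map_zero, sub_zero]
      | cov t i k =>
        rw [extDeriv_cov]
        simp only [ladder_X_cov]
        simp
        split_ifs <;> simp
      | pot t a =>
        rw [ladder_one, extDeriv_pot, map_sum, ladder_add_two, pderiv_X_of_ne (by simp), map_zero,
          sub_zero]
        simp only [Derivation.leibniz, ladder_emb, cov, ladder_X_cov, smul_eq_mul]
        simp only [pderiv_X, Pi.single_apply]
        by_cases ht : t = s
        · subst ht; simp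
        · simp [ht]
    rw [← key, Derivation.commutator_apply]; ring
  | n + 2 =>
    have key : ⁅(ladder w s j (n + 3)), extDeriv w⁆ = ladder w s j (n + 2) := by
      apply derivation_ext
      intro v
      rw [Derivation.commutator_apply]
      cases v with
      | fld i k =>
        rw [← emb_jet, extDeriv_emb]
        simp only [ladder_emb, map_zero, sub_zero]
      | cov t i k =>
        rw [extDeriv_cov]
        simp only [ladder_X_cov]
        simp only [show n + 3 = k + 1 + 2 ↔ n + 2 = k + 2 by omega]
        split_ifs <;> simp
      | pot t a =>
        rw [extDeriv_pot, map_sum, ladder_add_two, ladder_add_two, pderiv_X_of_ne (by simp),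
          pderiv_X_of_ne (by simp), map_zero, sub_zero]
        refine Finset.sum_eq_zero fun i _ => ?_
        rw [Derivation.leibniz, ladder_emb, cov, ladder_X_cov]
        simp
    rw [← key, Derivation.commutator_apply]; ring

theorem exists_ladder_eq_zero (s : Fin 3) (f : ExtPoly R m) :
    ∃ N, ∀ n ≥ N, ∀ j, ladder w s j n f = 0 := by
  classical
  let e : Fin 2 → ℕ := fun j => (f.vars.sup fun v => match v with
    | .cov _ _ n => n + 1
    | _ => 0)
  refine ⟨e 0 + 2, fun n hn j => ?_⟩
  obtain ⟨k, rfl⟩ : ∃ k, n = k + 2 := ⟨n - 2, by omega⟩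
  rw [ladder_add_two]
  apply pderiv_eq_zero_of_notMem_vars
  intro hk
  have := Finset.le_sup (f := fun v : ExtVar m => match v with
    | .cov _ _ n => n + 1
    | _ => 0) hk
  have h2 : k + 1 ≤ e 0 := this
  omega

variable (w) in
/-- The vectors in the tail are linearly independent over the universal ring. -/
def TailIndep : Prop :=
  ∀ k : Fin m → ExtPoly R m, (∀ i, ∑ a, emb R m (w a i) * k a = 0) → k = 0

/-- Index `1` only gives the combinations `∑ w a ∂f/∂(potential a)`; independence of the tail
vectors separates the potentials. Then all derivatives in the variables of `P_s` vanish, and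
positive degree excludes a constant. -/
theorem eq_zero_of_ladder [IsDomain R] [CharZero R] (hw : TailIndep w) {s : Fin 3}
    {n : Fin 3 → ℕ} (hn : n s ≠ 0) {f : ExtPoly R m} (hf : HasDeg f n)
    (h : ∀ j k, ladder w s j (k + 1) f = 0) : f = 0 := by
  refine hf.eq_zero_of_pderiv hn fun v hv => ?_
  cases v with
  | fld i k => exact absurd rfl hv
  | cov t i k =>
    have ht : s = t := by
      by_contra hts
      exact hv (Pi.single_eq_of_ne hts _)
    subst ht
    exact h i (k + 1)
  | pot t a =>
    have ht : s = t := by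
      by_contra hts
      exact hv (Pi.single_eq_of_ne hts _)
    subst ht
    exact congrFun (hw (fun a => pderiv (ExtVar.pot s a) f)
      fun i => by rw [← ladder_one]; exact h i 0) a

/-- There are no constants that depend on a covector. -/
theorem eq_zero_of_extDeriv_eq_zero [IsDomain R] [CharZero R] (hw : TailIndep w) {s : Fin 3}
    {n : Fin 3 → ℕ} (hn : n s ≠ 0) {f : ExtPoly R m} (hf : HasDeg f n)
    (h : extDeriv w f = 0) : f = 0 := by
  -- If `D_x f = 0`, a vanishing coefficient forces the one below it to vanish. High coefficients
  -- vanish, so all of them do.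
  have step : ∀ k j, ladder w s j (k + 1) f = 0 → ladder w s j k f = 0 := by
    intro k j hk
    have := ladder_extDeriv (w := w) s j k f
    rw [h, hk, map_zero, map_zero, zero_add] at this
    exact this.symm
  obtain ⟨N, hN⟩ := exists_ladder_eq_zero (w := w) s f
  refine eq_zero_of_ladder hw hn hf fun j k => ?_
  by_contra hk
  have : ∀ l, ladder w s j (k + 1 + l) f ≠ 0 := by
    intro l
    induction l with
    | zero => exact hk
    | succ l ih => exact fun h => ih (step _ _ h)
  exact this N (hN _ (by omega) j)

end WNLOp


theorem MvPolynomial.IsWeightedHomogeneous.pderiv_eq_zero {R σ ι : Type*} [CommRing R]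
    {wt : σ → ι → ℕ} {n : ι → ℕ} {s : ι} {f : MvPolynomial σ R}
    (hf : f.IsWeightedHomogeneous wt n) {v : σ} (h : n s < wt v s) : pderiv v f = 0 := by
  classical
  ext d
  rw [coeff_pderiv, coeff_zero, hf.coeff_eq_zero, zero_mul]
  intro h1
  rw [map_add, Finsupp.weight_single, one_smul] at h1
  have := congrFun h1 s
  rw [Pi.add_apply] at this
  omega

/-! ### Dependence of the trivector on the potentials -/

namespace WNLOp

variable {R : Type*} [CommRing R] {m : ℕ} {w : Fin m → Fin 2 → DiffPoly R}

theorem pderiv_pot_evol (Q : Fin 2 → ExtPoly R m) (s : Fin 3) (b : Fin m) (f : ExtPoly R m) :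
    pderiv (ExtVar.pot s b) (evol w Q f) = evol w Q (pderiv (ExtVar.pot s b) f) +
      evol w (fun i => pderiv (ExtVar.pot s b) (Q i)) f := by
  classical
  have hit : ∀ n g, pderiv (ExtVar.pot s b) ((extDeriv w)^[n] g) =
      (extDeriv w)^[n] (pderiv (ExtVar.pot s b) g) := by
    intro n g
    induction n with
    | zero => rfl
    | succ n ih => rw [Function.iterate_succ_apply', pderiv_pot_extDeriv, ih,
        Function.iterate_succ_apply']
  have key : ⁅(pderiv (ExtVar.pot s b) : Derivation R (ExtPoly R m) (ExtPoly R m)),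
      evol w Q⁆ = evol w (fun i => pderiv (ExtVar.pot s b) (Q i)) := by
    apply derivation_ext
    intro v
    rw [Derivation.commutator_apply]
    cases v with
    | fld i n => rw [evol_fld, evol_fld, hit, pderiv_X_of_ne (by simp), map_zero, sub_zero]
    | cov t i n => rw [evol_cov, evol_cov, pderiv_X_of_ne (by simp), map_zero, map_zero, sub_zero]
    | pot t a =>
      rw [evol_pot, evol_pot, pderiv_X, Pi.single_apply]
      split_ifs <;> simp
  rw [← key, Derivation.commutator_apply]; ring

/-- Evolutionary vector fields are linear in the characteristic. -/
theorem evol_sum_smul {ι : Type*} (s : Finset ι) (c : ι → R) (Q : ι → Fin 2 → ExtPoly R m)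
    (f : ExtPoly R m) : evol w (fun i => ∑ a ∈ s, c a • Q a i) f = ∑ a ∈ s, c a • evol w (Q a) f := by
  classical
  have hit : ∀ n i, (extDeriv w)^[n] (∑ a ∈ s, c a • Q a i) =
      ∑ a ∈ s, c a • (extDeriv w)^[n] (Q a i) := by
    intro n i
    induction n with
    | zero => rfl
    | succ n ih => simp only [Function.iterate_succ_apply', ih, map_sum, Derivation.map_smul]
  have key : evol w (fun i => ∑ a ∈ s, c a • Q a i) = ∑ a ∈ s, c a • evol w (Q a) := by
    apply derivation_ext
    intro v
    rw [Derivation.finset_sum_apply]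
    cases v with
    | fld i n => simp only [Derivation.smul_apply, evol_fld, hit]
    | cov t i n => simp
    | pot t a => simp
  rw [key, Derivation.finset_sum_apply]
  rfl

variable {K : WNLOp w} {W : Fin 2 → DiffPoly R} {L : Fin 2 → Fin 2 → DiffOp R}

/-- A density of `∫ P_t · pr v_Q (K) P_s dx` for `Q` free of covectors. -/
def fieldVariation (K : WNLOp w) (W : Fin 2 → DiffPoly R) (t s : Fin 3) : ExtPoly R m :=
  ∑ i, cov R m t i * evol w (fun i => emb R m (W i)) (K.locValue s i) +
    ∑ a, ∑ b, K.tail a b •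
      ((∑ i, cov R m t i * evol w (fun i => emb R m (W i)) (emb R m (w a i))) *
          X (ExtVar.pot s b) -
        X (ExtVar.pot t a) *
          ∑ i, evol w (fun i => emb R m (W i)) (emb R m (w b i)) * cov R m s i)

/-- The Lie derivative differs from the evolutionary field by a derivation that kills fields. -/
theorem lieDeriv_act (hW : IsSymmetry w W L) (M : DiffOp R) {f : ExtPoly R m}
    (hf : f ∈ potFree R m) : lieDeriv w W L (extAct w M f) =
      evol w (fun i => emb R m (W i)) (extAct w M f) +
        extAct w M (lieDeriv w W L f - evol w (fun i => emb R m (W i)) f) := by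
  have h := DiffOp.deriv_act_of_mem (e := embHom R m) (d := extDeriv w)
    (lieDeriv w W L - evol w (fun i => emb R m (W i))) (potFree R m) emb_mem_potFree
    (fun _ => extDeriv_mem_potFree w) (fun f hf => by
      rw [Derivation.sub_apply, Derivation.sub_apply, lieDeriv_extDeriv hW,
        evol_extDeriv_of_mem w _ hf, map_sub]) M hf
  rw [DiffOp.vary_eq_zero (embHom R m) _ (fun a => by
    rw [Derivation.sub_apply, embHom_apply, lieDeriv_emb, sub_self]), zero_add,
    Derivation.sub_apply, sub_eq_iff_eq_add, Derivation.sub_apply] at h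
  rw [extAct, h, add_comm]

/-- The pairing `∫ P_t · K P_s` is conserved. Splitting its Lie derivative into the part acting on
fields and the part acting on covectors gives the variation of `K` along `W` in terms of `L*`;
skew-symmetry moves `K` off `L* P_s`. -/
theorem integral_fieldVariation (hW : IsSymmetry w W L) (hs : K.IsSkew)
    (hK : K.IsInvariant W L) (t s : Fin 3) :
    extInt w (K.fieldVariation W t s) =
      extInt w (∑ i, adjCov w L t i * K.value s i) -
        extInt w (∑ i, adjCov w L s i * K.value t i) := by
  set E := evol w (fun i => emb R m (W i)) with hE
  have h0 : extInt w (lieDeriv w W L (∑ i, cov R m t i * K.value s i)) = 0 := by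
    rw [lieDeriv_pairing hK, DiffOp.integral_deriv]
  have h1 : ∀ i, lieDeriv w W L (K.value s i) = E (K.locValue s i) -
      ∑ j, extAct w (K.loc i j) (adjCov w L s j) +
      ∑ a, ∑ b, K.tail a b • (E (emb R m (w a i)) * X (ExtVar.pot s b) +
        emb R m (w a i) * potConc w L s b) := by
    intro i
    rw [value, map_add]
    congr 1
    · rw [locValue, map_sum, map_sum, ← Finset.sum_sub_distrib]
      refine Finset.sum_congr rfl fun j _ => ?_
      have := lieDeriv_act hW (K.loc i j) (cov_mem_potFree s j)
      rw [extAct] at this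
      rw [this, lieDeriv_cov, evol_cov', sub_zero, extAct, DiffOp.act_map_neg, sub_eq_add_neg]
    · rw [map_sum]
      refine Finset.sum_congr rfl fun a _ => ?_
      rw [map_sum]
      refine Finset.sum_congr rfl fun b _ => ?_
      rw [mul_assoc, C_mul', Derivation.map_smul, Derivation.leibniz, lieDeriv_emb, lieDeriv_pot,
        smul_eq_mul, smul_eq_mul]
      congr 1; ring
  have h2 : ∀ b, extInt w (∑ a, K.tail a b • ((∑ i, emb R m (w a i) * cov R m t i) *
      potConc w L s b)) = -extInt w (∑ a, K.tail a b • (X (ExtVar.pot t a) *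
        ∑ i, (E (emb R m (w b i)) * cov R m s i - emb R m (w b i) * adjCov w L s i))) := by
    intro b
    rw [map_sum, map_sum, ← Finset.sum_neg_distrib]
    refine Finset.sum_congr rfl fun a _ => ?_
    rw [LinearMap.map_smul, LinearMap.map_smul, ← smul_neg]
    refine congrArg (K.tail a b • ·) ?_
    change _ = -extInt w (_ * ∑ i, (evol w _ _ * _ - _))
    rw [← extDeriv_potConc hW, extInt_pot_mul_extDeriv, neg_neg]
  have h3 := hs.integral_cov_mul t (adjCov w L s)
  have h4 : lieDeriv w W L (∑ i, cov R m t i * K.value s i) =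
      K.fieldVariation W t s - ∑ i, adjCov w L t i * K.value s i -
        ∑ i, cov R m t i * ∑ j, extAct w (K.loc i j) (adjCov w L s j) +
        ∑ b, ∑ a, K.tail a b • ((∑ i, emb R m (w a i) * cov R m t i) * potConc w L s b) +
        ∑ b, ∑ a, K.tail a b • (X (ExtVar.pot t a) *
          ∑ i, E (emb R m (w b i)) * cov R m s i) := by
    have h5 : ∀ i, lieDeriv w W L (cov R m t i * K.value s i) =
        cov R m t i * E (K.locValue s i) - adjCov w L t i * K.value s i -
          cov R m t i * ∑ j, extAct w (K.loc i j) (adjCov w L s j) +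
          ∑ b, ∑ a, K.tail a b • (emb R m (w a i) * cov R m t i * potConc w L s b) +
          ∑ b, ∑ a, K.tail a b • (cov R m t i * E (emb R m (w a i)) * X (ExtVar.pot s b)) := by
      intro i
      rw [Derivation.leibniz, h1, lieDeriv_cov, smul_eq_mul, smul_eq_mul,
        Finset.sum_comm (s := (Finset.univ : Finset (Fin m)))]
      simp only [smul_add, Finset.sum_add_distrib, mul_add, mul_sub, Finset.mul_sum,
        mul_smul_comm, mul_assoc]
      simp only [mul_left_comm (cov R m t i) (emb R m _)]
      ring
    rw [map_sum, Finset.sum_congr rfl fun i _ => h5 i, Finset.sum_add_distrib,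
      Finset.sum_add_distrib, Finset.sum_sub_distrib, Finset.sum_sub_distrib, fieldVariation]
    have h6 : ∀ G : Fin m → Fin m → Fin 2 → ExtPoly R m, ∑ i, ∑ b, ∑ a, K.tail a b • G a b i =
        ∑ b, ∑ a, K.tail a b • ∑ i, G a b i := by
      intro G
      simp only [Finset.smul_sum]
      rw [Finset.sum_comm]
      exact Finset.sum_congr rfl fun b _ => Finset.sum_comm
    rw [h6, h6, Finset.sum_comm (f := fun a b => K.tail a b • (_ - _))]
    simp only [smul_sub, Finset.sum_sub_distrib, Finset.sum_mul]
    rw [hE]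
    ring
  rw [h4, map_add, map_add, map_sub, map_sub, map_sum (extInt w) (fun b => ∑ a, K.tail a b • (_ * potConc w L s b)),
    Finset.sum_congr rfl fun b _ => h2 b, Finset.sum_neg_distrib, ← map_sum] at h0
  have h7 : ∑ b, ∑ a, K.tail a b • (X (ExtVar.pot t a) *
        ∑ i, (E (emb R m (w b i)) * cov R m s i - emb R m (w b i) * adjCov w L s i)) =
      ∑ b, ∑ a, K.tail a b • (X (ExtVar.pot t a) * ∑ i, E (emb R m (w b i)) * cov R m s i) -
      ∑ a, ∑ b, K.tail a b • (X (ExtVar.pot t a) * ∑ i, emb R m (w b i) * adjCov w L s i) := by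
    rw [Finset.sum_comm (f := fun a b => K.tail a b • (X (ExtVar.pot t a) *
      ∑ i, emb R m (w b i) * adjCov w L s i)), ← Finset.sum_sub_distrib]
    refine Finset.sum_congr rfl fun b _ => ?_
    rw [← Finset.sum_sub_distrib]
    refine Finset.sum_congr rfl fun a _ => ?_
    rw [Finset.sum_sub_distrib, mul_sub, smul_sub]
  rw [h7, map_sub] at h0
  rw [sub_eq_iff_eq_add] at h3
  rw [h3] at h0
  rw [← sub_eq_zero, ← h0]
  abel

/-- The variation of `W` along `K P_r` is `L (K P_r)`; integrate by parts. -/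
theorem integral_cov_mul_evol (hW : IsSymmetry w W L) (t r : Fin 3) :
    extInt w (∑ i, cov R m t i * evol w (K.value r) (emb R m (W i))) =
      extInt w (∑ i, adjCov w L t i * K.value r i) := by
  simp only [hW.lin, adjCov, Finset.sum_mul, Finset.mul_sum, map_sum (extInt w)]
  rw [Finset.sum_comm]
  refine Finset.sum_congr rfl fun j _ => Finset.sum_congr rfl fun i _ => ?_
  rw [extInt, DiffOp.integral_mul_act]

/-- Potentials enter in three places: in the characteristic `K P_r`, where they multiply the flows
`w a`; in `K P_s`; and in the factor that comes from integrating the tail by parts. -/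
theorem pderiv_pot_variation (t s r c : Fin 3) (b : Fin m) :
    pderiv (ExtVar.pot c b) (K.variation t s r) =
      (if c = r then ∑ a, K.tail a b • K.fieldVariation (w a) t s else 0) +
      (if c = s then ∑ a, K.tail a b •
        ∑ i, cov R m t i * evol w (K.value r) (emb R m (w a i)) else 0) -
      (if c = t then ∑ a, K.tail b a •
        ∑ i, evol w (K.value r) (emb R m (w a i)) * cov R m s i else 0) := by
  classical
  have hQ : ∀ f ∈ potFree R m, pderiv (ExtVar.pot c b) (evol w (K.value r) f) =
      if c = r then ∑ a, K.tail a b • evol w (fun i => emb R m (w a i)) f else 0 := by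
    intro f hf
    rw [pderiv_pot_evol, hf c b, map_zero, zero_add]
    simp only [pderiv_pot_value]
    split_ifs
    · rw [evol_sum_smul]
    · have := evol_sum_smul (w := w) (∅ : Finset (Fin 0)) (fun _ => (0 : R))
        (fun _ _ => (0 : ExtPoly R m)) f
      simpa using this
  have hp : ∀ s a, pderiv (ExtVar.pot c b) (X (ExtVar.pot s a) : ExtPoly R m) =
      if c = s then (if a = b then 1 else 0) else 0 := by
    intro s a
    rw [pderiv_X, Pi.single_apply]
    by_cases h1 : c = s
    · by_cases h2 : a = b
      · simp [h1, h2]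
      · have : ¬ (ExtVar.pot s a : ExtVar m) = ExtVar.pot c b := by simp [h2]
        simp [h2, this]
    · have : ¬ (ExtVar.pot s a : ExtVar m) = ExtVar.pot c b := by simp [Ne.symm h1]
      simp [h1, this]
  have h1 : ∀ (t s : Fin 3) (F : Fin 2 → ExtPoly R m), (∀ i, F i ∈ potFree R m) →
      pderiv (ExtVar.pot c b) (∑ i, cov R m t i * evol w (K.value r) (F i)) =
      if c = r then ∑ a, K.tail a b • ∑ i, cov R m t i *
        evol w (fun i => emb R m (w a i)) (F i) else 0 := by
    intro t s F hF
    rw [map_sum]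
    simp only [Derivation.leibniz, pderiv_pot_cov, hQ _ (hF _), smul_eq_mul, mul_zero, add_zero]
    split_ifs
    · simp only [Finset.mul_sum, Finset.smul_sum, mul_smul_comm]
      rw [Finset.sum_comm]
    · simp
  have hc : ∀ (s : Fin 3) (F G : Fin 2 → ExtPoly R m),
      ∑ i, G i * cov R m s i = ∑ i, cov R m s i * G i := by
    intro s F G
    exact Finset.sum_congr rfl fun i _ => mul_comm _ _
  have h2 : ∀ a a', pderiv (ExtVar.pot c b) (C (K.tail a a') *
      ((∑ i, cov R m t i * evol w (K.value r) (emb R m (w a i))) * X (ExtVar.pot s a') -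
        X (ExtVar.pot t a) * ∑ i, evol w (K.value r) (emb R m (w a' i)) * cov R m s i)) =
      (if c = r then ∑ a'', K.tail a'' b • (K.tail a a' •
        ((∑ i, cov R m t i * evol w (fun i => emb R m (w a'' i)) (emb R m (w a i))) *
          X (ExtVar.pot s a') - X (ExtVar.pot t a) *
            ∑ i, evol w (fun i => emb R m (w a'' i)) (emb R m (w a' i)) * cov R m s i)) else 0) +
      (if a' = b then (if c = s then K.tail a a' •
        ∑ i, cov R m t i * evol w (K.value r) (emb R m (w a i)) else 0) else 0) -
      (if a = b then (if c = t then K.tail a a' •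
        ∑ i, evol w (K.value r) (emb R m (w a' i)) * cov R m s i else 0) else 0) := by
    intro a a'
    rw [hc s (fun _ => 0), C_mul', Derivation.map_smul, map_sub, Derivation.leibniz,
      Derivation.leibniz, h1 t s _ fun i => emb_mem_potFree _,
      h1 s s _ fun i => emb_mem_potFree _, hp, hp]
    simp only [hc s (fun _ => 0)]
    have e1 : ∀ (A B : Fin m → ExtPoly R m) (x y : ExtPoly R m),
        ∑ a'', K.tail a'' b • (K.tail a a' • (A a'' * x - y * B a'')) =
        K.tail a a' • (x * ∑ a'', K.tail a'' b • A a'' - y * ∑ a'', K.tail a'' b • B a'') := by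
      intro A B x y
      simp only [Finset.mul_sum, ← Finset.sum_sub_distrib, Finset.smul_sum, mul_smul_comm,
        ← smul_sub]
      refine Finset.sum_congr rfl fun a'' _ => ?_
      rw [smul_comm]
      congr 2
      rw [mul_comm x]
    rw [e1]
    simp only [smul_eq_mul]
    split_ifs <;> simp only [smul_add, smul_sub, mul_one, mul_zero, smul_zero] <;> abel
  rw [variation, map_add, h1 t s _ (locValue_mem_potFree K s), map_sum]
  simp only [map_sum (pderiv (ExtVar.pot c b)), h2, Finset.sum_add_distrib,
    Finset.sum_sub_distrib, Finset.sum_ite_eq', Finset.mem_univ, if_true]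
  rw [Finset.sum_comm (f := fun a a' => if a = b then _ else _)]
  simp only [Finset.sum_ite_eq', Finset.mem_univ, if_true]
  by_cases hr : c = r
  · simp only [hr, if_true]
    have e2 : ∑ a, ∑ a', ∑ a'', K.tail a'' b • (K.tail a a' •
        ((∑ i, cov R m t i * evol w (fun i => emb R m (w a'' i)) (emb R m (w a i))) *
          X (ExtVar.pot s a') - X (ExtVar.pot t a) *
            ∑ i, evol w (fun i => emb R m (w a'' i)) (emb R m (w a' i)) * cov R m s i)) =
        ∑ a'', K.tail a'' b • ∑ a, ∑ a', (K.tail a a' •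
        ((∑ i, cov R m t i * evol w (fun i => emb R m (w a'' i)) (emb R m (w a i))) *
          X (ExtVar.pot s a') - X (ExtVar.pot t a) *
            ∑ i, evol w (fun i => emb R m (w a'' i)) (emb R m (w a' i)) * cov R m s i)) := by
      have e3 : ∀ G : Fin m → Fin m → Fin m → ExtPoly R m,
          ∑ a, ∑ a', ∑ a'', G a'' a a' = ∑ a'', ∑ a, ∑ a', G a'' a a' := by
        intro G
        rw [Finset.sum_comm (s := (Finset.univ : Finset (Fin m)))
          (f := fun a'' a => ∑ a', G a'' a a')]
        exact Finset.sum_congr rfl fun a _ => Finset.sum_comm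
      rw [e3]
      refine Finset.sum_congr rfl fun a'' _ => ?_
      rw [Finset.smul_sum]
      exact Finset.sum_congr rfl fun a _ => Finset.smul_sum.symm
    rw [e2]
    simp only [fieldVariation, smul_add, Finset.sum_add_distrib]
    split_ifs <;> simp <;> abel
  · simp only [hr, if_false]
    split_ifs <;> simp

end WNLOp


/-! ### Reduction of the trivector to an invariant vector `E` -/

namespace WNLOp

variable {R : Type*} [CommRing R] {m : ℕ} {w : Fin m → Fin 2 → DiffPoly R}
  {K : WNLOp w} {W : Fin 2 → DiffPoly R} {L : Fin 2 → Fin 2 → DiffOp R}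

/-- For each tail flow `w a` the three cyclic contributions are the variation of `K` along `w a` and
two terms with its linearization. These cancel because `K` is invariant under `w a`; symmetry of the
tail lets them share one coefficient. -/
theorem integral_pderiv_pot_trivector {Lw : Fin m → Fin 2 → Fin 2 → DiffOp R}
    (hw : ∀ a, IsSymmetry w (w a) (Lw a)) (hs : K.IsSkew)
    (hK : ∀ a, K.IsInvariant (w a) (Lw a)) (b : Fin m) :
    extInt w (pderiv (ExtVar.pot 2 b) K.trivector) = 0 := by
  have h : ∀ a, extInt w (K.fieldVariation (w a) 0 1 +
      ∑ i, cov R m 1 i * evol w (K.value 0) (emb R m (w a i)) -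
      ∑ i, evol w (K.value 1) (emb R m (w a i)) * cov R m 0 i) = 0 := by
    intro a
    rw [map_sub, map_add, integral_fieldVariation (hw a) hs (hK a), integral_cov_mul_evol (hw a),
      Finset.sum_congr rfl fun i _ => mul_comm _ (cov R m 0 i), integral_cov_mul_evol (hw a)]
    abel
  rw [trivector, (pderiv (ExtVar.pot 2 b)).map_add, (pderiv (ExtVar.pot 2 b)).map_add, pderiv_pot_variation, pderiv_pot_variation,
    pderiv_pot_variation]
  simp only [show ((2 : Fin 3) = 0) ↔ False by decide, show ((2 : Fin 3) = 1) ↔ False by decide,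
    if_true, if_false, zero_add, add_zero, sub_zero, zero_sub]
  have h2 : ∀ a, K.tail b a = K.tail a b := fun a => hs.tail b a
  simp only [h2, ← sub_eq_add_neg]
  rw [← Finset.sum_add_distrib, ← Finset.sum_sub_distrib, map_sum]
  refine Finset.sum_eq_zero fun a _ => ?_
  rw [← smul_add, ← smul_sub, LinearMap.map_smul, h, smul_zero]

theorem integral_iterate_mul {B : Type*} [CommRing B] [Algebra R B] (d : Derivation R B B)
    (f g : B) (n : ℕ) : DiffOp.integral d (d^[n] f * g) =
      DiffOp.integral d (f * ((-1) ^ n * d^[n] g)) := by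
  induction n generalizing g with
  | zero => simp
  | succ n ih =>
    rw [Function.iterate_succ_apply', DiffOp.integral_deriv_mul, ih, ← map_neg,
      Function.iterate_succ_apply]
    congr 1; ring

/-- A functional that is linear in `P₂` can be written as `∫ P₂ · E`, up to potentials. -/
theorem exists_integral_eq {f : ExtPoly R m} (hf : HasDeg f 1) :
    ∃ E : Fin 2 → ExtPoly R m, (∀ i, HasDeg (E i) ![1, 1, 0]) ∧
      extInt w f = extInt w (∑ i, cov R m 2 i * E i +
        ∑ a, X (ExtVar.pot 2 a) * pderiv (ExtVar.pot 2 a) f) := by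
  classical
  induction hf using IsWeightedHomogeneous.induction_on with
  | zero => exact ⟨0, fun i => hasDeg_zero _, by simp⟩
  | add p q hp hq h1 h2 =>
    obtain ⟨E, hE, h1⟩ := h1
    obtain ⟨E', hE', h2⟩ := h2
    refine ⟨E + E', fun i => (hE i).add (hE' i), ?_⟩
    rw [map_add, h1, h2, ← map_add]
    simp only [map_add, Pi.add_apply, mul_add, Finset.sum_add_distrib]
    abel
  | monomial d r hd =>
    have hv : ∃ v ∈ d.support, covDeg v 2 ≠ 0 := by
      by_contra! hv
      have := congrFun hd 2
      rw [Finsupp.weight_apply, Finsupp.sum, Finset.sum_apply, Finset.sum_eq_zero] at this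
      · exact absurd this (by simp)
      · exact fun v hv' => by simp [hv v hv']
    obtain ⟨v, hv, hv2⟩ := hv
    have hv3 : covDeg v = Pi.single 2 1 := by
      cases v with
      | fld i n => exact absurd rfl hv2
      | cov s i n =>
        by_cases hs : s = 2
        · rw [hs]; rfl
        · exact absurd (Pi.single_eq_of_ne (Ne.symm hs) _) hv2
      | pot s a =>
        by_cases hs : s = 2
        · rw [hs]; rfl
        · exact absurd (Pi.single_eq_of_ne (Ne.symm hs) _) hv2
    have hle : Finsupp.single v 1 ≤ d := by
      rw [Finsupp.single_le_iff]
      exact Nat.one_le_iff_ne_zero.2 (Finsupp.mem_support_iff.1 hv)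
    set g : ExtPoly R m := monomial (d - Finsupp.single v 1) r with hg
    have hfg : monomial d r = X v * g := by
      rw [hg, X, monomial_mul, one_mul, add_tsub_cancel_of_le hle]
    have hgd : HasDeg g ![1, 1, 0] := by
      refine isWeightedHomogeneous_monomial covDeg _ r ?_
      have h1 : Finsupp.weight covDeg (Finsupp.single v 1) +
          Finsupp.weight covDeg (d - Finsupp.single v 1) = 1 := by
        rw [← map_add, add_tsub_cancel_of_le hle, hd]
      rw [Finsupp.weight_single, hv3, one_smul] at h1
      refine add_left_cancel (h1.trans ?_)
      decide
    -- A monomial of degree one in `P₂` contains exactly one of its variables, so the cofactor is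
    -- free of them.
    have hg0 : ∀ a, pderiv (ExtVar.pot 2 a) g = 0 := fun a =>
      hgd.pderiv_eq_zero (s := 2) (by simp [covDeg])
    rw [hfg]
    simp only [Derivation.leibniz, hg0, smul_eq_mul, mul_zero, zero_add]
    cases v with
    | fld i n => exact absurd rfl hv2
    | cov s i n =>
      have hs : s = 2 := by
        by_contra hs
        exact hv2 (Pi.single_eq_of_ne (Ne.symm hs) _)
      subst hs
      refine ⟨Pi.single i ((-1) ^ n * (extDeriv w)^[n] g), fun j => ?_, ?_⟩
      · by_cases hj : j = i
        · subst hj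
          rw [Pi.single_eq_same]
          have := (hasDeg_iterate_extDeriv (w := w) hgd n).C_mul ((-1) ^ n)
          simpa using this
        · rw [Pi.single_eq_of_ne hj]; exact hasDeg_zero _
      · have h1 : ∀ a, pderiv (ExtVar.pot 2 a) (X (ExtVar.cov 2 i n) : ExtPoly R m) = 0 :=
          fun a => pderiv_X_of_ne (by simp)
        simp only [h1, mul_zero, Finset.sum_const_zero, add_zero]
        rw [Finset.sum_eq_single i, Pi.single_eq_same, ← iterate_extDeriv_cov w,
          extInt, integral_iterate_mul]
        · intro j _ hj
          rw [Pi.single_eq_of_ne hj, mul_zero]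
        · simp
    | pot s a =>
      have hs : s = 2 := by
        by_contra hs
        exact hv2 (Pi.single_eq_of_ne (Ne.symm hs) _)
      subst hs
      refine ⟨0, fun i => hasDeg_zero _, ?_⟩
      simp only [Pi.zero_apply, mul_zero, Finset.sum_const_zero, zero_add]
      rw [Finset.sum_eq_single a]
      · rw [pderiv_X_self, mul_one]
      · intro b _ hb
        rw [pderiv_X_of_ne (by simpa using hb.symm)]; ring
      · simp

/-- A functional `∫ P₂ · f` vanishes only for `f = 0`. -/
theorem eq_zero_of_integral_cov_mul [IsDomain R] [CharZero R] (hw : TailIndep w)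
    {f : Fin 2 → ExtPoly R m} (hf : ∀ i, HasDeg (f i) ![1, 1, 0])
    (h : extInt w (∑ i, cov R m 2 i * f i) = 0) : f = 0 := by
  classical
  obtain ⟨h', hh'⟩ := (DiffOp.integral_eq_zero_iff _).1 h
  have hdeg : HasDeg (∑ i, cov R m 2 i * f i) 1 := hasDeg_sum fun i _ =>
    hasDeg_mul (hasDeg_cov 2 i) (hf i) (by decide)
  obtain ⟨g, hg, hfg⟩ := exists_hasDeg_extDeriv_eq hdeg hh'
  have hf0 : ∀ i j n, pderiv (ExtVar.cov 2 j n) (f i) = 0 := fun i j n =>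
    (hf i).pderiv_eq_zero (s := 2) (by simp [covDeg])
  have hf1 : ∀ i a, pderiv (ExtVar.pot 2 a) (f i) = 0 := fun i a =>
    (hf i).pderiv_eq_zero (s := 2) (by simp [covDeg])
  have hl : ∀ j n, ladder w 2 j (n + 2) (extDeriv w g) = if n = 0 then f j else 0 := by
    intro j n
    rw [← hfg, map_sum]
    simp only [Derivation.leibniz, cov, ladder_X_cov]
    simp only [ladder_add_two, hf0]
    fin_cases j <;> simp
  -- The density has no potentials of `P₂`, so the derivative of its primitive `g` in such a
  -- potential is a constant of `D_x`. It still has degree one in `P₀`, hence it is zero.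
  have hp : ∀ a, pderiv (ExtVar.pot 2 a) g = 0 := by
    intro a
    have hd : HasDeg (pderiv (ExtVar.pot 2 a) g) ![1, 1, 0] := by
      refine hg.pderiv ?_
      change ![1, 1, 0] + (Pi.single 2 1 : Fin 3 → ℕ) = 1
      decide
    refine eq_zero_of_extDeriv_eq_zero hw (s := 0) (by simp) hd ?_
    rw [← pderiv_pot_extDeriv, ← hfg, map_sum]
    refine Finset.sum_eq_zero fun i _ => ?_
    rw [Derivation.leibniz, hf1, pderiv_pot_cov, smul_zero, smul_zero, add_zero]
  have h1 : ∀ j, ladder w 2 j 1 g = 0 := by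
    intro j
    rw [ladder_one]
    simp [hp]
  obtain ⟨N, hN⟩ := exists_ladder_eq_zero (w := w) 2 g
  -- A nonzero coefficient of `g` at some order would give, through the ladder, nonzero coefficients
  -- at all higher orders. Only the coefficient of the undifferentiated `P₂` remains, and there the
  -- ladder gives `f j = 0`.
  have h2 : ∀ j n, ladder w 2 j (n + 2) g = 0 := by
    intro j n
    by_contra hk
    have : ∀ l, ladder w 2 j (n + l + 2) g ≠ 0 := by
      intro l
      induction l with
      | zero => exact hk
      | succ l ih =>
        intro h0
        apply ih
        have h3 : ladder w 2 j (n + (l + 1) + 2) (extDeriv w g) =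
            extDeriv w (ladder w 2 j (n + (l + 1) + 2) g) + ladder w 2 j (n + l + 2) g :=
          ladder_extDeriv 2 j (n + l + 2) g
        rw [hl, h0, map_zero, zero_add] at h3
        rw [← h3, if_neg (by omega)]
    exact this N (hN _ (by omega) j)
  funext j
  have := ladder_extDeriv (w := w) 2 j 1 g
  rw [hl j 0, h2 j 0, h1, map_zero, zero_add] at this
  simpa using this

/-- The trivector of an invariant operator is `∫ P₂ · E` for some `E` that is bilinear in `P₀, P₁`
and invariant. -/
theorem exists_trivector_eq [IsDomain R] [CharZero R] (hti : TailIndep w)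
    {Lw : Fin m → Fin 2 → Fin 2 → DiffOp R}
    (hw : ∀ a, IsSymmetry w (w a) (Lw a)) (hs : K.IsSkew)
    (hK : ∀ a, K.IsInvariant (w a) (Lw a)) : ∃ E : Fin 2 → ExtPoly R m,
      (∀ i, HasDeg (E i) ![1, 1, 0]) ∧
      extInt w K.trivector = extInt w (∑ i, cov R m 2 i * E i) ∧
      ∀ b i, lieDeriv w (w b) (Lw b) (E i) = ∑ j, extAct w (Lw b i j) (E j) := by
  obtain ⟨E, hE, hT⟩ := exists_integral_eq (w := w) (hasDeg_trivector K)
  have hZ : ∀ a, ∃ Y, HasDeg Y ![1, 1, 0] ∧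
      pderiv (ExtVar.pot 2 a) K.trivector = extDeriv w Y := by
    intro a
    obtain ⟨h, hh⟩ := (DiffOp.integral_eq_zero_iff _).1 (integral_pderiv_pot_trivector hw hs hK a)
    refine exists_hasDeg_extDeriv_eq ?_ hh
    refine (hasDeg_trivector K).pderiv ?_
    change ![1, 1, 0] + (Pi.single 2 1 : Fin 3 → ℕ) = 1
    decide
  choose Y hY hZ using hZ
  -- If the coefficient of a potential is `D_x Y`, integration by parts replaces the product by `-(w
  -- a · P₂) Y`, which is local in `P₂` and is absorbed here.
  set E' : Fin 2 → ExtPoly R m := fun i => E i - ∑ a, emb R m (w a i) * Y a with hE'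
  have hdeg : ∀ i, HasDeg (E' i) ![1, 1, 0] := fun i =>
    (hE i).sub (hasDeg_sum fun a _ => hasDeg_emb_mul _ (hY a))
  have hTE : extInt w K.trivector = extInt w (∑ i, cov R m 2 i * E' i) := by
    rw [hT, map_add]
    simp only [hZ, map_sum (extInt w) (fun a => X (ExtVar.pot 2 a) * _),
      extInt_pot_mul_extDeriv, hE', mul_sub, Finset.sum_sub_distrib, map_sub]
    rw [sub_eq_add_neg, Finset.sum_neg_distrib, ← map_sum]
    congr 3
    simp only [Finset.mul_sum, Finset.sum_mul]
    rw [Finset.sum_comm]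
    exact Finset.sum_congr rfl fun i _ => Finset.sum_congr rfl fun a _ => by ring
  refine ⟨E', hdeg, hTE, fun b => ?_⟩
  have h0 : extInt w (lieDeriv w (w b) (Lw b) (∑ i, cov R m 2 i * E' i)) = 0 := by
    have h1 := integral_lieDeriv_trivector (hw b) hs (hK b)
    rw [← sub_eq_zero, ← map_sub, DiffOp.integral_eq_zero_iff] at hTE
    obtain ⟨h, hh⟩ := hTE
    have h2 : extInt w (lieDeriv w (w b) (Lw b) (K.trivector - ∑ i, cov R m 2 i * E' i)) = 0 := by
      rw [hh, lieDeriv_extDeriv (hw b), DiffOp.integral_deriv]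
    rw [map_sub, map_sub, h1, zero_sub, neg_eq_zero] at h2
    exact h2
  -- Since `P₂` evolves by `-L*`, the invariance of `∫ P₂ · E'` says that `E'_t - L E'` pairs to
  -- zero with `P₂`, and this pairing is nondegenerate.
  have h1 : extInt w (∑ i, cov R m 2 i * (lieDeriv w (w b) (Lw b) (E' i) -
      ∑ j, extAct w (Lw b i j) (E' j))) = 0 := by
    rw [← h0]
    simp only [map_sum (lieDeriv w (w b) (Lw b)), Derivation.leibniz, lieDeriv_cov, mul_sub,
      Finset.sum_sub_distrib, smul_eq_mul, mul_neg, ← sub_eq_add_neg, map_sub]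
    congr 1
    simp only [adjCov, Finset.mul_sum, map_sum (extInt w)]
    rw [Finset.sum_comm]
    refine Finset.sum_congr rfl fun j _ => Finset.sum_congr rfl fun i _ => ?_
    rw [extInt, DiffOp.integral_mul_act, mul_comm]
  have h2 := eq_zero_of_integral_cov_mul hti (fun i =>
    (hasDeg_lieDeriv (hdeg i)).sub (hasDeg_sum fun j _ => hasDeg_act _ (hdeg j))) h1
  exact fun i => sub_eq_zero.1 (congrFun h2 i)

end WNLOp


namespace WNLOp

variable {R : Type*} [CommRing R] {m : ℕ} {w : Fin m → Fin 2 → DiffPoly R}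

/-! ### Dispersion -/

theorem act_adjoint_pow_der {B : Type*} [CommRing B] [Algebra R B] (e : DiffPoly R →+* B)
    (d : Derivation R B B) (n : ℕ) (f : B) :
    ((DiffOp.der : DiffOp R) ^ n).adjoint.act e d f = (-1) ^ n * d^[n] f := by
  induction n generalizing f with
  | zero =>
    change e 1 * f = _
    simp
  | succ n ih =>
    change (DiffOp.der ^ n).adjoint.act e d ((-DiffOp.der : DiffOp R).act e d f) = _
    rw [ih, DiffOp.act_neg, DiffOp.act_der, pow_succ, Function.iterate_succ_apply]
    have : ∀ g, d^[n] (-g) = -d^[n] g := by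
      intro g
      have h := DiffOp.act_map_neg e d ((DiffOp.der : DiffOp R) ^ n) g
      simp only [DiffOp.act_pow] at h
      exact h
    rw [this]; ring

theorem act_adjoint_linOp {B : Type*} [CommRing B] [Algebra R B] (e : DiffPoly R →+* B)
    (d : Derivation R B B) (f : DiffPoly R) (k : Fin 2) (N : ℕ) (g : B) :
    (linOp f k N).adjoint.act e d g =
      ∑ n ∈ Finset.range N, (-1) ^ n * d^[n] (e (pderiv (k, n) f) * g) := by
  induction N with
  | zero =>
    change (0 : DiffOp R).adjoint.act e d g = _
    simp
  | succ N ih =>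
    rw [Finset.sum_range_succ, ← ih, ← act_adjoint_pow_der e d]
    rfl

theorem ladder_eq_zero_of_hasDeg {f : ExtPoly R m} {n : Fin 3 → ℕ} (hf : HasDeg f n) {s : Fin 3}
    (hn : n s = 0) (j : Fin 2) (k : ℕ) : ladder w s j k f = 0 := by
  have h1 : ∀ a, pderiv (ExtVar.pot s a) f = 0 := fun a =>
    hf.pderiv_eq_zero (s := s) (by simp [covDeg, hn])
  match k with
  | 0 => simp [ladder_zero, h1]
  | 1 => simp [ladder_one, h1]
  | k + 2 => exact hf.pderiv_eq_zero (s := s) (by simp [covDeg, hn])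

theorem hasDeg_ladder {f : ExtPoly R m} {n n' : Fin 3 → ℕ} (hf : HasDeg f n) {s : Fin 3}
    (hn : n' + Pi.single s 1 = n) (j : Fin 2) (k : ℕ) : HasDeg (ladder w s j k f) n' := by
  have h1 : ∀ a, HasDeg (pderiv (ExtVar.pot s a) f) n' := fun a => hf.pderiv hn
  match k with
  | 0 =>
    rw [ladder_zero]
    exact (hasDeg_sum fun a _ => hasDeg_mul (hasDeg_extDeriv (hasDeg_emb _)) (h1 a)
      (zero_add _)).neg
  | 1 =>
    rw [ladder_one]
    exact hasDeg_sum fun a _ => hasDeg_emb_mul _ (h1 a)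
  | k + 2 => exact hf.pderiv hn

/-- The top two coefficients of `Dˡ` composed with an operator having leading coefficients `a, b`
are `a` and `b + l a'`. -/
theorem ladder_iterate_extDeriv {s : Fin 3} {j : Fin 2} {f : ExtPoly R m} {n : ℕ}
    (h : ∀ k > n + 1, ladder w s j k f = 0) (l : ℕ) :
    (∀ k > n + 1 + l, ladder w s j k ((extDeriv w)^[l] f) = 0) ∧
      ladder w s j (n + 1 + l) ((extDeriv w)^[l] f) = ladder w s j (n + 1) f ∧
      ladder w s j (n + l) ((extDeriv w)^[l] f) =
        ladder w s j n f + l * extDeriv w (ladder w s j (n + 1) f) := by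
  induction l with
  | zero => exact ⟨h, rfl, by simp⟩
  | succ l ih =>
    obtain ⟨h1, h2, h3⟩ := ih
    rw [Function.iterate_succ_apply']
    refine ⟨fun k hk => ?_, ?_, ?_⟩
    · obtain ⟨k, rfl⟩ : ∃ k', k = k' + 1 := ⟨k - 1, by omega⟩
      rw [ladder_extDeriv, h1 _ (by omega), h1 _ (by omega), map_zero, add_zero]
    · rw [← add_assoc, ladder_extDeriv, h1 _ (by omega), h2, map_zero, zero_add]
    · rw [← add_assoc, ladder_extDeriv, h3, show n + l + 1 = n + 1 + l by omega, h2]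
      push_cast
      ring

/-- A flow of order five whose linearization has constant, distinct and nonzero leading
coefficients. -/
structure IsDispersive (W : Fin 2 → DiffPoly R) (L : Fin 2 → Fin 2 → DiffOp R)
    (c : Fin 2 → R) : Prop where
  lin : ∀ i j, L i j = linOp (W i) j 6
  lead : ∀ i j, pderiv (j, 5) (W i) = if j = i then C (c i) else 0
  sub : ∀ i, pderiv (i, 4) (W i) = 0
  ne_zero : ∀ i, c i ≠ 0
  ne : c 0 ≠ c 1

variable {W : Fin 2 → DiffPoly R} {L : Fin 2 → Fin 2 → DiffOp R} {c : Fin 2 → R}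

theorem ladder_emb_mul (s : Fin 3) (j : Fin 2) (k : ℕ) (f : DiffPoly R) (g : ExtPoly R m) :
    ladder w s j k (emb R m f * g) = emb R m f * ladder w s j k g := by
  rw [Derivation.leibniz, ladder_emb, smul_zero, add_zero, smul_eq_mul]

theorem neg_one_pow_mul_ladder (D : Derivation R (ExtPoly R m) (ExtPoly R m)) (n : ℕ)
    (f : ExtPoly R m) : D ((-1) ^ n * f) = (-1) ^ n * D f := by
  rcases neg_one_pow_eq_or (ExtPoly R m) n with h | h <;> simp [h]

/-- Indices `7` and `6` stand for the fifth and fourth derivatives. Taking the adjoint changes the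
sign of the leading coefficient `c j`. The next coefficient vanishes on the diagonal because `c j`
is constant and the fourth-order coefficient of `L` is zero there. -/
theorem ladder_adjCov (hd : IsDispersive W L c) (s : Fin 3) (j i : Fin 2) :
    (∀ k > 7, ladder w s j k (adjCov w L s i) = 0) ∧
      ladder w s j 7 (adjCov w L s i) = (if i = j then -C (c j) else 0) ∧
      (i = j → ladder w s j 6 (adjCov w L s i) = 0) := by
  have key : ∀ k ≥ 6, ladder w s j k (adjCov w L s i) = ∑ n ∈ Finset.range 6,
      (-1) ^ n * ladder w s j k ((extDeriv w)^[n] (emb R m (pderiv (i, n) (W j)) *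
        cov R m s j)) := by
    intro k hk
    rw [adjCov, map_sum, Finset.sum_eq_single j]
    · rw [extAct, hd.lin, act_adjoint_linOp, map_sum]
      simp only [neg_one_pow_mul_ladder]
      rfl
    · intro j' _ hj'
      rw [extAct, hd.lin, act_adjoint_linOp, map_sum]
      refine Finset.sum_eq_zero fun n hn => ?_
      rw [neg_one_pow_mul_ladder]
      have h0 : ∀ k, ladder w s j k (emb R m (pderiv (i, n) (W j')) * cov R m s j') = 0 := by
        intro k
        rw [ladder_emb_mul, cov, ladder_X_cov, if_neg (by simp [hj']), mul_zero]
      have h1 : ∀ l, ∀ k ≥ l, ladder w s j k ((extDeriv w)^[l]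
          (emb R m (pderiv (i, n) (W j')) * cov R m s j')) = 0 := by
        intro l
        induction l with
        | zero => exact fun k _ => h0 k
        | succ l ih =>
          intro k hk
          obtain ⟨k, rfl⟩ : ∃ k', k = k' + 1 := ⟨k - 1, by omega⟩
          rw [Function.iterate_succ_apply', ladder_extDeriv, ih _ (by omega), ih _ (by omega),
            map_zero, add_zero]
      have h2 := h1 n k (by have := Finset.mem_range.1 hn; omega)
      exact (congrArg _ h2).trans (mul_zero _)
    · simp
  have h0 : ∀ n k, ladder w s j k (emb R m (pderiv (i, n) (W j)) * cov R m s j) =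
      if k = 2 then emb R m (pderiv (i, n) (W j)) else 0 := by
    intro n k
    rw [ladder_emb_mul, cov, ladder_X_cov]
    simp
  have h1 := fun n => ladder_iterate_extDeriv (n := 1)
    (fun k hk => (h0 n k).trans (if_neg (by omega))) n
  simp only [h0, if_true] at h1
  have h5 : emb R m (pderiv (i, 5) (W j)) = if i = j then C (c j) else 0 := by
    rw [hd.lead]
    split_ifs <;> simp
  refine ⟨fun k hk => ?_, ?_, fun hij => ?_⟩
  · rw [key k (by omega)]
    refine Finset.sum_eq_zero fun n hn => ?_
    rw [(h1 n).1 k (by have := Finset.mem_range.1 hn; omega), mul_zero]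
  · rw [key 7 (by omega), Finset.sum_range_succ, Finset.sum_eq_zero, zero_add,
      show (7 : ℕ) = 1 + 1 + 5 from rfl, (h1 5).2.1, h5]
    · split_ifs <;> ring
    · intro n hn
      rw [(h1 n).1 7 (by have := Finset.mem_range.1 hn; omega), mul_zero]
  · rw [key 6 (by omega), Finset.sum_range_succ, Finset.sum_range_succ, Finset.sum_eq_zero,
      zero_add, show ladder w s j 6 ((extDeriv w)^[4] _) = _ from (h1 4).2.1,
      show ladder w s j 6 ((extDeriv w)^[5] _) = _ from (h1 5).2.2, h5, hij, hd.sub]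
    · simp
    · intro n hn
      rw [(h1 n).1 6 (by have := Finset.mem_range.1 hn; omega), mul_zero]

/-- The concomitant is known through its total derivative, so its coefficients are found by
descending the ladder: each one is determined by a coefficient of `L* P_s` and by the derivative of
the coefficient above it. -/
theorem ladder_potConc (hW : IsSymmetry w W L) (hd : IsDispersive W L c) (s : Fin 3) (j : Fin 2)
    (a : Fin m) : (∀ k > 6, ladder w s j k (potConc w L s a) = 0) ∧
      ladder w s j 6 (potConc w L s a) = C (c j) * emb R m (w a j) ∧
      ladder w s j 5 (potConc w L s a) = -∑ i, emb R m (w a i) * ladder w s j 6 (adjCov w L s i) -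
        C (c j) * extDeriv w (emb R m (w a j)) := by
  have h : ∀ k ≥ 6, ladder w s j k (extDeriv w (potConc w L s a)) =
      -∑ i, emb R m (w a i) * ladder w s j k (adjCov w L s i) := by
    intro k hk
    rw [extDeriv_potConc hW, map_sum, ← Finset.sum_neg_distrib]
    refine Finset.sum_congr rfl fun i _ => ?_
    rw [map_sub, ladder_emb_mul, Derivation.leibniz, ladder_eq_zero_of_hasDeg
      (hasDeg_evol (fun i => hasDeg_emb (W i)) (hasDeg_emb (w a i)) (zero_add 0)) rfl,
      cov, ladder_X_cov, if_neg (by omega), smul_zero, smul_zero, zero_add, zero_sub]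
  obtain ⟨N, hN⟩ := exists_ladder_eq_zero (w := w) s (potConc w L s a)
  have h7 : ∀ k > 6, ladder w s j k (potConc w L s a) = 0 := by
    intro k hk
    by_contra h0
    have : ∀ l, ladder w s j (k + l) (potConc w L s a) ≠ 0 := by
      intro l
      induction l with
      | zero => exact h0
      | succ l ih =>
        intro h1
        have h2 := ladder_extDeriv (w := w) s j (k + l) (potConc w L s a)
        rw [h _ (by omega), show k + l + 1 = k + (l + 1) from rfl, h1, map_zero, zero_add,
          Finset.sum_eq_zero, neg_zero] at h2
        · exact ih h2.symm
        · intro i _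
          rw [(ladder_adjCov hd s j i).1 _ (by omega), mul_zero]
    exact this N (hN _ (by omega) j)
  have h6 : ladder w s j 6 (potConc w L s a) = C (c j) * emb R m (w a j) := by
    have h2 := ladder_extDeriv (w := w) s j 6 (potConc w L s a)
    rw [h _ (by omega), h7 _ (by omega), map_zero, zero_add] at h2
    rw [← h2]
    simp only [(ladder_adjCov hd s j _).2.1]
    rw [Finset.sum_eq_single j]
    · simp [mul_comm]
    · intro i _ hi
      rw [if_neg hi, mul_zero]
    · simp
  refine ⟨h7, h6, ?_⟩
  have h2 := ladder_extDeriv (w := w) s j 5 (potConc w L s a)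
  rw [h _ (by omega), h6, ← smul_eq_C_mul, Derivation.map_smul, smul_eq_C_mul] at h2
  rw [h2]; ring

variable (w W L c) in
/-- The commutator of the ladder with the Lie derivative, without its two leading terms. -/
def dispersion (j : Fin 2) (q : ℕ) : Derivation R (ExtPoly R m) (ExtPoly R m) :=
  ⁅ladder w 0 j (q + 5), lieDeriv w W L⁆ - (C (c j) : ExtPoly R m) • ladder w 0 j q +
    ∑ i, ladder w 0 j 6 (adjCov w L 0 i) • ladder w 0 i (q + 1)

theorem dispersion_apply (j : Fin 2) (q : ℕ) (f : ExtPoly R m) : dispersion w W L c j q f =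
    ladder w 0 j (q + 5) (lieDeriv w W L f) - lieDeriv w W L (ladder w 0 j (q + 5) f) -
      C (c j) * ladder w 0 j q f +
      ∑ i, ladder w 0 j 6 (adjCov w L 0 i) * ladder w 0 i (q + 1) f := by
  simp [dispersion, Derivation.commutator_apply]

/-- Each ingredient obeys the ladder relation and the Lie derivative commutes with `D_x`. Only the
subleading coefficients of `L*` are not constant, and they give the last sum. -/
theorem dispersion_extDeriv (hW : IsSymmetry w W L) (j : Fin 2) (q : ℕ) (f : ExtPoly R m) :
    dispersion w W L c j (q + 1) (extDeriv w f) = extDeriv w (dispersion w W L c j (q + 1) f) +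
      dispersion w W L c j q f -
      ∑ i, extDeriv w (ladder w 0 j 6 (adjCov w L 0 i)) * ladder w 0 i (q + 2) f := by
  have h : ∀ k f, ladder w 0 j (k + 1) (extDeriv w f) =
      extDeriv w (ladder w 0 j (k + 1) f) + ladder w 0 j k f := fun k f => ladder_extDeriv 0 j k f
  simp only [dispersion_apply]
  rw [lieDeriv_extDeriv hW, show q + 1 + 5 = q + 5 + 1 by omega, h, h, h, map_add,
    lieDeriv_extDeriv hW]
  simp only [ladder_extDeriv, map_add, map_sub, map_sum, Derivation.leibniz, smul_eq_mul, mul_add,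
    Finset.sum_add_distrib, derivation_C, mul_zero, add_zero]
  simp only [mul_comm (ladder w 0 _ (q + 1 + 1) f)]
  ring

theorem dispersion_cov (hW : IsSymmetry w W L) (hd : IsDispersive W L c) (j i : Fin 2)
    (k : ℕ) : ∀ q ≥ k + 1, dispersion w W L c j q (X (ExtVar.cov 0 i k)) = 0 := by
  induction k with
  | zero =>
    intro q hq
    change dispersion w W L c j q (cov R m 0 i) = 0
    rw [dispersion_apply, lieDeriv_cov, cov, ladder_X_cov, if_neg (by omega), map_zero, sub_zero,
      map_neg]
    simp only [ladder_X_cov]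
    rcases hq.eq_or_lt with rfl | hq
    · simp
    · rw [Finset.sum_eq_zero fun i' _ => by rw [if_neg (by omega), mul_zero], add_zero]
      rcases (show 2 ≤ q by omega).eq_or_lt with rfl | hq
      · rw [(ladder_adjCov hd 0 j i).2.1]
        by_cases hij : i = j <;> simp [hij]
      · rw [(ladder_adjCov hd 0 j i).1 _ (by omega), if_neg (by omega)]
        simp
  | succ k ih =>
    intro q hq
    obtain ⟨q, rfl⟩ : ∃ q', q = q' + 1 := ⟨q - 1, by omega⟩
    -- The correction sum looks at the coefficient of index `q + 2`, above the single index `k + 2`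
    -- at which the variable is visible.
    rw [← extDeriv_cov w, dispersion_extDeriv hW, ih _ (by omega), ih _ (by omega), map_zero,
      zero_add, zero_sub, neg_eq_zero]
    refine Finset.sum_eq_zero fun i' _ => ?_
    rw [ladder_X_cov, if_neg (by omega), mul_zero]

/-- The case `q = 0` is why the ladder goes down to `D⁻²`: the third-order coefficient of the
concomitant contains `-c j D_x (w a j)`, which is matched by the coefficient of `D⁻²` in the
potential. -/
theorem dispersion_pot (hW : IsSymmetry w W L) (hd : IsDispersive W L c) (j : Fin 2) (a : Fin m)
    (q : ℕ) : dispersion w W L c j q (X (ExtVar.pot 0 a)) = 0 := by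
  classical
  have h2 : ∀ k i, ladder w 0 i (k + 2) (X (ExtVar.pot 0 a)) = 0 := fun k i =>
    pderiv_X_of_ne (by simp)
  have h1 : ∀ i, ladder w 0 i 1 (X (ExtVar.pot 0 a)) = emb R m (w a i) := by
    intro i
    rw [ladder_one, Finset.sum_eq_single a, pderiv_X_self, mul_one]
    · intro b _ hb
      rw [pderiv_X_of_ne (by simpa using hb.symm), mul_zero]
    · simp
  have h0 : ∀ i, ladder w 0 i 0 (X (ExtVar.pot 0 a)) = -extDeriv w (emb R m (w a i)) := by
    intro i
    rw [ladder_zero, Finset.sum_eq_single a, pderiv_X_self, mul_one]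
    · intro b _ hb
      rw [pderiv_X_of_ne (by simpa using hb.symm), mul_zero]
    · simp
  rw [dispersion_apply, lieDeriv_pot, h2 (q + 3), map_zero, sub_zero]
  obtain ⟨hp7, hp6, hp5⟩ := ladder_potConc hW hd 0 j a
  match q with
  | 0 =>
    rw [hp5, h0]
    simp only [zero_add, h1]
    simp only [mul_comm (emb R m (w a _))]
    ring
  | 1 =>
    rw [hp6, h1]
    simp only [h2, mul_zero, Finset.sum_const_zero]
    ring
  | q + 2 =>
    rw [hp7 _ (by omega), h2]
    simp only [show q + 2 + 1 = q + 1 + 2 by omega, h2, mul_zero, Finset.sum_const_zero]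
    ring

/-- By the chain rule only variables that occur in `f` matter. Potentials are always annihilated,
and covector derivatives below the order of `f` are annihilated as soon as `q ≥ n`. So the two
leading terms of the commutator are exact on the top two coefficients of `f`. -/
theorem dispersion_eq_zero (hW : IsSymmetry w W L) (hd : IsDispersive W L c) {f : ExtPoly R m}
    {n : ℕ} (hf : ∀ j, ∀ k > n + 1, ladder w 0 j k f = 0) (j : Fin 2) {q : ℕ} (hq : n ≤ q) :
    dispersion w W L c j q f = 0 := by
  rw [derivation_eq_sum_vars]
  have hz : ∀ v : ExtVar m, covDeg v 0 = 0 → dispersion w W L c j q (X v) = 0 := by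
    intro v hv
    have h1 := fun i k => ladder_eq_zero_of_hasDeg (w := w) (hasDeg_X (R := R) v) hv i k
    have h2 := fun i k => ladder_eq_zero_of_hasDeg (w := w)
      (hasDeg_lieDeriv (W := W) (L := L) (w := w) (hasDeg_X (R := R) v)) hv i k
    rw [dispersion_apply]
    simp [h1, h2]
  refine Finset.sum_eq_zero fun v _ => ?_
  by_cases hv : covDeg v 0 = 0
  · rw [hz v hv, mul_zero]
  cases v with
  | fld i k => exact absurd rfl hv
  | cov s i k =>
    have hs : s = 0 := by
      by_contra hs
      exact hv (Pi.single_eq_of_ne (Ne.symm hs) _)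
    subst hs
    by_cases hk : k + 2 > n + 1
    · have := hf i _ hk
      rw [ladder_add_two] at this
      rw [this, zero_mul]
    · rw [dispersion_cov hW hd j i k q (by omega), mul_zero]
  | pot s a =>
    have hs : s = 0 := by
      by_contra hs
      exact hv (Pi.single_eq_of_ne (Ne.symm hs) _)
    subst hs
    rw [dispersion_pot hW hd, mul_zero]

/-- The counterpart for `L E`: composition with `c D⁵ + b D⁴ + ⋯` raises the order by five and adds
`5 c a' + b a` to the second coefficient. -/
theorem ladder_act_linOp (hd : IsDispersive W L c) {f : ExtPoly R m} {n : ℕ} {j : Fin 2}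
    (hf : ∀ k > n + 1, ladder w 0 j k f = 0) (i k : Fin 2) :
    ladder w 0 j (n + 6) (extAct w (L i k) f) =
        (if k = i then C (c i) * ladder w 0 j (n + 1) f else 0) ∧
      ladder w 0 j (n + 5) (extAct w (L i k) f) =
        (if k = i then C (c i) * (ladder w 0 j n f + 5 * extDeriv w (ladder w 0 j (n + 1) f))
          else 0) + emb R m (pderiv (k, 4) (W i)) * ladder w 0 j (n + 1) f := by
  have h := fun l => ladder_iterate_extDeriv hf l
  have h5 : emb R m (pderiv (k, 5) (W i)) = if k = i then C (c i) else 0 := by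
    rw [hd.lead]
    split_ifs <;> simp
  have key : ∀ q, ladder w 0 j q (extAct w (L i k) f) = ∑ l ∈ Finset.range 6,
      emb R m (pderiv (k, l) (W i)) * ladder w 0 j q ((extDeriv w)^[l] f) := by
    intro q
    rw [extAct, hd.lin, act_linOp, map_sum]
    exact Finset.sum_congr rfl fun l _ => ladder_emb_mul _ _ _ _ _
  rw [key, key]
  constructor
  · rw [Finset.sum_range_succ, Finset.sum_eq_zero, zero_add, show n + 6 = n + 1 + 5 by omega,
      (h 5).2.1, h5]
    · split_ifs <;> ring
    · intro l hl
      rw [(h l).1 _ (by have := Finset.mem_range.1 hl; omega), mul_zero]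
  · rw [Finset.sum_range_succ, Finset.sum_range_succ, Finset.sum_eq_zero, zero_add,
      (h 5).2.2, h5, show n + 5 = n + 1 + 4 by omega, (h 4).2.1]
    · push_cast
      split_ifs <;> ring
    · intro l hl
      rw [(h l).1 _ (by have := Finset.mem_range.1 hl; omega), mul_zero]

/-- A dispersive flow has no invariants that are linear in `P₀` and depend on another covector. -/
theorem eq_zero_of_lieDeriv_eq [IsDomain R] [CharZero R] (hti : TailIndep w)
    (hW : IsSymmetry w W L) (hd : IsDispersive W L c) {E : Fin 2 → ExtPoly R m}
    (hE : ∀ i, HasDeg (E i) ![1, 1, 0])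
    (hinv : ∀ i, lieDeriv w W L (E i) = ∑ j, extAct w (L i j) (E j)) : E = 0 := by
  have hne : ∀ i j : Fin 2, j ≠ i → c j ≠ c i := by
    intro i j hij
    fin_cases i <;> fin_cases j <;> simp at hij ⊢
    · exact hd.ne.symm
    · exact hd.ne
  -- Induction from the top: if all coefficients above index `n + 1` vanish, so do those at index `n
  -- + 1`.
  have step : ∀ n, (∀ i j, ∀ k > n + 1, ladder w 0 j k (E i) = 0) →
      ∀ i j, ladder w 0 j (n + 1) (E i) = 0 := by
    intro n hn
    -- At index `n + 6` the equation `E_t = L E` reads `c j * a = c i * a`, with distinct `c i, c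
    -- j`.
    have hoff : ∀ i j, j ≠ i → ladder w 0 j (n + 1) (E i) = 0 := by
      intro i j hij
      have h1 := dispersion_eq_zero hW hd (hn i) j (Nat.le_succ n)
      rw [dispersion_apply, hinv, hn i j _ (by omega), map_zero, sub_zero, map_sum,
        Finset.sum_eq_single i, (ladder_act_linOp hd (hn i j) i i).1, if_pos rfl,
        Finset.sum_eq_zero, add_zero, ← sub_mul, ← C_sub] at h1
      · rcases mul_eq_zero.1 h1 with h1 | h1
        · rw [C_eq_zero, sub_eq_zero] at h1
          exact absurd h1.symm (hne i j hij)
        · exact h1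
      · exact fun i' _ => by rw [hn i i' _ (by omega), mul_zero]
      · intro k _ hk
        rw [(ladder_act_linOp hd (hn k j) i k).1, if_neg hk]
      · simp
    intro i j
    by_cases hij : j = i
    · subst hij
      have h1 := dispersion_eq_zero hW hd (hn j) j le_rfl
      have h2 : ladder w 0 j (n + 5) (∑ k, extAct w (L j k) (E k)) = C (c j) *
          (ladder w 0 j n (E j) + 5 * extDeriv w (ladder w 0 j (n + 1) (E j))) := by
        rw [map_sum, Finset.sum_eq_single j]
        · rw [(ladder_act_linOp hd (hn j j) j j).2, if_pos rfl, hd.sub, map_zero, zero_mul,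
            add_zero]
        · intro k _ hk
          rw [(ladder_act_linOp hd (hn k j) j k).2, if_neg hk, hoff k j hk.symm, mul_zero,
            zero_add]
        · simp
      have h3 : ∑ i, ladder w 0 j 6 (adjCov w L 0 i) * ladder w 0 i (n + 1) (E j) = 0 := by
        refine Finset.sum_eq_zero fun i _ => ?_
        by_cases hi : i = j
        · rw [(ladder_adjCov hd 0 j i).2.2 hi, zero_mul]
        · rw [hoff j i hi, mul_zero]
      rw [dispersion_apply, hinv, h2, h3, hn j j (n + 5) (by omega), map_zero] at h1
      -- On the diagonal the terms `c j * a` agree, and index `n + 5` leaves `5 c j D_x a = 0`. The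
      -- coefficient `a` has lost `P₀` but is still linear in `P₁`, so it cannot be a nonzero
      -- constant.
      have h4 : C (c j) * (C 5 * extDeriv w (ladder w 0 j (n + 1) (E j))) = 0 := by
        rw [← h1, show (C 5 : ExtPoly R m) = 5 from map_ofNat C 5]; ring
      rw [mul_eq_zero, mul_eq_zero, C_eq_zero, C_eq_zero] at h4
      refine eq_zero_of_extDeriv_eq_zero hti (s := 1) (n := ![0, 1, 0]) (by simp)
        (hasDeg_ladder (hE j) (by decide) j (n + 1)) ?_
      exact (h4.resolve_left (hd.ne_zero j)).resolve_left (by norm_num)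
    · exact hoff i j hij
  have hN : ∃ N, ∀ i j, ∀ k ≥ N, ladder w 0 j k (E i) = 0 := by
    choose N hN using fun i => exists_ladder_eq_zero (w := w) 0 (E i)
    refine ⟨max (N 0) (N 1), fun i j k hk => hN i k ?_ j⟩
    fin_cases i
    · exact le_trans (le_max_left _ _) hk
    · exact le_trans (le_max_right _ _) hk
  obtain ⟨N, hN⟩ := hN
  have hall : ∀ l ≤ N, ∀ i j, ∀ k > N - l, ladder w 0 j k (E i) = 0 := by
    intro l
    induction l with
    | zero => exact fun _ i j k hk => hN i j k (by omega)
    | succ l ih =>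
      intro hl i j k hk
      rcases (show N - l ≤ k by omega).eq_or_lt with h | h
      · have := step (N - (l + 1)) (fun i j k hk => ih (by omega) i j k (by omega)) i j
        rwa [show N - (l + 1) + 1 = k by omega] at this
      · exact ih (by omega) i j k h
  funext i
  exact eq_zero_of_ladder hti (s := 0) (by simp) (hE i)
    fun j k => hall N le_rfl i j (k + 1) (by omega)

/-- A skew-symmetric operator that is invariant under its tail flows, one of which is dispersive,
has vanishing trivector. -/
theorem trivectorVanishes_of_isInvariant [IsDomain R] [CharZero R] (hti : TailIndep w)
    {Lw : Fin m → Fin 2 → Fin 2 → DiffOp R} {K : WNLOp w}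
    (hw : ∀ a, IsSymmetry w (w a) (Lw a)) (hs : K.IsSkew)
    (hK : ∀ a, K.IsInvariant (w a) (Lw a)) {b : Fin m} (hb : IsDispersive (w b) (Lw b) c) :
    K.TrivectorVanishes := by
  obtain ⟨E, hE, hT, hinv⟩ := exists_trivector_eq hti hw hs hK
  rw [eq_zero_of_lieDeriv_eq hti (hw b) hb hE (hinv b)] at hT
  refine (DiffOp.integral_eq_zero_iff _).1 (hT.trans ?_)
  simp

/-- Skew-symmetric operators are skew-adjoint. -/
theorem isSkewAdjoint_of_isSkew {K : WNLOp w} (hs : K.IsSkew) : K.IsSkewAdjoint := by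
  refine (DiffOp.integral_eq_zero_iff (extDeriv w)).1 ?_
  have h := hs.integral_cov_mul 0 (cov R m 1)
  -- In the tail, `w a · P₀` is the total derivative of the potential of `P₀`, so integration by
  -- parts is available.
  have h1 : extInt w (∑ i, cov R m 0 i * ∑ a, ∑ b, K.tail a b •
      (emb R m (w a i) * X (ExtVar.pot 1 b))) = -extInt w (∑ a, ∑ b, K.tail a b •
        (X (ExtVar.pot 0 a) * ∑ i, emb R m (w b i) * cov R m 1 i)) := by
    have h2 : ∑ i, cov R m 0 i * ∑ a, ∑ b, K.tail a b •
        (emb R m (w a i) * X (ExtVar.pot 1 b)) = ∑ a, ∑ b, K.tail a b •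
          (extDeriv w (X (ExtVar.pot 0 a)) * X (ExtVar.pot 1 b)) := by
      simp only [extDeriv_pot, Finset.mul_sum, Finset.sum_mul, Finset.smul_sum, mul_smul_comm]
      rw [Finset.sum_comm]
      refine Finset.sum_congr rfl fun a _ => ?_
      rw [Finset.sum_comm]
      refine Finset.sum_congr rfl fun b _ => Finset.sum_congr rfl fun i _ => ?_
      congr 1; ring
    rw [h2, map_sum, map_sum, ← Finset.sum_neg_distrib]
    refine Finset.sum_congr rfl fun a _ => ?_
    rw [map_sum, map_sum, ← Finset.sum_neg_distrib]
    refine Finset.sum_congr rfl fun b _ => ?_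
    rw [LinearMap.map_smul, LinearMap.map_smul, ← smul_neg, ← extDeriv_pot w,
      show extInt w (extDeriv w (X (ExtVar.pot 0 a)) * X (ExtVar.pot 1 b)) = _ from
        DiffOp.integral_deriv_mul _ _ _]
  have h3 : K.pairing 0 1 = ∑ i, cov R m 0 i * ∑ j, extAct w (K.loc i j) (cov R m 1 j) +
      ∑ i, cov R m 0 i * ∑ a, ∑ b, K.tail a b • (emb R m (w a i) * X (ExtVar.pot 1 b)) := by
    simp only [pairing, value_eq, mul_add, Finset.sum_add_distrib]
  rw [map_add, h3, map_add, h1, ← sub_eq_add_neg, h]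
  simp [pairing]

end WNLOp


/-! ## Sparse polynomials for computations in the kernel

A monomial is encoded by a product of primes, one for each variable, and a coefficient by a
difference of two natural numbers. The operations are written with recursors, which the kernel
evaluates faster than structural recursion. -/

/-- Sparse polynomials; `bad` marks the result of an operation that has failed. -/
inductive SPoly
  | nil
  | bad
  | cons (k a b : ℕ) (t : SPoly)

namespace SPoly

/-- Merge a term into a sum. -/
def mergeCons (k a b : ℕ) (t : SPoly) (ih : SPoly → SPoly) (l : SPoly) : SPoly :=
  SPoly.rec (motive := fun _ => SPoly) (cons k a b t) bad
    (fun k' a' b' t' ih' => Bool.rec (cons k' a' b' ih')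
      (Bool.rec (cons k a b (ih (cons k' a' b' t')))
        (cons k (Nat.add a a') (Nat.add b b') (ih t')) (Nat.beq k k')) (Nat.ble k k')) l

/-- Sum. -/
def merge (l : SPoly) : SPoly → SPoly :=
  SPoly.rec (motive := fun _ => SPoly → SPoly) (fun l => l) (fun _ => bad)
    (fun k a b t ih => mergeCons k a b t ih) l

/-- Negation. -/
def neg (l : SPoly) : SPoly :=
  SPoly.rec (motive := fun _ => SPoly) nil bad (fun k a b _ ih => cons k b a ih) l

/-- Multiplication by a term. -/
def scale (m a b : ℕ) (l : SPoly) : SPoly :=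
  SPoly.rec (motive := fun _ => SPoly) nil bad
    (fun k a' b' _ ih => cons (Nat.mul m k) (Nat.add (Nat.mul a a') (Nat.mul b b'))
      (Nat.add (Nat.mul b a') (Nat.mul a b')) ih) l

/-- Add the members of a list in pairs. -/
def pairs (l : List SPoly) : Option SPoly → List SPoly :=
  List.rec (motive := fun _ => Option SPoly → List SPoly) (fun o => Option.rec [] (fun a => [a]) o)
    (fun a _ ih o => Option.rec (ih (some a)) (fun b => merge b a :: ih none) o) l

/-- Balanced sum of a list. -/
def sumFuel (n : ℕ) : List SPoly → SPoly :=
  Nat.rec (motive := fun _ => List SPoly → SPoly)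
    (fun l => List.rec nil (fun a _ ih => merge a ih) l)
    (fun _ ih l => List.rec nil (fun a t _ => List.rec a (fun _ _ _ => ih (pairs l none)) t) l) n

/-- The terms of a product. -/
def mulTerms (f g : SPoly) : List SPoly → List SPoly :=
  SPoly.rec (motive := fun _ => List SPoly → List SPoly) (fun l => l) (fun _ => [bad])
    (fun m a b _ ih l => scale m a b g :: ih l) f

/-- Product. -/
def mul (f g : SPoly) : SPoly := sumFuel 14 (mulTerms f g [])

/-- The multiplicity of `p` in `k`, up to `n`. -/
def mult (p : ℕ) (n : ℕ) : ℕ → ℕ :=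
  Nat.rec (motive := fun _ => ℕ → ℕ) (fun _ => 0)
    (fun _ ih k => Bool.rec 0 (Nat.succ (ih (Nat.div k p))) (Nat.beq (Nat.mod k p) 0)) n

/-- Partial derivative. -/
def partialDeriv (p : ℕ) (l : SPoly) : SPoly :=
  SPoly.rec (motive := fun _ => SPoly) nil bad (fun k a b _ ih => Bool.rec ih
    ((fun e => cons (Nat.div k p) (Nat.mul e a) (Nat.mul e b) ih) (mult p 13 k))
      (Nat.beq (Nat.mod k p) 0)) l

/-- All monomials divide `M`. -/
def supported (M : ℕ) (l : SPoly) : Bool :=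
  SPoly.rec (motive := fun _ => Bool) true false
    (fun k _ _ _ ih => Bool.rec false ih (Nat.beq (Nat.mod M k) 0)) l

/-- The product of all monomials. -/
def prodMon (l : SPoly) : ℕ :=
  SPoly.rec (motive := fun _ => ℕ) 1 0 (fun k _ _ _ ih => Nat.mul k ih) l

/-- The thirteenth power of the product of the variables of a table. -/
def bound (tb : List (ℕ × SPoly)) : ℕ :=
  Nat.pow (List.rec 1 (fun p _ ih => Nat.mul p.1 ih) tb) 13

/-- Cancel common summands in the coefficients. -/
def clean (l : SPoly) : SPoly :=
  SPoly.rec (motive := fun _ => SPoly) nil bad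
    (fun k a b _ ih => Bool.rec (cons k (Nat.sub a b) (Nat.sub b a) ih) ih (Nat.beq a b)) l

/-- The terms of a derivative. -/
def derTerms (N : ℕ) (f : SPoly) (tb : List (ℕ × SPoly)) : List SPoly :=
  List.rec (motive := fun _ => List SPoly) []
    (fun p _ ih => Bool.rec ih (mulTerms p.2 (partialDeriv p.1 f) ih)
      (Nat.beq (Nat.mod N p.1) 0)) tb

/-- The derivation with the given values on the variables. -/
def der (tb : List (ℕ × SPoly)) (f : SPoly) : SPoly :=
  Bool.rec bad (clean (sumFuel 14 (derTerms (prodMon f) f tb))) (supported (bound tb) f)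

/-- Test for zero. -/
def isZero (l : SPoly) : Bool :=
  SPoly.rec (motive := fun _ => Bool) true false (fun _ a b _ ih => Bool.rec false ih (Nat.beq a b)) l

/-- A monomial. -/
def mono (k : ℕ) : SPoly := cons k 1 0 nil

/-- A constant. -/
def const (a : ℕ) : SPoly := cons 1 a 0 nil

section Soundness

variable {B : Type*} [CommRing B] (ρ : ℕ → B)

/-- The value of a monomial. -/
def monVal (k : ℕ) : B := k.factorization.prod fun p e => ρ p ^ e

theorem monVal_one : monVal ρ 1 = 1 := by simp [monVal]

theorem monVal_mul {k l : ℕ} (hk : k ≠ 0) (hl : l ≠ 0) :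
    monVal ρ (k * l) = monVal ρ k * monVal ρ l := by
  rw [monVal, Nat.factorization_mul hk hl]
  exact Finsupp.prod_add_index' (fun _ => pow_zero _) (fun _ _ _ => pow_add _ _ _)

theorem monVal_prime {p : ℕ} (hp : p.Prime) : monVal ρ p = ρ p := by
  rw [monVal, hp.factorization, Finsupp.prod_single_index (h := fun p e => ρ p ^ e) (pow_zero _), pow_one]

/-- `x` is the value of a sparse polynomial. -/
def Den : SPoly → B → Prop
  | nil, x => x = 0
  | bad, _ => True
  | cons k a b t, x => k ≠ 0 ∧ ∃ y, Den t y ∧ x = ((a : B) - b) * monVal ρ k + y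

/-- `x` is the sum of the values of a list of sparse polynomials. -/
def DenSum : List SPoly → B → Prop
  | [], x => x = 0
  | a :: l, x => ∃ y z, Den ρ a y ∧ DenSum l z ∧ x = y + z

variable {ρ} {f g : SPoly} {x y : B}

theorem den_cast (h : Den ρ f x) (e : x = y) : Den ρ f y := e ▸ h

theorem den_mono {p : ℕ} (hp : p.Prime) : Den ρ (mono p) (ρ p) :=
  ⟨hp.ne_zero, 0, rfl, by rw [monVal_prime ρ hp]; simp⟩

theorem den_const (n : ℕ) : Den ρ (const n) (n : B) :=
  ⟨one_ne_zero, 0, rfl, by rw [monVal_one]; simp⟩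

/-- Soundness does not depend on the order of monomials. The order only serves to bring equal
monomials together. -/
theorem den_merge (hf : Den ρ f x) (hg : Den ρ g y) : Den ρ (merge f g) (x + y) := by
  induction f generalizing g x y with
  | nil =>
    rw [show x = 0 from hf, zero_add]
    exact hg
  | bad => trivial
  | cons k a b t ih =>
    obtain ⟨hk, x', hx', rfl⟩ := hf
    induction g generalizing y with
    | nil =>
      rw [show y = 0 from hg, add_zero]
      exact ⟨hk, x', hx', rfl⟩
    | bad => trivial
    | cons k' a' b' t' ih' =>
      have hg' := hg
      obtain ⟨hk', y', hy', rfl⟩ := hg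
      change Den ρ (Bool.rec (cons k' a' b' (merge (cons k a b t) t'))
        (Bool.rec (cons k a b (merge t (cons k' a' b' t')))
          (cons k (a + a') (b + b') (merge t t')) (Nat.beq k k')) (Nat.ble k k')) _
      cases Nat.ble k k' with
      | false =>
        refine ⟨hk', _, ih' hy', ?_⟩
        ring
      | true =>
        cases h : Nat.beq k k' with
        | false => exact ⟨hk, _, ih hx' hg', by ring⟩
        | true =>
          have := Nat.eq_of_beq_eq_true h
          subst this
          refine ⟨hk, _, ih hx' hy', ?_⟩
          push_cast
          ring

theorem den_neg (hf : Den ρ f x) : Den ρ (neg f) (-x) := by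
  induction f generalizing x with
  | nil =>
    rw [show x = 0 from hf, neg_zero]
    rfl
  | bad => trivial
  | cons k a b t ih =>
    obtain ⟨hk, x', hx', rfl⟩ := hf
    exact ⟨hk, _, ih hx', by ring⟩

theorem den_scale (hf : Den ρ f x) {m : ℕ} (hm : m ≠ 0) (a b : ℕ) :
    Den ρ (scale m a b f) (((a : B) - b) * monVal ρ m * x) := by
  induction f generalizing x with
  | nil =>
    rw [show x = 0 from hf, mul_zero]
    rfl
  | bad => trivial
  | cons k a' b' t ih =>
    obtain ⟨hk, x', hx', rfl⟩ := hf
    refine ⟨mul_ne_zero hm hk, _, ih hx', ?_⟩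
    change _ = (((a * a' + b * b' : ℕ) : B) - (b * a' + a * b' : ℕ)) * monVal ρ (m * k) + _
    rw [monVal_mul ρ hm hk]
    push_cast
    ring

theorem denSum_pairs {l : List SPoly} (hl : DenSum ρ l x) : DenSum ρ (pairs l none) x ∧
    ∀ f y, Den ρ f y → DenSum ρ (pairs l (some f)) (y + x) := by
  induction l generalizing x with
  | nil =>
    rw [show x = 0 from hl]
    exact ⟨rfl, fun f y hf => ⟨y, 0, hf, rfl, rfl⟩⟩
  | cons a l ih =>
    obtain ⟨y, z, hy, hz, rfl⟩ := hl
    refine ⟨(ih hz).2 a y hy, fun f y' hf => ⟨y' + y, z, den_merge hf hy, (ih hz).1, by ring⟩⟩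

/-- Valid for any amount of fuel: when it runs out, the remaining list is summed term by term. -/
theorem den_sumFuel (n : ℕ) {l : List SPoly} (hl : DenSum ρ l x) : Den ρ (sumFuel n l) x := by
  induction n generalizing l x with
  | zero =>
    induction l generalizing x with
    | nil => exact hl
    | cons a l ih =>
      obtain ⟨y, z, hy, hz, rfl⟩ := hl
      exact den_merge hy (ih hz)
  | succ n ih =>
    cases l with
    | nil => exact hl
    | cons a l =>
      cases l with
      | nil =>
        obtain ⟨y, z, hy, hz, rfl⟩ := hl
        rw [show z = 0 from hz, add_zero]
        exact hy
      | cons b l => exact ih (denSum_pairs hl).1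

theorem denSum_mulTerms (hf : Den ρ f x) (hg : Den ρ g y) {l : List SPoly} {z : B}
    (hl : DenSum ρ l z) : DenSum ρ (mulTerms f g l) (x * y + z) := by
  induction f generalizing x with
  | nil =>
    rw [show x = 0 from hf, zero_mul, zero_add]
    exact hl
  | bad => exact ⟨_, 0, trivial, rfl, (add_zero _).symm⟩
  | cons k a b t ih =>
    obtain ⟨hk, x', hx', rfl⟩ := hf
    exact ⟨_, _, den_scale hg hk a b, ih hx', by ring⟩

theorem den_mul (hf : Den ρ f x) (hg : Den ρ g y) : Den ρ (mul f g) (x * y) := by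
  have h := den_sumFuel 14 (denSum_mulTerms hf hg (l := []) (z := 0) rfl)
  rwa [add_zero] at h

theorem den_clean (hf : Den ρ f x) : Den ρ (clean f) x := by
  induction f generalizing x with
  | nil => exact hf
  | bad => trivial
  | cons k a b t ih =>
    obtain ⟨hk, x', hx', rfl⟩ := hf
    change Den ρ (Bool.rec (cons k (a - b) (b - a) (clean t)) (clean t) (Nat.beq a b)) _
    cases h : Nat.beq a b with
    | true =>
      rw [Nat.eq_of_beq_eq_true h, sub_self, zero_mul, zero_add]
      exact ih hx'
    | false =>
      refine ⟨hk, x', ih hx', ?_⟩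
      rcases le_total a b with h | h
      · rw [Nat.sub_eq_zero_of_le h, Nat.cast_sub h]; push_cast; ring
      · rw [Nat.sub_eq_zero_of_le h, Nat.cast_sub h]; push_cast; ring

/-- Every value is admissible for `bad`, but the test rejects `bad`, so a failed operation cannot
certify that something vanishes. -/
theorem eq_zero_of_isZero (hf : Den ρ f x) (h : isZero f = true) : x = 0 := by
  induction f generalizing x with
  | nil => exact hf
  | bad => exact absurd h (by simp [isZero])
  | cons k a b t ih =>
    obtain ⟨hk, x', hx', rfl⟩ := hf
    change Bool.rec false (isZero t) (Nat.beq a b) = true at h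
    cases hab : Nat.beq a b with
    | false => rw [hab] at h; exact absurd h Bool.false_ne_true
    | true =>
      rw [hab] at h
      rw [Nat.eq_of_beq_eq_true hab, ih hx' h]
      ring

/-- The count is capped, so it equals the exponent only below the cap; the divisibility test in
`supported` supplies this bound. -/
theorem mult_eq {p : ℕ} (hp : p.Prime) (n : ℕ) {k : ℕ} (hk : k ≠ 0) :
    mult p n k = min n (k.factorization p) := by
  induction n generalizing k with
  | zero => simp [mult]
  | succ n ih =>
    change (Bool.rec 0 (Nat.succ (mult p n (k / p))) (Nat.beq (k % p) 0) : ℕ) = _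
    cases h : Nat.beq (k % p) 0 with
    | false =>
      have h1 : ¬ p ∣ k := fun hd => Nat.ne_of_beq_eq_false h (Nat.mod_eq_zero_of_dvd hd)
      rw [Nat.factorization_eq_zero_of_not_dvd h1]
      simp
    | true =>
      have hd : p ∣ k := Nat.dvd_of_mod_eq_zero (Nat.eq_of_beq_eq_true h)
      have hk' : k / p ≠ 0 := (Nat.div_pos (Nat.le_of_dvd (Nat.pos_of_ne_zero hk) hd) hp.pos).ne'
      have h1 : 1 ≤ k.factorization p := (hp.dvd_iff_one_le_factorization hk).1 hd
      change Nat.succ (mult p n (k / p)) = _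
      rw [ih hk', Nat.factorization_div hd, hp.factorization]
      simp only [Finsupp.coe_tsub, Pi.sub_apply, Finsupp.single_eq_same]
      omega

/-- The derivative of a monomial. -/
theorem deriv_monVal {R : Type*} [CommRing R] [Algebra R B] (d : Derivation R B B) {k : ℕ}
    (hk : k ≠ 0) {S : Finset ℕ} (hS : k.primeFactors ⊆ S) (hp : ∀ p ∈ S, p.Prime) :
    d (monVal ρ k) =
      ∑ p ∈ S, (k.factorization p : B) * monVal ρ (k / p) * d (ρ p) := by
  induction k using induction_on_primes with
  | zero => exact absurd rfl hk
  | one => simp [monVal_one]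
  | prime_mul q a hq ih =>
    have ha : a ≠ 0 := right_ne_zero_of_mul hk
    rw [Nat.primeFactors_mul hq.ne_zero ha] at hS
    rw [monVal_mul ρ hq.ne_zero ha, Derivation.leibniz, ih ha (Finset.union_subset_right hS),
      monVal_prime ρ hq, smul_eq_mul, smul_eq_mul]
    have hqS : q ∈ S := hS (Finset.mem_union_left _ (by simp [hq.primeFactors]))
    have h : ∀ p ∈ S, ((q * a).factorization p : B) * monVal ρ (q * a / p) * d (ρ p) =
        ρ q * ((a.factorization p : B) * monVal ρ (a / p) * d (ρ p)) +
          if p = q then monVal ρ a * d (ρ q) else 0 := by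
      intro p hpS
      rw [Nat.factorization_mul hq.ne_zero ha, hq.factorization, Finsupp.add_apply,
        Finsupp.single_apply]
      by_cases hpa : p ∣ a
      · have h1 : monVal ρ (q * a / p) = ρ q * monVal ρ (a / p) := by
          rw [Nat.mul_div_assoc q hpa, monVal_mul ρ hq.ne_zero, monVal_prime ρ hq]
          exact (Nat.div_pos (Nat.le_of_dvd (Nat.pos_of_ne_zero ha) hpa) (hp p hpS).pos).ne'
        rw [h1]
        by_cases hpq : p = q
        · subst hpq
          have h2 : monVal ρ a = ρ p * monVal ρ (a / p) := by
            conv_lhs => rw [← Nat.mul_div_cancel' hpa]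
            rw [monVal_mul ρ hq.ne_zero, monVal_prime ρ hq]
            exact (Nat.div_pos (Nat.le_of_dvd (Nat.pos_of_ne_zero ha) hpa) hq.pos).ne'
          rw [if_pos rfl, if_pos rfl, h2]
          push_cast
          ring
        · rw [if_neg (Ne.symm hpq), if_neg hpq]
          push_cast
          ring
      · rw [Nat.factorization_eq_zero_of_not_dvd hpa]
        by_cases hpq : p = q
        · subst hpq
          rw [if_pos rfl, if_pos rfl, Nat.mul_div_cancel_left _ hq.pos]
          push_cast
          ring
        · rw [if_neg (Ne.symm hpq), if_neg hpq]
          push_cast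
          ring
    rw [Finset.sum_congr rfl h, Finset.sum_add_distrib, ← Finset.mul_sum, Finset.sum_ite_eq',
      if_pos hqS]

/-- The variables of a table are distinct primes. -/
def GoodTable (tb : List (ℕ × SPoly)) : Prop :=
  (tb.map Prod.fst).Nodup ∧ ∀ p ∈ tb.map Prod.fst, p.Prime

theorem bound_eq (tb : List (ℕ × SPoly)) : bound tb = (tb.map Prod.fst).prod ^ 13 := by
  have h : ∀ tb : List (ℕ × SPoly),
      (List.rec 1 (fun p _ ih => Nat.mul p.1 ih) tb : ℕ) = (tb.map Prod.fst).prod := by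
    intro tb
    induction tb with
    | nil => rfl
    | cons p tb ih =>
      rw [List.map_cons, List.prod_cons, ← ih]
      rfl
  rw [← h]
  rfl

theorem GoodTable.factorization_le {tb : List (ℕ × SPoly)} (ht : GoodTable tb) {k : ℕ}
    (hk : k ∣ bound tb) (p : ℕ) : k.factorization p ≤ 13 := by
  by_cases hp : p.Prime
  · have hne : (tb.map Prod.fst).prod ≠ 0 :=
      List.prod_ne_zero fun h => (ht.2 0 h).ne_zero rfl
    have h1 := (Nat.factorization_le_iff_dvd (ne_zero_of_dvd_ne_zero
      (by rw [bound_eq]; exact pow_ne_zero _ hne) hk)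
      (by rw [bound_eq]; exact pow_ne_zero _ hne)).2 hk p
    rw [bound_eq, Nat.factorization_pow] at h1
    -- Distinct primes have a squarefree product, so a divisor of its thirteenth power has exponents
    -- at most thirteen.
    have h2 : (tb.map Prod.fst).prod.factorization p ≤ 1 := by
      have hs : Squarefree (tb.map Prod.fst).prod := by
        have : ∀ l : List ℕ, l.Nodup → (∀ p ∈ l, p.Prime) → Squarefree l.prod := by
          intro l
          induction l with
          | nil => simp
          | cons q l ih =>
            intro hn hl
            rw [List.nodup_cons] at hn
            rw [List.prod_cons, Nat.squarefree_mul_iff]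
            refine ⟨?_, (hl q (by simp)).prime.squarefree,
              ih hn.2 fun p hp => hl p (List.mem_cons_of_mem _ hp)⟩
            refine Nat.coprime_list_prod_right_iff.2 fun p hp => ?_
            rw [Nat.coprime_primes (hl q (by simp)) (hl p (List.mem_cons_of_mem _ hp))]
            exact fun h => hn.1 (h ▸ hp)
        exact this _ ht.1 ht.2
      exact hs.natFactorization_le_one p
    calc k.factorization p ≤ _ := h1
      _ ≤ 13 := by simpa using Nat.mul_le_mul_left 13 h2
  · rw [Nat.factorization_eq_zero_of_not_prime _ hp]
    exact Nat.zero_le _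

theorem GoodTable.primeFactors_subset {tb : List (ℕ × SPoly)} (ht : GoodTable tb) {k : ℕ}
    (hk : k ∣ bound tb) : k.primeFactors ⊆ (tb.map Prod.fst).toFinset := by
  intro p hp
  have h := Nat.prime_of_mem_primeFactors hp
  have h1 : p ∣ (tb.map Prod.fst).prod := by
    refine h.dvd_of_dvd_pow (n := 13) ?_
    rw [← bound_eq]
    exact (Nat.dvd_of_mem_primeFactors hp).trans hk
  obtain ⟨q, hq, hpq⟩ := (Prime.dvd_prod_iff h.prime).1 h1
  rw [List.mem_toFinset, (Nat.prime_dvd_prime_iff_eq h (ht.2 q hq)).1 hpq]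
  exact hq

/-- The chain rule. The support test guarantees that every variable of `f` is in the table and that
all exponents are computed exactly. The values `q` must come with the statement, since the relation
`Den` does not determine them when `bad` occurs. -/
theorem exists_partialDeriv {R : Type*} [CommRing R] [Algebra R B] (d : Derivation R B B)
    {tb : List (ℕ × SPoly)} (ht : GoodTable tb) (hf : Den ρ f x)
    (hs : supported (bound tb) f = true) : ∃ q : ℕ → B,
      (∀ p, p.Prime → Den ρ (partialDeriv p f) (q p)) ∧
        d x = ∑ p ∈ (tb.map Prod.fst).toFinset, q p * d (ρ p) := by
  induction f generalizing x with
  | nil => exact ⟨0, fun _ _ => rfl, by rw [show x = 0 from hf]; simp⟩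
  | bad => exact absurd hs Bool.false_ne_true
  | cons k a b t ih =>
    obtain ⟨hk, x', hx', rfl⟩ := hf
    change (Bool.rec false (supported (bound tb) t) (Nat.beq (bound tb % k) 0) : Bool) = true at hs
    cases hdk : Nat.beq (bound tb % k) 0 with
    | false => rw [hdk] at hs; exact absurd hs Bool.false_ne_true
    | true =>
      rw [hdk] at hs
      have hdvd : k ∣ bound tb := Nat.dvd_of_mod_eq_zero (Nat.eq_of_beq_eq_true hdk)
      obtain ⟨q, hq, hqs⟩ := ih hx' hs
      have hm : ∀ p, p.Prime → mult p 13 k = k.factorization p := fun p hp => by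
        rw [mult_eq hp 13 hk, min_eq_right (ht.factorization_le hdvd p)]
      refine ⟨fun p => (k.factorization p : B) * ((a - b) * monVal ρ (k / p)) + q p,
        fun p hp => ?_, ?_⟩
      · change Den ρ (Bool.rec (partialDeriv p t) (cons (k / p) (mult p 13 k * a)
          (mult p 13 k * b) (partialDeriv p t)) (Nat.beq (k % p) 0)) _
        cases h : Nat.beq (k % p) 0 with
        | false =>
          have h1 : ¬ p ∣ k := fun hd => Nat.ne_of_beq_eq_false h (Nat.mod_eq_zero_of_dvd hd)
          beta_reduce
          rw [Nat.factorization_eq_zero_of_not_dvd h1, Nat.cast_zero, zero_mul, zero_add]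
          exact hq p hp
        | true =>
          have hd : p ∣ k := Nat.dvd_of_mod_eq_zero (Nat.eq_of_beq_eq_true h)
          refine ⟨(Nat.div_pos (Nat.le_of_dvd (Nat.pos_of_ne_zero hk) hd) hp.pos).ne', _,
            hq p hp, ?_⟩
          rw [hm p hp]
          push_cast
          ring
      · have hc : d ((a : B) - b) = 0 := by
          rw [map_sub, Derivation.map_natCast, Derivation.map_natCast, sub_self]
        rw [map_add, hqs, Derivation.leibniz, hc, smul_zero, add_zero, smul_eq_mul,
          deriv_monVal d hk (ht.primeFactors_subset hdvd) (fun p hp => ht.2 p (by simpa using hp)),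
          Finset.mul_sum, ← Finset.sum_add_distrib]
        exact Finset.sum_congr rfl fun p _ => by ring

/-- A prime that does not divide the product of all monomials divides none of them, so skipping such
variables in `derTerms` loses nothing. -/
theorem partialDeriv_eq_nil {p : ℕ} (h : Nat.beq (prodMon f % p) 0 = false) :
    partialDeriv p f = nil := by
  induction f with
  | nil => rfl
  | bad => exact absurd h (by simp [prodMon])
  | cons k a b t ih =>
    change Nat.beq ((k * prodMon t) % p) 0 = false at h
    have h1 := Nat.ne_of_beq_eq_false h
    change (Bool.rec (partialDeriv p t) (cons (k / p) (mult p 13 k * a)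
      (mult p 13 k * b) (partialDeriv p t)) (Nat.beq (k % p) 0) : SPoly) = nil
    cases hk : Nat.beq (k % p) 0 with
    | false =>
      refine ih ?_
      cases ht : Nat.beq (prodMon t % p) 0 with
      | false => rfl
      | true =>
        exact absurd (Nat.mod_eq_zero_of_dvd ((Nat.dvd_of_mod_eq_zero
          (Nat.eq_of_beq_eq_true ht)).mul_left k)) h1
    | true =>
      exact absurd (Nat.mod_eq_zero_of_dvd ((Nat.dvd_of_mod_eq_zero
        (Nat.eq_of_beq_eq_true hk)).mul_right _)) h1

theorem denSum_derTerms {q D : ℕ → B} {tb : List (ℕ × SPoly)}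
    (hq : ∀ p ∈ tb, Den ρ (partialDeriv p.1 f) (q p.1)) (hD : ∀ p ∈ tb, Den ρ p.2 (D p.1)) :
    DenSum ρ (derTerms (prodMon f) f tb) (tb.map fun p => q p.1 * D p.1).sum := by
  induction tb with
  | nil => rfl
  | cons p tb ih =>
    have ih := ih (fun p hp => hq p (List.mem_cons_of_mem _ hp))
      (fun p hp => hD p (List.mem_cons_of_mem _ hp))
    rw [List.map_cons, List.sum_cons]
    change DenSum ρ (Bool.rec (derTerms (prodMon f) f tb)
      (mulTerms p.2 (partialDeriv p.1 f) (derTerms (prodMon f) f tb))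
      (Nat.beq (prodMon f % p.1) 0)) _
    cases h : Nat.beq (prodMon f % p.1) 0 with
    | false =>
      have h1 := hq p (by simp)
      rw [partialDeriv_eq_nil h] at h1
      rw [show q p.1 = 0 from h1, zero_mul, zero_add]
      exact ih
    | true =>
      rw [mul_comm (q p.1)]
      exact denSum_mulTerms (hD p (by simp)) (hq p (by simp)) ih

theorem den_der {R : Type*} [CommRing R] [Algebra R B] {d : Derivation R B B}
    {tb : List (ℕ × SPoly)} (ht : GoodTable tb) (htd : ∀ p ∈ tb, Den ρ p.2 (d (ρ p.1)))
    (hf : Den ρ f x) : Den ρ (der tb f) (d x) := by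
  change Den ρ (Bool.rec bad (clean (sumFuel 14 (derTerms (prodMon f) f tb)))
    (supported (bound tb) f)) _
  cases hs : supported (bound tb) f with
  | false => trivial
  | true =>
    obtain ⟨q, hq, hd⟩ := exists_partialDeriv d ht hf hs
    have h := denSum_derTerms (ρ := ρ) (f := f) (q := q) (D := fun p => d (ρ p)) (tb := tb)
      (fun p hp => hq p.1 (ht.2 p.1 (List.mem_map_of_mem hp))) htd
    have h2 : (tb.map fun p => q p.1 * d (ρ p.1)).sum = d x := by
      rw [hd, List.sum_toFinset _ ht.1, List.map_map]
      rfl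
    rw [h2] at h
    exact den_clean (den_sumFuel 14 h)

/-- The partial derivative with respect to one variable of a table. -/
theorem den_partialDeriv {R : Type*} [CommRing R] [Algebra R B] {d : Derivation R B B}
    {tb : List (ℕ × SPoly)} (ht : GoodTable tb) {p : ℕ} (hp : p ∈ tb.map Prod.fst)
    (hd : ∀ p' ∈ tb.map Prod.fst, d (ρ p') = if p' = p then 1 else 0) (hf : Den ρ f x)
    (hs : supported (bound tb) f = true) : Den ρ (partialDeriv p f) (d x) := by
  obtain ⟨q, hq, hdx⟩ := exists_partialDeriv d ht hf hs
  have h : d x = q p := by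
    rw [hdx, Finset.sum_eq_single p]
    · rw [hd p hp, if_pos rfl, mul_one]
    · intro p' hp' hne
      rw [hd p' (by simpa using hp'), if_neg hne, mul_zero]
    · intro h
      exact absurd (List.mem_toFinset.2 hp) h
  rw [h]
  exact hq p (ht.2 p hp)

theorem den_map {B' : Type*} [CommRing B'] (φ : B →+* B') (hf : Den ρ f x) :
    Den (fun p => φ (ρ p)) f (φ x) := by
  induction f generalizing x with
  | nil =>
    rw [show x = 0 from hf, map_zero]
    rfl
  | bad => trivial
  | cons k a b t ih =>
    obtain ⟨hk, x', hx', rfl⟩ := hf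
    refine ⟨hk, _, ih hx', ?_⟩
    rw [map_add, map_mul, map_sub, map_natCast, map_natCast]
    congr 2
    rw [monVal, monVal, Finsupp.prod, Finsupp.prod, map_prod]
    exact Finset.prod_congr rfl fun p _ => map_pow φ _ _

end Soundness

end SPoly


namespace SPoly

/-! ### Operators

A list of sparse polynomials stands for the differential operator with these coefficients. -/

/-- The variables `u, v, u_x, v_x, …`. -/
def jetPrimes : List ℕ :=
  [2, 3, 5, 7, 11, 13, 17, 19, 23, 29, 31, 37, 41, 43, 47, 53, 59, 61, 67, 71, 73, 79, 83, 89, 97, 101]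

/-- The total derivative. -/
def derTable : List (ℕ × SPoly) :=
  [(2, mono 5), (3, mono 7), (5, mono 11), (7, mono 13), (11, mono 17), (13, mono 19),
    (17, mono 23), (19, mono 29), (23, mono 31), (29, mono 37), (31, mono 41), (37, mono 43),
    (41, mono 47), (43, mono 53), (47, mono 59), (53, mono 61), (59, mono 67), (61, mono 71),
    (67, mono 73), (71, mono 79), (73, mono 83), (79, mono 89), (83, mono 97), (89, mono 101)]

/-- Total derivative. -/
def deriv (f : SPoly) : SPoly := der derTable f

/-- Iterated total derivative. -/
def iterDeriv (n : ℕ) (f : SPoly) : SPoly := Nat.rec f (fun _ ih => deriv ih) n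

/-- Sum of operators. -/
def opAdd (x : List SPoly) : List SPoly → List SPoly :=
  List.rec (motive := fun _ => List SPoly → List SPoly) (fun y => y)
    (fun a t ih y => List.rec (a :: t) (fun b s _ => merge a b :: ih s) y) x

/-- Negation of an operator. -/
def opNeg (x : List SPoly) : List SPoly :=
  List.rec (motive := fun _ => List SPoly) [] (fun a _ ih => neg a :: ih) x

/-- Multiplication by a polynomial from the left. -/
def opScale (f : SPoly) (x : List SPoly) : List SPoly :=
  List.rec (motive := fun _ => List SPoly) [] (fun a _ ih => mul f a :: ih) x

/-- Clean all coefficients. -/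
def opClean (x : List SPoly) : List SPoly :=
  List.rec (motive := fun _ => List SPoly) [] (fun a _ ih => clean a :: ih) x

/-- The composition of `D_x` with an operator. -/
def opDeriv (x : List SPoly) : List SPoly :=
  List.rec (motive := fun _ => SPoly → List SPoly) (fun c => [c])
    (fun a _ ih c => clean (merge (deriv a) c) :: ih a) x nil

/-- The composition of a power of `D_x` with an operator. -/
def opIterDeriv (n : ℕ) (x : List SPoly) : List SPoly := Nat.rec x (fun _ ih => opDeriv ih) n

/-- A derivation acts on the coefficients. -/
def opDer (tb : List (ℕ × SPoly)) (x : List SPoly) : List SPoly :=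
  List.rec (motive := fun _ => List SPoly) [] (fun a _ ih => der tb a :: ih) x

/-- The operator `∑ (∂f / ∂u^{(n)}) D_xⁿ X`. -/
def opLin (f : SPoly) (ps : List ℕ) (x : List SPoly) : List SPoly :=
  List.rec (motive := fun _ => List SPoly → List SPoly) (fun _ => [])
    (fun p _ ih x => opAdd (opScale (partialDeriv p f) x) (ih (opDeriv x))) ps x

/-- The operator `∑ (-D_x)ⁿ (∂f / ∂u^{(n)}) X`. -/
def opAdj (f : SPoly) (ps : List ℕ) (x : List SPoly) : List SPoly :=
  List.rec (motive := fun _ => List SPoly) []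
    (fun p _ ih => opAdd (opScale (partialDeriv p f) x) (opNeg (opDeriv ih))) ps

/-- The concomitant of `D_xⁿ`. -/
def opConcPow (n : ℕ) (a : SPoly) (x : List SPoly) : List SPoly :=
  Nat.rec (motive := fun _ => List SPoly → List SPoly) (fun _ => [])
    (fun m ih x => opAdd (opScale (iterDeriv m a) x) (ih (opNeg (opDeriv x)))) n x

/-- The concomitant of the linearization of `f`. -/
def opConc (f : SPoly) (ps : List ℕ) (a : SPoly) (x : List SPoly) : List SPoly :=
  List.rec (motive := fun _ => ℕ → List SPoly) (fun _ => [])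
    (fun p _ ih m => opAdd (opConcPow m a (opScale (partialDeriv p f) x)) (ih (Nat.succ m))) ps 0

/-- The part of `D_xⁿ a D_x⁻¹ X` without nonlocal terms. -/
def opLeibPow (n : ℕ) (a : SPoly) (x : List SPoly) : List SPoly :=
  Nat.rec (motive := fun _ => List SPoly) []
    (fun m ih => opAdd (opScale (iterDeriv m a) x) (opDeriv ih)) n

/-- The local part of the composition of the linearization of `f` with `a D_x⁻¹ X`. -/
def opLeib (f : SPoly) (ps : List ℕ) (a : SPoly) (x : List SPoly) : List SPoly :=
  List.rec (motive := fun _ => ℕ → List SPoly) (fun _ => [])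
    (fun p _ ih m => opAdd (opScale (partialDeriv p f) (opLeibPow m a x)) (ih (Nat.succ m))) ps 0

/-- Test for zero. -/
def opIsZero (x : List SPoly) : Bool :=
  List.rec (motive := fun _ => Bool) true (fun a _ ih => Bool.rec false ih (isZero a)) x

section Soundness

variable {R B : Type*} [CommRing R] [CommRing B] [Algebra R B]

/-- The value of a variable. -/
def jetVal (x : Fin 2 → ℕ → B) (p : ℕ) : B :=
  if jetPrimes.idxOf p % 2 = 0 then x 0 (jetPrimes.idxOf p / 2) else x 1 (jetPrimes.idxOf p / 2)

theorem goodTable_derTable : GoodTable derTable := by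
  refine ⟨by decide, fun p hp => ?_⟩
  simp only [derTable, List.map_cons, List.map_nil, List.mem_cons, List.not_mem_nil, or_false] at hp
  rcases hp with rfl | rfl | rfl | rfl | rfl | rfl | rfl | rfl | rfl | rfl | rfl | rfl | rfl | rfl |
    rfl | rfl | rfl | rfl | rfl | rfl | rfl | rfl | rfl | rfl <;> norm_num

theorem den_derTable {x : Fin 2 → ℕ → B} {D : Derivation R B B}
    (hD : ∀ i n, D (x i n) = x i (n + 1)) :
    ∀ p ∈ derTable, Den (jetVal x) p.2 (D (jetVal x p.1)) := by
  intro p hp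
  have h : ∀ q : ℕ, q.Prime → ∀ i n, jetVal x q = x i (n + 1) → Den (jetVal x) (mono q) (D (x i n)) :=
    fun q hq i n h => den_cast (den_mono hq) (by rw [h, hD])
  simp only [derTable, List.mem_cons, List.not_mem_nil, or_false] at hp
  rcases hp with rfl | rfl | rfl | rfl | rfl | rfl | rfl | rfl | rfl | rfl | rfl | rfl | rfl | rfl |
    rfl | rfl | rfl | rfl | rfl | rfl | rfl | rfl | rfl | rfl
  all_goals exact h _ (by norm_num) _ _ rfl

/-- `X` is the value on `p` of the operator with coefficients `x`. -/
def DenOp (ρ : ℕ → B) (D : Derivation R B B) : List SPoly → B → B → Prop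
  | [], _, X => X = 0
  | a :: t, p, X => ∃ y z, Den ρ a y ∧ DenOp ρ D t (D p) z ∧ X = y * p + z

variable {ρ : ℕ → B} {D : Derivation R B B} {f : SPoly} {F : B} {x y : List SPoly} {p X Y : B}

theorem denOp_cast (h : DenOp ρ D x p X) (e : X = Y) : DenOp ρ D x p Y := e ▸ h

theorem denOp_one : DenOp ρ D [const 1] p p :=
  ⟨(1 : ℕ), 0, den_const 1, rfl, by simp⟩

theorem denOp_add (hx : DenOp ρ D x p X) (hy : DenOp ρ D y p Y) :
    DenOp ρ D (opAdd x y) p (X + Y) := by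
  induction x generalizing y p X Y with
  | nil =>
    rw [show X = 0 from hx, zero_add]
    exact hy
  | cons a t ih =>
    cases y with
    | nil =>
      rw [show Y = 0 from hy, add_zero]
      exact hx
    | cons b s =>
      obtain ⟨x₁, x₂, h1, h2, rfl⟩ := hx
      obtain ⟨y₁, y₂, h3, h4, rfl⟩ := hy
      exact ⟨_, _, den_merge h1 h3, ih h2 h4, by ring⟩

theorem denOp_neg (hx : DenOp ρ D x p X) : DenOp ρ D (opNeg x) p (-X) := by
  induction x generalizing p X with
  | nil =>
    rw [show X = 0 from hx, neg_zero]
    rfl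
  | cons a t ih =>
    obtain ⟨x₁, x₂, h1, h2, rfl⟩ := hx
    exact ⟨_, _, den_neg h1, ih h2, by ring⟩

theorem denOp_scale (hf : Den ρ f F) (hx : DenOp ρ D x p X) :
    DenOp ρ D (opScale f x) p (F * X) := by
  induction x generalizing p X with
  | nil =>
    rw [show X = 0 from hx, mul_zero]
    rfl
  | cons a t ih =>
    obtain ⟨x₁, x₂, h1, h2, rfl⟩ := hx
    exact ⟨_, _, den_mul hf h1, ih h2, by ring⟩

theorem denOp_clean (hx : DenOp ρ D x p X) : DenOp ρ D (opClean x) p X := by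
  induction x generalizing p X with
  | nil => exact hx
  | cons a t ih =>
    obtain ⟨x₁, x₂, h1, h2, rfl⟩ := hx
    exact ⟨_, _, den_clean h1, ih h2, rfl⟩

theorem eq_zero_of_opIsZero (hx : DenOp ρ D x p X) (h : opIsZero x = true) : X = 0 := by
  induction x generalizing p X with
  | nil => exact hx
  | cons a t ih =>
    obtain ⟨x₁, x₂, h1, h2, rfl⟩ := hx
    change Bool.rec false (opIsZero t) (isZero a) = true at h
    cases ha : isZero a with
    | false => rw [ha] at h; exact absurd h Bool.false_ne_true
    | true =>
      rw [ha] at h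
      rw [eq_zero_of_isZero h1 ha, ih h2 h, zero_mul, zero_add]

/-- If `δ` kills the argument and all its derivatives, it acts on the coefficients alone. -/
theorem denOp_der {δ : Derivation R B B} {tb : List (ℕ × SPoly)} (ht : GoodTable tb)
    (htd : ∀ q ∈ tb, Den ρ q.2 (δ (ρ q.1))) (hp : ∀ n, δ (D^[n] p) = 0)
    (hx : DenOp ρ D x p X) : DenOp ρ D (opDer tb x) p (δ X) := by
  induction x generalizing p X with
  | nil =>
    rw [show X = 0 from hx, map_zero]
    rfl
  | cons a t ih =>
    obtain ⟨x₁, x₂, h1, h2, rfl⟩ := hx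
    have h0 : δ p = 0 := hp 0
    refine ⟨_, _, den_der ht htd h1, ih (fun n => hp (n + 1)) h2, ?_⟩
    rw [map_add, Derivation.leibniz, h0, smul_zero, zero_add, smul_eq_mul, mul_comm]

section Deriv

theorem den_deriv (hD : ∀ q ∈ derTable, Den ρ q.2 (D (ρ q.1)))
    (hf : Den ρ f F) : Den ρ (deriv f) (D F) :=
  den_der goodTable_derTable hD hf

theorem den_iterDeriv (hD : ∀ q ∈ derTable, Den ρ q.2 (D (ρ q.1)))
    (hf : Den ρ f F) (n : ℕ) : Den ρ (iterDeriv n f) (D^[n] F) := by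
  induction n with
  | zero => exact hf
  | succ n ih =>
    rw [Function.iterate_succ_apply']
    exact den_deriv hD ih

/-- The recursion carries the coefficient that multiplies `p` in from the previous order: `D (y p +
z) = (D y) p + y (D p) + D z`. -/
theorem denOp_deriv (hD : ∀ q ∈ derTable, Den ρ q.2 (D (ρ q.1)))
    (hx : DenOp ρ D x p X) : DenOp ρ D (opDeriv x) p (D X) := by
  have key : ∀ (c : SPoly) (C : B), Den ρ c C → DenOp ρ D
      (List.rec (motive := fun _ => SPoly → List SPoly) (fun c => [c])
        (fun a _ ih c => clean (merge (deriv a) c) :: ih a) x c) p (D X + C * p) := by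
    induction x generalizing p X with
    | nil =>
      intro c C hc
      refine ⟨C, 0, hc, rfl, ?_⟩
      rw [show X = 0 from hx, map_zero]
      ring
    | cons a t ih =>
      intro c C hc
      obtain ⟨x₁, x₂, h1, h2, rfl⟩ := hx
      refine ⟨_, _, den_clean (den_merge (den_deriv hD h1) hc), ih h2 a x₁ h1, ?_⟩
      rw [map_add, Derivation.leibniz, smul_eq_mul, smul_eq_mul]
      ring
  have h := key nil 0 rfl
  rw [zero_mul, add_zero] at h
  exact h

theorem denOp_iterDeriv (hD : ∀ q ∈ derTable, Den ρ q.2 (D (ρ q.1)))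
    (hx : DenOp ρ D x p X) (n : ℕ) :
    DenOp ρ D (opIterDeriv n x) p (D^[n] X) := by
  induction n with
  | zero => exact hx
  | succ n ih =>
    rw [Function.iterate_succ_apply']
    exact denOp_deriv hD ih

/-- The values of the partial derivatives of `f`. -/
abbrev DenPartials (ρ : ℕ → B) (f : SPoly) (ps : List ℕ) (fs : List B) : Prop :=
  List.Forall₂ (fun p F => Den ρ (partialDeriv p f) F) ps fs



/-- Value of `opLin`. -/
def linVal (D : Derivation R B B) : List B → B → B
  | [], _ => 0
  | F :: t, X => F * X + linVal D t (D X)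

/-- Value of `opAdj`. -/
def adjVal (D : Derivation R B B) : List B → B → B
  | [], _ => 0
  | F :: t, X => F * X + -D (adjVal D t X)

/-- Value of `opConcPow`. -/
def concPowVal (D : Derivation R B B) (a : B) : ℕ → B → B
  | 0, _ => 0
  | n + 1, X => D^[n] a * X + concPowVal D a n (-D X)

/-- Value of `opConc`. -/
def concVal (D : Derivation R B B) (a X : B) : List B → ℕ → B
  | [], _ => 0
  | F :: t, n => concPowVal D a n (F * X) + concVal D a X t (n + 1)

/-- Value of `opLeibPow`. -/
def leibPowVal (D : Derivation R B B) (a X : B) : ℕ → B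
  | 0 => 0
  | n + 1 => D^[n] a * X + D (leibPowVal D a X n)

/-- Value of `opLeib`. -/
def leibVal (D : Derivation R B B) (a X : B) : List B → ℕ → B
  | [], _ => 0
  | F :: t, n => F * leibPowVal D a X n + leibVal D a X t (n + 1)

variable {ps : List ℕ} {fs : List B} {a : SPoly} {A : B}

theorem denOp_lin (hD : ∀ q ∈ derTable, Den ρ q.2 (D (ρ q.1)))
    (hf : DenPartials ρ f ps fs) (hx : DenOp ρ D x p X) :
    DenOp ρ D (opLin f ps x) p (linVal D fs X) := by
  induction hf generalizing x X with
  | nil => rfl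
  | cons h _ ih => exact denOp_add (denOp_scale h hx) (ih (denOp_deriv hD hx))

theorem denOp_adj (hD : ∀ q ∈ derTable, Den ρ q.2 (D (ρ q.1)))
    (hf : DenPartials ρ f ps fs) (hx : DenOp ρ D x p X) :
    DenOp ρ D (opAdj f ps x) p (adjVal D fs X) := by
  induction hf with
  | nil => rfl
  | cons h _ ih => exact denOp_add (denOp_scale h hx) (denOp_neg (denOp_deriv hD ih))

theorem denOp_concPow (hD : ∀ q ∈ derTable, Den ρ q.2 (D (ρ q.1)))
    (ha : Den ρ a A) (n : ℕ) (hx : DenOp ρ D x p X) :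
    DenOp ρ D (opConcPow n a x) p (concPowVal D A n X) := by
  induction n generalizing x X with
  | zero => rfl
  | succ n ih =>
    exact denOp_add (denOp_scale (den_iterDeriv hD ha n) hx) (ih (denOp_neg (denOp_deriv hD hx)))

theorem denOp_conc (hD : ∀ q ∈ derTable, Den ρ q.2 (D (ρ q.1)))
    (hf : DenPartials ρ f ps fs) (ha : Den ρ a A) (hx : DenOp ρ D x p X) :
    DenOp ρ D (opConc f ps a x) p (concVal D A X fs 0) := by
  have key : ∀ n, DenOp ρ D (List.rec (motive := fun _ => ℕ → List SPoly) (fun _ => [])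
      (fun p _ ih m => opAdd (opConcPow m a (opScale (partialDeriv p f) x)) (ih (Nat.succ m))) ps n)
      p (concVal D A X fs n) := by
    induction hf with
    | nil => exact fun _ => rfl
    | cons h _ ih =>
      exact fun n => denOp_add (denOp_concPow hD ha n (denOp_scale h hx)) (ih (n + 1))
  exact key 0

theorem denOp_leibPow (hD : ∀ q ∈ derTable, Den ρ q.2 (D (ρ q.1)))
    (ha : Den ρ a A) (n : ℕ) (hx : DenOp ρ D x p X) :
    DenOp ρ D (opLeibPow n a x) p (leibPowVal D A X n) := by
  induction n with
  | zero => rfl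
  | succ n ih =>
    exact denOp_add (denOp_scale (den_iterDeriv hD ha n) hx) (denOp_deriv hD ih)

theorem denOp_leib (hD : ∀ q ∈ derTable, Den ρ q.2 (D (ρ q.1)))
    (hf : DenPartials ρ f ps fs) (ha : Den ρ a A) (hx : DenOp ρ D x p X) :
    DenOp ρ D (opLeib f ps a x) p (leibVal D A X fs 0) := by
  have key : ∀ n, DenOp ρ D (List.rec (motive := fun _ => ℕ → List SPoly) (fun _ => [])
      (fun p _ ih m => opAdd (opScale (partialDeriv p f) (opLeibPow m a x)) (ih (Nat.succ m))) ps n)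
      p (leibVal D A X fs n) := by
    induction hf with
    | nil => exact fun _ => rfl
    | cons h _ ih =>
      exact fun n => denOp_add (denOp_scale h (denOp_leibPow hD ha n hx)) (ih (n + 1))
  exact key 0

end Deriv

/-! Values of the operators above in terms of `DiffOp`. -/

variable (e : DiffPoly R →+* B) (D)

/-- The partial derivatives of `f`. -/
def partials (f : DiffPoly R) (k : Fin 2) : List B :=
  [e (pderiv (k, 0) f), e (pderiv (k, 1) f), e (pderiv (k, 2) f), e (pderiv (k, 3) f),
    e (pderiv (k, 4) f), e (pderiv (k, 5) f)]

theorem linVal_partials (f : DiffPoly R) (k : Fin 2) (X : B) :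
    linVal D (partials e f k) X = (WNLOp.linOp f k 6).act e D X := by
  rw [WNLOp.act_linOp]
  simp only [partials, linVal, Finset.sum_range_succ, Finset.sum_range_zero,
    Function.iterate_succ_apply, Function.iterate_zero, id]
  ring

theorem adjVal_partials (f : DiffPoly R) (k : Fin 2) (X : B) :
    adjVal D (partials e f k) X = (WNLOp.linOp f k 6).adjoint.act e D X := by
  rw [WNLOp.act_adjoint_linOp]
  simp only [partials, adjVal, Finset.sum_range_succ, Finset.sum_range_zero,
    Function.iterate_succ_apply, Function.iterate_zero, id, map_add, map_neg, map_zero]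
  ring

theorem concPowVal_eq (n : ℕ) (a X : B) :
    concPowVal D a n X = ((DiffOp.der : DiffOp R) ^ n).conc e D a X := by
  induction n generalizing X with
  | zero => rfl
  | succ n ih =>
    change _ = ((DiffOp.der : DiffOp R) ^ n).act e D a * X +
      (DiffOp.der ^ n).conc e D a ((-DiffOp.der : DiffOp R).act e D X)
    rw [DiffOp.act_pow, DiffOp.act_neg, ← ih]
    rfl

theorem leibPowVal_eq (n : ℕ) (a X : B) :
    leibPowVal D a X n = ((DiffOp.der : DiffOp R) ^ n).leib e D a X := by
  induction n with
  | zero => rfl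
  | succ n ih =>
    change _ = ((DiffOp.der : DiffOp R) ^ n).act e D a * X +
      D ((DiffOp.der ^ n).leib e D a X)
    rw [DiffOp.act_pow, ← ih]
    rfl

theorem concVal_partials (f : DiffPoly R) (k : Fin 2) (a X : B) :
    concVal D a X (partials e f k) 0 = (WNLOp.linOp f k 6).conc e D a X := by
  have h : ∀ n, (WNLOp.linOp f k (n + 1)).conc e D a X = (WNLOp.linOp f k n).conc e D a X +
      concPowVal D a n (e (pderiv (k, n) f) * X) := by
    intro n
    rw [concPowVal_eq D e]
    change (WNLOp.linOp f k n).conc e D a X + (0 + (DiffOp.der ^ n).conc e D a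
      (e (pderiv (k, n) f) * X)) = _
    rw [zero_add]
  have h0 : (WNLOp.linOp f k 0).conc e D a X = 0 := rfl
  rw [h, h, h, h, h, h, h0]
  simp only [partials, concVal]
  ring

theorem leibVal_partials (f : DiffPoly R) (k : Fin 2) (a X : B) :
    leibVal D a X (partials e f k) 0 = (WNLOp.linOp f k 6).leib e D a X := by
  have h : ∀ n, (WNLOp.linOp f k (n + 1)).leib e D a X = (WNLOp.linOp f k n).leib e D a X +
      e (pderiv (k, n) f) * leibPowVal D a X n := by
    intro n
    rw [leibPowVal_eq D e]
    change (WNLOp.linOp f k n).leib e D a X + (0 + e (pderiv (k, n) f) *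
      (DiffOp.der ^ n).leib e D a X) = _
    rw [zero_add]
  have h0 : (WNLOp.linOp f k 0).leib e D a X = 0 := rfl
  rw [h, h, h, h, h, h, h0]
  simp only [partials, leibVal]
  ring

/-- The variables `u_{nx}` or `v_{nx}` with `n ≤ 5`. -/
def jetVars (k : Fin 2) : List ℕ :=
  Fin.cases [2, 5, 11, 17, 23, 31] (fun _ => [3, 7, 13, 19, 29, 37]) k

/-- The indices of a variable. -/
def jetIdx (p : ℕ) : Fin 2 × ℕ :=
  (if jetPrimes.idxOf p % 2 = 0 then 0 else 1, jetPrimes.idxOf p / 2)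

theorem jetVal_jet (p : ℕ) : jetVal (jet R) p = MvPolynomial.X (jetIdx p) := by
  rw [jetVal]
  split_ifs with h <;> simp only [jetIdx, h, if_true, if_false] <;> rfl

theorem jetIdx_injOn : ∀ p ∈ derTable.map Prod.fst, ∀ p' ∈ derTable.map Prod.fst,
    jetIdx p = jetIdx p' → p = p' := by
  decide +kernel

theorem den_pderiv {f : SPoly} {F : DiffPoly R} (hf : Den (jetVal (jet R)) f F)
    (hs : supported (bound derTable) f = true) {p : ℕ} (hp : p ∈ derTable.map Prod.fst) :
    Den (jetVal (jet R)) (partialDeriv p f) (pderiv (jetIdx p) F) := by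
  refine den_partialDeriv goodTable_derTable hp (fun p' hp' => ?_) hf hs
  rw [jetVal_jet]
  split_ifs with h
  · rw [h, pderiv_X_self]
  · exact pderiv_X_of_ne fun h1 => h (jetIdx_injOn p' hp' p hp h1)

theorem denPartials_partials {B : Type*} [CommRing B] (e : DiffPoly R →+* B) {f : SPoly}
    {F : DiffPoly R} (hf : Den (jetVal (jet R)) f F)
    (hs : supported (bound derTable) f = true) (k : Fin 2) :
    DenPartials (fun p => e (jetVal (jet R) p)) f (jetVars k) (partials e F k) := by
  have h : ∀ p ∈ derTable.map Prod.fst,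
      Den (fun p => e (jetVal (jet R) p)) (partialDeriv p f) (e (pderiv (jetIdx p) F)) :=
    fun p hp => den_map e (den_pderiv hf hs hp)
  have h2 := fun k : Fin 2 => show ∀ p ∈ jetVars k, p ∈ derTable.map Prod.fst by
    fin_cases k <;> decide
  fin_cases k
  · exact .cons (h 2 (h2 0 _ (by decide))) <| .cons (h 5 (h2 0 _ (by decide))) <|
      .cons (h 11 (h2 0 _ (by decide))) <| .cons (h 17 (h2 0 _ (by decide))) <|
      .cons (h 23 (h2 0 _ (by decide))) <| .cons (h 31 (h2 0 _ (by decide))) .nil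
  · exact .cons (h 3 (h2 1 _ (by decide))) <| .cons (h 7 (h2 1 _ (by decide))) <|
      .cons (h 13 (h2 1 _ (by decide))) <| .cons (h 19 (h2 1 _ (by decide))) <|
      .cons (h 29 (h2 1 _ (by decide))) <| .cons (h 37 (h2 1 _ (by decide))) .nil

end Soundness

end SPoly


namespace SPoly

/-! ### The coefficients of the system -/

/-- Power. -/
def pow (f : SPoly) (n : ℕ) : SPoly := Nat.rec (const 1) (fun _ ih => mul f ih) n

/-- A jet variable. -/
def jetMono (i n : ℕ) : SPoly := mono (jetPrimes.getD (Nat.add (Nat.mul 2 n) i) 2)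

section

variable {B : Type*} [CommRing B] {ρ : ℕ → B} {f g : SPoly} {x y : B}

theorem den_sub (hf : Den ρ f x) (hg : Den ρ g y) : Den ρ (merge f (neg g)) (x - y) :=
  den_cast (den_merge hf (den_neg hg)) (sub_eq_add_neg x y).symm

theorem den_pow (hf : Den ρ f x) (n : ℕ) : Den ρ (pow f n) (x ^ n) := by
  induction n with
  | zero => exact den_cast (den_const 1) (by simp)
  | succ n ih => exact den_cast (den_mul hf ih) (pow_succ' x n).symm

theorem den_ofNat (n : ℕ) [n.AtLeastTwo] : Den ρ (const n) (OfNat.ofNat n : B) := den_const n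

theorem den_jetMono (x : Fin 2 → ℕ → B) (i : Fin 2) {n : ℕ} (hn : n < 6) :
    Den (jetVal x) (jetMono i n) (x i n) := by
  interval_cases n <;> fin_cases i <;> exact den_cast (den_mono (by decide)) rfl

end

/-- Sparse polynomials with a given value. -/
abbrev Code (F : ∀ {A : Type*} [CommRing A], (ℕ → A) → (ℕ → A) → A) : Type _ :=
  {f : SPoly // ∀ {B : Type _} [CommRing B] (ρ : ℕ → B) (u v : ℕ → B),
    (∀ n < 6, Den ρ (jetMono 0 n) (u n)) → (∀ n < 6, Den ρ (jetMono 1 n) (v n)) → Den ρ f (F u v)}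

theorem Code.den {R : Type*} [CommRing R]
    {F : ∀ {A : Type _} [CommRing A], (ℕ → A) → (ℕ → A) → A} (f : Code F) :
    Den (jetVal (jet R)) f.1 (F (jet R 0) (jet R 1)) :=
  f.2 _ _ _ (fun _ => den_jetMono (jet R) 0) (fun _ => den_jetMono (jet R) 1)

/-- A sparse polynomial for `flowU`. -/
def flowUCode : Code flowU := by
  -- The sparse polynomial is left as a metavariable. Unification builds it while the soundness
  -- lemmas follow the syntax of the coefficient, so it is correct by construction. The other
  -- coefficients are treated in the same way.
  constructor
  · intro B _ ρ u v hu hv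
    apply den_clean
    unfold flowU
    beta_reduce
    repeat' first
      | exact hu _ (by norm_num)
      | exact hv _ (by norm_num)
      | exact den_ofNat _
      | with_reducible apply den_merge
      | with_reducible apply den_sub
      | with_reducible apply den_mul
      | with_reducible apply den_neg
      | with_reducible apply den_pow

/-- A sparse polynomial for `flowV`. -/
def flowVCode : Code flowV := by
  constructor
  · intro B _ ρ u v hu hv
    apply den_clean
    unfold flowV
    beta_reduce
    repeat' first
      | exact hu _ (by norm_num)
      | exact hv _ (by norm_num)
      | exact den_ofNat _
      | with_reducible apply den_merge
      | with_reducible apply den_sub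
      | with_reducible apply den_mul
      | with_reducible apply den_neg
      | with_reducible apply den_pow

/-- A sparse polynomial for `alpha1`. -/
def alpha1Code : Code alpha1 := by
  constructor
  · intro B _ ρ u v hu hv
    apply den_clean
    unfold alpha1
    beta_reduce
    repeat' first
      | exact hu _ (by norm_num)
      | exact hv _ (by norm_num)
      | exact den_ofNat _
      | with_reducible apply den_merge
      | with_reducible apply den_sub
      | with_reducible apply den_mul
      | with_reducible apply den_neg
      | with_reducible apply den_pow

/-- A sparse polynomial for `alpha2`. -/
def alpha2Code : Code alpha2 := by
  constructor
  · intro B _ ρ u v hu hv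
    apply den_clean
    unfold alpha2
    beta_reduce
    repeat' first
      | exact hu _ (by norm_num)
      | exact hv _ (by norm_num)
      | exact den_ofNat _
      | with_reducible apply den_merge
      | with_reducible apply den_sub
      | with_reducible apply den_mul
      | with_reducible apply den_neg
      | with_reducible apply den_pow

/-- A sparse polynomial for `alpha3`. -/
def alpha3Code : Code alpha3 := by
  constructor
  · intro B _ ρ u v hu hv
    apply den_clean
    unfold alpha3
    beta_reduce
    repeat' first
      | exact hu _ (by norm_num)
      | exact hv _ (by norm_num)
      | exact den_ofNat _
      | with_reducible apply den_merge
      | with_reducible apply den_sub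
      | with_reducible apply den_mul
      | with_reducible apply den_neg
      | with_reducible apply den_pow

/-- A sparse polynomial for `alpha4`. -/
def alpha4Code : Code alpha4 := by
  constructor
  · intro B _ ρ u v hu hv
    apply den_clean
    unfold alpha4
    beta_reduce
    repeat' first
      | exact hu _ (by norm_num)
      | exact hv _ (by norm_num)
      | exact den_ofNat _
      | with_reducible apply den_merge
      | with_reducible apply den_sub
      | with_reducible apply den_mul
      | with_reducible apply den_neg
      | with_reducible apply den_pow

/-- A sparse polynomial for `alpha5`. -/
def alpha5Code : Code alpha5 := by
  constructor
  · intro B _ ρ u v hu hv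
    apply den_clean
    unfold alpha5
    beta_reduce
    repeat' first
      | exact hu _ (by norm_num)
      | exact hv _ (by norm_num)
      | exact den_ofNat _
      | with_reducible apply den_merge
      | with_reducible apply den_sub
      | with_reducible apply den_mul
      | with_reducible apply den_neg
      | with_reducible apply den_pow

/-- A sparse polynomial for `alpha6`. -/
def alpha6Code : Code alpha6 := by
  constructor
  · intro B _ ρ u v hu hv
    apply den_clean
    unfold alpha6
    beta_reduce
    repeat' first
      | exact hu _ (by norm_num)
      | exact hv _ (by norm_num)
      | exact den_ofNat _
      | with_reducible apply den_merge
      | with_reducible apply den_sub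
      | with_reducible apply den_mul
      | with_reducible apply den_neg
      | with_reducible apply den_pow

/-- A sparse polynomial for `alpha7`. -/
def alpha7Code : Code alpha7 := by
  constructor
  · intro B _ ρ u v hu hv
    apply den_clean
    unfold alpha7
    beta_reduce
    repeat' first
      | exact hu _ (by norm_num)
      | exact hv _ (by norm_num)
      | exact den_ofNat _
      | with_reducible apply den_merge
      | with_reducible apply den_sub
      | with_reducible apply den_mul
      | with_reducible apply den_neg
      | with_reducible apply den_pow

/-- A sparse polynomial for `alpha8`. -/
def alpha8Code : Code alpha8 := by
  constructor
  · intro B _ ρ u v hu hv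
    apply den_clean
    unfold alpha8
    beta_reduce
    repeat' first
      | exact hu _ (by norm_num)
      | exact hv _ (by norm_num)
      | exact den_ofNat _
      | with_reducible apply den_merge
      | with_reducible apply den_sub
      | with_reducible apply den_mul
      | with_reducible apply den_neg
      | with_reducible apply den_pow

/-- A sparse polynomial for `alpha9`. -/
def alpha9Code : Code alpha9 := by
  constructor
  · intro B _ ρ u v hu hv
    apply den_clean
    unfold alpha9
    beta_reduce
    repeat' first
      | exact hu _ (by norm_num)
      | exact hv _ (by norm_num)
      | exact den_ofNat _
      | with_reducible apply den_merge
      | with_reducible apply den_sub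
      | with_reducible apply den_mul
      | with_reducible apply den_neg
      | with_reducible apply den_pow

/-- A sparse polynomial for `alpha10`. -/
def alpha10Code : Code alpha10 := by
  constructor
  · intro B _ ρ u v hu hv
    apply den_clean
    unfold alpha10
    beta_reduce
    repeat' first
      | exact hu _ (by norm_num)
      | exact hv _ (by norm_num)
      | exact den_ofNat _
      | with_reducible apply den_merge
      | with_reducible apply den_sub
      | with_reducible apply den_mul
      | with_reducible apply den_neg
      | with_reducible apply den_pow

/-- A sparse polynomial for `alpha11`. -/
def alpha11Code : Code alpha11 := by
  constructor
  · intro B _ ρ u v hu hv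
    apply den_clean
    unfold alpha11
    beta_reduce
    repeat' first
      | exact hu _ (by norm_num)
      | exact hv _ (by norm_num)
      | exact den_ofNat _
      | with_reducible apply den_merge
      | with_reducible apply den_sub
      | with_reducible apply den_mul
      | with_reducible apply den_neg
      | with_reducible apply den_pow

/-- A sparse polynomial for `alpha12`. -/
def alpha12Code : Code alpha12 := by
  constructor
  · intro B _ ρ u v hu hv
    apply den_clean
    unfold alpha12
    beta_reduce
    repeat' first
      | exact hu _ (by norm_num)
      | exact hv _ (by norm_num)
      | exact den_ofNat _
      | with_reducible apply den_merge
      | with_reducible apply den_sub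
      | with_reducible apply den_mul
      | with_reducible apply den_neg
      | with_reducible apply den_pow

/-- A sparse polynomial for `rho1`. -/
def rho1Code : Code rho1 := by
  constructor
  · intro B _ ρ u v hu hv
    apply den_clean
    unfold rho1
    beta_reduce
    repeat' first
      | exact hu _ (by norm_num)
      | exact hv _ (by norm_num)
      | exact den_ofNat _
      | with_reducible apply den_merge
      | with_reducible apply den_sub
      | with_reducible apply den_mul
      | with_reducible apply den_neg
      | with_reducible apply den_pow

end SPoly


namespace WNLOp

variable {R : Type*} [CommRing R] {m : ℕ} {w : Fin m → Fin 2 → DiffPoly R}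

theorem extAct_add (L : DiffOp R) (f g : ExtPoly R m) :
    extAct w L (f + g) = extAct w L f + extAct w L g :=
  DiffOp.act_map_add (embHom R m) (extDeriv w) L f g

theorem extAct_neg (L : DiffOp R) (f : ExtPoly R m) : extAct w L (-f) = -extAct w L f :=
  DiffOp.act_map_neg (embHom R m) (extDeriv w) L f

theorem extAct_smul (L : DiffOp R) (r : R) (f : ExtPoly R m) :
    extAct w L (r • f) = r • extAct w L f :=
  DiffOp.act_map_smul (embHom R m) (extDeriv w) L r f

theorem extAct_sum {ι : Type*} (L : DiffOp R) (s : Finset ι) (f : ι → ExtPoly R m) :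
    extAct w L (∑ i ∈ s, f i) = ∑ i ∈ s, extAct w L (f i) :=
  DiffOp.act_map_sum (embHom R m) (extDeriv w) L s f

theorem extAct_mul (L : DiffOp R) (f p : ExtPoly R m) : extAct w L (f * p) =
    extAct w L f * p + L.leib (embHom R m) (extDeriv w) f (extDeriv w p) :=
  DiffOp.act_mul_eq_leib (embHom R m) (extDeriv w) L f p

/-! ### Criteria for symmetries and invariant operators -/

/-- For a truncated Fréchet derivative that reaches far enough, linearization and symmetry of second
derivatives are automatic, and only commutation remains to be checked. -/
theorem isSymmetry_linOp {W : Fin 2 → DiffPoly R} {N : ℕ}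
    (hN : ∀ i k, ∀ n ≥ N, pderiv (k, n) (W i) = 0)
    (comm : ∀ a j, evol w (fun i => emb R m (w a i)) (emb R m (W j)) =
      evol w (fun i => emb R m (W i)) (emb R m (w a j))) :
    IsSymmetry w W (fun i j => linOp (W i) j N) where
  lin Q i := evol_emb_eq_linOp w (hN i) Q
  comm := comm
  second Q Q' i := sum_vary_linOp_comm w (hN i) Q Q'

/-- Vector fields commute with the translation along `x`. -/
theorem evol_jet_one (f : DiffPoly R) :
    evol w (fun i => emb R m (jet R i 1)) (emb R m f) = extDeriv w (emb R m f) := by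
  refine eq_on_emb (fun i n => ?_) f
  rw [evol_fld, extDeriv_fld, emb_jet, iterate_extDeriv_fld, add_comm]

theorem lieDeriv_act_cov {W : Fin 2 → DiffPoly R} {L : Fin 2 → Fin 2 → DiffOp R}
    (hW : IsSymmetry w W L) (M : DiffOp R) (s : Fin 3) (j : Fin 2) :
    lieDeriv w W L (extAct w M (cov R m s j)) =
      evol w (fun i => emb R m (W i)) (extAct w M (cov R m s j)) -
        ∑ k, extAct w M (extAct w (L k j).adjoint (cov R m s k)) := by
  rw [lieDeriv_act hW M (cov_mem_potFree s j), lieDeriv_cov, evol_cov', sub_zero, adjCov,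
    extAct_neg, extAct_sum, sub_eq_add_neg]

/-- An operator is invariant if the local parts agree. -/
theorem isInvariant_of_loc {K : WNLOp w} {W : Fin 2 → DiffPoly R}
    {L : Fin 2 → Fin 2 → DiffOp R} (hW : IsSymmetry w W L)
    (h : ∀ s i j, evol w (fun i => emb R m (W i)) (extAct w (K.loc i j) (cov R m s j)) +
      ∑ a, ∑ b, K.tail a b •
        (emb R m (w a i) * ∑ k, extConc w (L j k) (emb R m (w b k)) (cov R m s j)) =
      ∑ k, extAct w (K.loc i k) (extAct w (L j k).adjoint (cov R m s j)) +
        (∑ k, extAct w (L i k) (extAct w (K.loc k j) (cov R m s j)) +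
        ∑ a, ∑ b, K.tail a b • ∑ k, (L i k).leib (embHom R m) (extDeriv w) (emb R m (w a k))
          (emb R m (w b j) * cov R m s j))) :
    K.IsInvariant W L := by
  intro s i
  -- On both sides of the invariance equation the coefficient of a potential is `L (w a)`, because
  -- the flows commute. After removing these terms only operators acting on covectors are left.
  have h1 : lieDeriv w W L (K.value s i) =
      ∑ j, (evol w (fun i => emb R m (W i)) (extAct w (K.loc i j) (cov R m s j)) -
        ∑ k, extAct w (K.loc i k) (extAct w (L j k).adjoint (cov R m s j))) +
      ∑ a, ∑ b, K.tail a b • ((∑ k, extAct w (L i k) (emb R m (w a k))) * X (ExtVar.pot s b) +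
        emb R m (w a i) * potConc w L s b) := by
    rw [value_eq, map_add, map_sum, map_sum]
    congr 1
    · rw [Finset.sum_congr rfl fun j _ => lieDeriv_act_cov hW (K.loc i j) s j,
        Finset.sum_sub_distrib, Finset.sum_sub_distrib]
      congr 1
      exact Finset.sum_comm
    · refine Finset.sum_congr rfl fun a _ => ?_
      rw [map_sum]
      refine Finset.sum_congr rfl fun b _ => ?_
      rw [Derivation.map_smul, Derivation.leibniz, lieDeriv_pot, lieDeriv_emb, ← hW.comm a i,
        hW.lin, add_comm]
      refine congrArg (K.tail a b • ·) ?_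
      rw [smul_eq_mul, smul_eq_mul]
      congr 1
      exact mul_comm _ _
  have h2 : ∑ k, extAct w (L i k) (K.value s k) =
      ∑ j, ∑ k, extAct w (L i k) (extAct w (K.loc k j) (cov R m s j)) +
      ∑ a, ∑ b, K.tail a b • ((∑ k, extAct w (L i k) (emb R m (w a k))) * X (ExtVar.pot s b) +
        ∑ k, (L i k).leib (embHom R m) (extDeriv w) (emb R m (w a k))
          (∑ j, emb R m (w b j) * cov R m s j)) := by
    have h3 : ∀ k, extAct w (L i k) (K.value s k) =
        ∑ j, extAct w (L i k) (extAct w (K.loc k j) (cov R m s j)) +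
        ∑ a, ∑ b, K.tail a b • (extAct w (L i k) (emb R m (w a k)) * X (ExtVar.pot s b) +
          (L i k).leib (embHom R m) (extDeriv w) (emb R m (w a k))
            (∑ j, emb R m (w b j) * cov R m s j)) := by
      intro k
      rw [value_eq, extAct_add, extAct_sum, extAct_sum]
      congr 1
      refine Finset.sum_congr rfl fun a _ => ?_
      rw [extAct_sum]
      refine Finset.sum_congr rfl fun b _ => ?_
      rw [extAct_smul, extAct_mul, extDeriv_pot]
    rw [Finset.sum_congr rfl fun k _ => h3 k, Finset.sum_add_distrib, Finset.sum_comm]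
    congr 1
    rw [Finset.sum_comm]
    refine Finset.sum_congr rfl fun a _ => ?_
    rw [Finset.sum_comm]
    refine Finset.sum_congr rfl fun b _ => ?_
    rw [← Finset.smul_sum, Finset.sum_add_distrib, Finset.sum_mul]
  have h4 := Finset.sum_congr rfl fun (j : Fin 2) (_ : j ∈ Finset.univ) => h s i j
  simp only [Finset.sum_add_distrib] at h4
  have h5 : ∀ g : Fin m → Fin m → Fin 2 → ExtPoly R m,
      ∑ j, ∑ a, ∑ b, K.tail a b • g a b j = ∑ a, ∑ b, K.tail a b • ∑ j, g a b j := by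
    intro g
    rw [Finset.sum_comm]
    refine Finset.sum_congr rfl fun a _ => ?_
    rw [Finset.sum_comm]
    exact Finset.sum_congr rfl fun b _ => (Finset.smul_sum).symm
  rw [h5 (fun a b j => emb R m (w a i) * ∑ k, extConc w (L j k) (emb R m (w b k)) (cov R m s j)),
    h5 (fun a b j => ∑ k, (L i k).leib (embHom R m) (extDeriv w) (emb R m (w a k))
      (emb R m (w b j) * cov R m s j))] at h4
  rw [h1, h2]
  simp only [smul_add, Finset.sum_add_distrib, Finset.sum_sub_distrib]
  have h6 : ∀ a b, emb R m (w a i) * potConc w L s b =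
      ∑ j, emb R m (w a i) * ∑ k, extConc w (L j k) (emb R m (w b k)) (cov R m s j) := fun a b => by
    rw [potConc, Finset.mul_sum]
  have h7 : ∀ a b, ∑ k, (L i k).leib (embHom R m) (extDeriv w) (emb R m (w a k))
      (∑ j, emb R m (w b j) * cov R m s j) = ∑ j, ∑ k, (L i k).leib (embHom R m) (extDeriv w)
        (emb R m (w a k)) (emb R m (w b j) * cov R m s j) := fun a b => by
    rw [Finset.sum_comm]
    exact Finset.sum_congr rfl fun k _ => DiffOp.leib_sum_right _ _ _ _ _ _
  simp only [h6, h7]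
  linear_combination h4

/-! ### Sums of operators -/

theorem value_add_smul (K M : WNLOp w) (c : R) (s : Fin 3) (i : Fin 2) :
    (K + c • M).value s i = K.value s i + c • M.value s i := by
  have h1 : ∀ j f, extAct w ((K + c • M).loc i j) f =
      extAct w (K.loc i j) f + c • extAct w (M.loc i j) f := fun j f => by
    change extAct w (K.loc i j) f + emb R m (C c) * extAct w (M.loc i j) f = _
    rw [emb_C, C_mul']
  have h2 : ∀ a b, (K + c • M).tail a b = K.tail a b + c * M.tail a b := fun a b => rfl
  simp only [value_eq, h1, h2, add_smul, mul_smul, Finset.sum_add_distrib, smul_add,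
    Finset.smul_sum]
  abel

theorem IsInvariant.add_smul {K M : WNLOp w} {W : Fin 2 → DiffPoly R}
    {L : Fin 2 → Fin 2 → DiffOp R} (hK : K.IsInvariant W L) (hM : M.IsInvariant W L) (c : R) :
    (K + c • M).IsInvariant W L := by
  intro s i
  simp only [value_add_smul, extAct_add, extAct_smul, Finset.sum_add_distrib]
  rw [map_add, Derivation.map_smul, hK s i, hM s i, Finset.smul_sum]

theorem IsSkew.add_smul {K M : WNLOp w} (hK : K.IsSkew) (hM : M.IsSkew) (c : R) :
    (K + c • M).IsSkew where
  loc i j f := by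
    change extAct w (K.loc i j).adjoint f +
      extAct w (M.loc i j).adjoint (embHom R m (C c) * f) =
      -(extAct w (K.loc j i) f + emb R m (C c) * extAct w (M.loc j i) f)
    rw [embHom_apply, emb_C, C_mul', C_mul', extAct_smul,
      hK.loc, hM.loc, smul_neg, neg_add]
  tail a b := by
    change K.tail a b + c * M.tail a b = K.tail b a + c * M.tail b a
    rw [hK.tail a b, hM.tail a b]

end WNLOp


namespace SPoly

universe r

/-! ### The defect of invariance as a computation -/

/-- The flow. -/
def flowS (i : Fin 2) : SPoly := Fin.cases flowUCode.{r}.1 (fun _ => flowVCode.{r}.1) i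

/-- The vectors in the tail. -/
def tailS (a i : Fin 2) : SPoly := Fin.cases (jetMono i 1) (fun _ => flowS.{r} i) a

/-- The local part of `K₁`. -/
def opK1S (x : List SPoly) : List SPoly :=
  opClean (opAdd (opDeriv (opAdd (opScale alpha3Code.{r}.1 x) (opIterDeriv 2
      (opAdd (opScale alpha2Code.{r}.1 x) (opIterDeriv 2 (opAdd (opScale alpha1Code.{r}.1 x)
        (opScale (const 2) (opIterDeriv 2 x))))))))
    (opAdd (opScale alpha1Code.{r}.1 (opIterDeriv 5 x))
      (opAdd (opScale alpha2Code.{r}.1 (opIterDeriv 3 x)) (opScale alpha3Code.{r}.1 (opDeriv x)))))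

/-- The local part of `K₄`. -/
def opK4S (x : List SPoly) : List SPoly :=
  opClean (opAdd (opDeriv (opAdd (opScale alpha12Code.{r}.1 x) (opIterDeriv 2
      (opAdd (opScale alpha11Code.{r}.1 x) (opIterDeriv 2 (opAdd (opScale alpha10Code.{r}.1 x)
        (opScale (neg (const 18)) (opIterDeriv 2 x))))))))
    (opAdd (opScale alpha10Code.{r}.1 (opIterDeriv 5 x))
      (opAdd (opScale alpha11Code.{r}.1 (opIterDeriv 3 x))
        (opScale alpha12Code.{r}.1 (opDeriv x)))))

/-- The local part of `K₂`. -/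
def opK2S (x : List SPoly) : List SPoly :=
  opClean (opAdd (opScale alpha9Code.{r}.1 x) (opDeriv (opAdd (opScale alpha8Code.{r}.1 x)
    (opDeriv (opAdd (opScale alpha7Code.{r}.1 x) (opDeriv (opAdd (opScale alpha6Code.{r}.1 x)
      (opDeriv (opAdd (opScale alpha5Code.{r}.1 x) (opDeriv (opAdd (opScale alpha4Code.{r}.1 x)
        (opDeriv (opScale (neg (const 56)) (opScale (jetMono 1 0) x))))))))))))))

/-- The local part of `-K₂*`. -/
def opK3S (x : List SPoly) : List SPoly :=
  opClean (opNeg (opAdd (opScale (mul (neg (const 56)) (jetMono 1 0)) (opIterDeriv 6 x))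
    (opAdd (opScale (neg alpha4Code.{r}.1) (opIterDeriv 5 x))
    (opAdd (opScale alpha5Code.{r}.1 (opIterDeriv 4 x))
    (opAdd (opScale (neg alpha6Code.{r}.1) (opIterDeriv 3 x))
    (opAdd (opScale alpha7Code.{r}.1 (opIterDeriv 2 x))
    (opAdd (opScale (neg alpha8Code.{r}.1) (opDeriv x)) (opScale alpha9Code.{r}.1 x))))))))

/-- The local part of `K`. -/
def opKS (i j : Fin 2) : List SPoly → List SPoly :=
  Fin.cases (Fin.cases opK1S.{r} (fun _ => opK2S.{r}) j)
    (fun _ => Fin.cases opK3S.{r} (fun _ => opK4S.{r}) j) i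

/-- The evolutionary vector field of the flow. -/
def evolTable : List (ℕ × SPoly) :=
  [(2, iterDeriv 0 (flowS.{r} 0)), (3, iterDeriv 0 (flowS.{r} 1)),
    (5, iterDeriv 1 (flowS.{r} 0)), (7, iterDeriv 1 (flowS.{r} 1)),
    (11, iterDeriv 2 (flowS.{r} 0)), (13, iterDeriv 2 (flowS.{r} 1)),
    (17, iterDeriv 3 (flowS.{r} 0)), (19, iterDeriv 3 (flowS.{r} 1)),
    (23, iterDeriv 4 (flowS.{r} 0)), (29, iterDeriv 4 (flowS.{r} 1)),
    (31, iterDeriv 5 (flowS.{r} 0)), (37, iterDeriv 5 (flowS.{r} 1)),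
    (41, iterDeriv 6 (flowS.{r} 0)), (43, iterDeriv 6 (flowS.{r} 1)),
    (47, iterDeriv 7 (flowS.{r} 0)), (53, iterDeriv 7 (flowS.{r} 1))]

/-- Summands with the nonlocal tail, from the concomitant. -/
def concS (a b i j : Fin 2) : List SPoly :=
  opScale (const 4) (opScale (tailS.{r} a i)
    (opAdd (opConc (flowS.{r} j) (jetVars 0) (tailS.{r} b 0) [const 1])
      (opConc (flowS.{r} j) (jetVars 1) (tailS.{r} b 1) [const 1])))

/-- Summands with the nonlocal tail, from the linearization. -/
def leibS (a b i j : Fin 2) : List SPoly :=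
  opScale (const 4)
    (opAdd (opLeib (flowS.{r} i) (jetVars 0) (tailS.{r} a 0) (opScale (tailS.{r} b j) [const 1]))
      (opLeib (flowS.{r} i) (jetVars 1) (tailS.{r} a 1) (opScale (tailS.{r} b j) [const 1])))

/-- The composition of a row of an operator with a column of the adjoint linearization. -/
def adjS (K : Fin 2 → Fin 2 → List SPoly → List SPoly) (i j : Fin 2) : List SPoly :=
  opAdd (K i 0 (opAdj (flowS.{r} j) (jetVars 0) [const 1]))
    (K i 1 (opAdj (flowS.{r} j) (jetVars 1) [const 1]))

/-- The composition of a row of the linearization with a column of an operator. -/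
def linS (K : Fin 2 → Fin 2 → List SPoly → List SPoly) (i j : Fin 2) : List SPoly :=
  opAdd (opLin (flowS.{r} i) (jetVars 0) (K 0 j [const 1]))
    (opLin (flowS.{r} i) (jetVars 1) (K 1 j [const 1]))

/-- The defect of the invariance of `K` under the flow. -/
def defect (i j : Fin 2) : List SPoly :=
  opAdd (opAdd (opDer evolTable.{r} (opKS.{r} i j [const 1]))
      (opAdd (concS.{r} 0 1 i j) (concS.{r} 1 0 i j)))
    (opNeg (opAdd (adjS.{r} opKS.{r} i j) (opAdd (linS.{r} opKS.{r} i j)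
      (opAdd (leibS.{r} 0 1 i j) (leibS.{r} 1 0 i j)))))

end SPoly


/-! ### Soundness of the sparse computation of the defect -/

namespace SPoly

universe r

open WNLOp

theorem deriv_ofNat_mul {R B : Type*} [CommRing R] [CommRing B] [Algebra R B]
    (D : Derivation R B B) (n : ℕ) [n.AtLeastTwo] (f : B) :
    D (ofNat(n) * f) = ofNat(n) * D f := by
  rw [← Nat.cast_ofNat (n := n), ← nsmul_eq_mul, map_nsmul, nsmul_eq_mul]

section

variable {R : Type r} [CommRing R]

/-- The values of the variables in the universal ring. -/
abbrev extVal (R : Type r) [CommRing R] (p : ℕ) : ExtPoly R 2 := embHom R 2 (jetVal (jet R) p)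

theorem extVal_eq : extVal R = jetVal fun i n => (X (ExtVar.fld i n) : ExtPoly R 2) := by
  funext p
  rw [extVal, jetVal, jetVal]
  split_ifs <;> exact emb_jet _ _

theorem den_extDeriv : ∀ q ∈ derTable, Den (extVal R) q.2 (extDeriv (tailK R) (extVal R q.1)) := by
  rw [extVal_eq]
  exact den_derTable (extDeriv_fld (tailK R))

theorem Code.den_emb {F : ∀ {A : Type r} [CommRing A], (ℕ → A) → (ℕ → A) → A} (f : Code F) :
    Den (extVal R) f.1 (embHom R 2 (F (jet R 0) (jet R 1))) := den_map _ f.den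

theorem den_flowS (i : Fin 2) : Den (jetVal (jet R)) (flowS.{r} i) (flow R i) := by
  fin_cases i
  · exact flowUCode.den
  · exact flowVCode.den

theorem den_tailS (a i : Fin 2) : Den (extVal R) (tailS.{r} a i) (embHom R 2 (tailK R a i)) := by
  refine den_map _ ?_
  fin_cases a
  · fin_cases i
    · exact den_jetMono (jet R) 0 (by norm_num)
    · exact den_jetMono (jet R) 1 (by norm_num)
  · exact den_flowS i

theorem supported_flowS (i : Fin 2) : supported (bound derTable) (flowS.{r} i) = true := by
  fin_cases i <;> decide +kernel

theorem denPartials_flowS (i k : Fin 2) : DenPartials (extVal R) (flowS.{r} i) (jetVars k)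
    (partials (embHom R 2) (flow R i) k) :=
  denPartials_partials _ (den_flowS i) (supported_flowS i) k

theorem goodTable_evolTable : GoodTable evolTable.{r} := by
  refine ⟨by simp [evolTable], fun p hp => ?_⟩
  simp only [evolTable, List.map_cons, List.map_nil, List.mem_cons, List.not_mem_nil,
    or_false] at hp
  rcases hp with rfl | rfl | rfl | rfl | rfl | rfl | rfl | rfl | rfl | rfl | rfl | rfl | rfl | rfl |
    rfl | rfl <;> norm_num

theorem den_evolTable : ∀ q ∈ evolTable.{r}, Den (extVal R) q.2
    (evol (tailK R) (fun i => emb R 2 (flow R i)) (extVal R q.1)) := by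
  have h : ∀ (i : Fin 2) n p, jetVal (fun i n => (X (ExtVar.fld i n) : ExtPoly R 2)) p =
      X (ExtVar.fld i n) → Den (extVal R) (p, iterDeriv n (flowS.{r} i)).2
        (evol (tailK R) (fun i => emb R 2 (flow R i))
          (extVal R (p, iterDeriv n (flowS.{r} i)).1)) := by
    intro i n p h
    rw [extVal_eq]
    dsimp only
    rw [h, evol_fld, ← extVal_eq]
    exact den_iterDeriv den_extDeriv (den_map (embHom R 2) (den_flowS i)) n
  simp only [evolTable, List.forall_mem_cons]
  exact ⟨h 0 0 2 rfl, h 1 0 3 rfl, h 0 1 5 rfl, h 1 1 7 rfl, h 0 2 11 rfl, h 1 2 13 rfl, h 0 3 17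
    rfl, h 1 3 19 rfl, h 0 4 23 rfl, h 1 4 29 rfl, h 0 5 31 rfl, h 1 5 37 rfl, h 0 6 41 rfl, h 1 6
    43 rfl, h 0 7 47 rfl, h 1 7 53 rfl,
    List.forall_mem_nil _⟩

variable {p X : ExtPoly R 2} {x : List SPoly}

/-- Values of operators in the universal ring. -/
abbrev DenExt (x : List SPoly) (p X : ExtPoly R 2) : Prop :=
  DenOp (extVal R) (extDeriv (tailK R)) x p X

/-- The sparse operator is in Horner form, `D (α₃ + D² (α₂ + D² (α₁ + 2 D²)))` plus the terms with
the coefficient on the left; expanding by additivity of `D_x` gives `K₁`. -/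
theorem denExt_opK1S (h : DenExt x p X) :
    DenExt (opK1S.{r} x) p (extAct (tailK R) (opK1 R) X) := by
  refine denOp_cast (denOp_clean (denOp_add (denOp_deriv den_extDeriv (denOp_add
    (denOp_scale alpha3Code.den_emb h) (denOp_iterDeriv den_extDeriv (denOp_add
    (denOp_scale alpha2Code.den_emb h) (denOp_iterDeriv den_extDeriv (denOp_add
    (denOp_scale alpha1Code.den_emb h)
    (denOp_scale (den_ofNat 2) (denOp_iterDeriv den_extDeriv h 2))) 2)) 2)))
    (denOp_add (denOp_scale alpha1Code.den_emb (denOp_iterDeriv den_extDeriv h 5))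
      (denOp_add (denOp_scale alpha2Code.den_emb (denOp_iterDeriv den_extDeriv h 3))
      (denOp_scale alpha3Code.den_emb (denOp_deriv den_extDeriv h)))))) ?_
  simp only [opK1, extAct, DiffOp.act_add, DiffOp.act_mul, DiffOp.act_pow, DiffOp.act_coeff,
    Function.iterate_succ_apply, Function.iterate_zero, id, map_add, deriv_ofNat_mul, map_ofNat,
    DiffOp.act_der]
  ring

theorem denExt_opK4S (h : DenExt x p X) :
    DenExt (opK4S.{r} x) p (extAct (tailK R) (opK4 R) X) := by
  refine denOp_cast (denOp_clean (denOp_add (denOp_deriv den_extDeriv (denOp_add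
    (denOp_scale alpha12Code.den_emb h) (denOp_iterDeriv den_extDeriv (denOp_add
    (denOp_scale alpha11Code.den_emb h) (denOp_iterDeriv den_extDeriv (denOp_add
    (denOp_scale alpha10Code.den_emb h)
    (denOp_scale (den_neg (den_ofNat 18)) (denOp_iterDeriv den_extDeriv h 2))) 2)) 2)))
    (denOp_add (denOp_scale alpha10Code.den_emb (denOp_iterDeriv den_extDeriv h 5))
      (denOp_add (denOp_scale alpha11Code.den_emb (denOp_iterDeriv den_extDeriv h 3))
      (denOp_scale alpha12Code.den_emb (denOp_deriv den_extDeriv h)))))) ?_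
  simp only [opK4, extAct, DiffOp.act_add, DiffOp.act_mul, DiffOp.act_pow, DiffOp.act_coeff,
    Function.iterate_succ_apply, Function.iterate_zero, id, map_add, neg_mul, map_neg, map_ofNat, deriv_ofNat_mul,
    DiffOp.act_der]
  ring

theorem den_jetMono_emb (i : Fin 2) {n : ℕ} (hn : n < 6) :
    Den (extVal R) (jetMono i n) (embHom R 2 (jet R i n)) := den_map _ (den_jetMono (jet R) i hn)

theorem denExt_opK2S (h : DenExt x p X) :
    DenExt (opK2S.{r} x) p (extAct (tailK R) (opK2 R) X) := by
  refine denOp_cast (denOp_clean (denOp_add (denOp_scale alpha9Code.den_emb h)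
    (denOp_deriv den_extDeriv (denOp_add (denOp_scale alpha8Code.den_emb h)
    (denOp_deriv den_extDeriv (denOp_add (denOp_scale alpha7Code.den_emb h)
    (denOp_deriv den_extDeriv (denOp_add (denOp_scale alpha6Code.den_emb h)
    (denOp_deriv den_extDeriv (denOp_add (denOp_scale alpha5Code.den_emb h)
    (denOp_deriv den_extDeriv (denOp_add (denOp_scale alpha4Code.den_emb h)
    (denOp_deriv den_extDeriv (denOp_scale (den_neg (den_ofNat 56))
      (denOp_scale (den_jetMono_emb 1 (by norm_num)) h))))))))))))))) ?_
  simp only [opK2, extAct, DiffOp.act_add, DiffOp.act_mul, DiffOp.act_pow, DiffOp.act_coeff,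
    Function.iterate_succ_apply, Function.iterate_zero, id, map_add, neg_mul, map_neg, map_ofNat, deriv_ofNat_mul,
    DiffOp.act_der]
  ring

/-- The adjoint turns `Dⁿ α` into `(-1)ⁿ α Dⁿ`, so no derivative of a coefficient has to be
computed. -/
theorem denExt_opK3S (h : DenExt x p X) :
    DenExt (opK3S.{r} x) p (extAct (tailK R) (-(opK2 R).adjoint) X) := by
  refine denOp_cast (denOp_clean (denOp_neg (denOp_add (denOp_scale
      (den_mul (den_neg (den_ofNat 56)) (den_jetMono_emb 1 (by norm_num)))
      (denOp_iterDeriv den_extDeriv h 6))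
    (denOp_add (denOp_scale (den_neg alpha4Code.den_emb) (denOp_iterDeriv den_extDeriv h 5))
    (denOp_add (denOp_scale alpha5Code.den_emb (denOp_iterDeriv den_extDeriv h 4))
    (denOp_add (denOp_scale (den_neg alpha6Code.den_emb) (denOp_iterDeriv den_extDeriv h 3))
    (denOp_add (denOp_scale alpha7Code.den_emb (denOp_iterDeriv den_extDeriv h 2))
    (denOp_add (denOp_scale (den_neg alpha8Code.den_emb) (denOp_deriv den_extDeriv h))
      (denOp_scale alpha9Code.den_emb h))))))))) ?_
  simp only [opK2, extAct, DiffOp.adjoint_add, DiffOp.adjoint_mul, DiffOp.adjoint_coeff,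
    DiffOp.adjoint_der, DiffOp.act_neg, DiffOp.act_add, DiffOp.act_mul, DiffOp.act_coeff,
    act_adjoint_pow_der,
    Function.iterate_succ_apply, Function.iterate_zero, id, neg_mul, map_neg, map_ofNat, deriv_ofNat_mul,
    DiffOp.act_der]
  ring

theorem denExt_opKS (i j : Fin 2) (h : DenExt x p X) :
    DenExt (opKS.{r} i j x) p (extAct (tailK R) ((opK R).loc i j) X) := by
  fin_cases i
  · fin_cases j
    · exact denExt_opK1S h
    · exact denExt_opK2S h
  · fin_cases j
    · exact denExt_opK3S h
    · exact denExt_opK4S h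

/-- The linearization of the flow. -/
abbrev flowLin (R : Type*) [CommRing R] (i j : Fin 2) : DiffOp R := linOp (flow R i) j 6

theorem denExt_lin (i k : Fin 2) (h : DenExt x p X) :
    DenExt (opLin (flowS.{r} i) (jetVars k) x) p (extAct (tailK R) (flowLin R i k) X) :=
  denOp_cast (denOp_lin den_extDeriv (denPartials_flowS i k) h) (linVal_partials _ _ _ _ _)

theorem denExt_adj (i k : Fin 2) (h : DenExt x p X) :
    DenExt (opAdj (flowS.{r} i) (jetVars k) x) p
      (extAct (tailK R) (flowLin R i k).adjoint X) :=
  denOp_cast (denOp_adj den_extDeriv (denPartials_flowS i k) h) (adjVal_partials _ _ _ _ _)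

theorem denExt_conc (i k : Fin 2) {a : SPoly} {A : ExtPoly R 2} (ha : Den (extVal R) a A)
    (h : DenExt x p X) : DenExt (opConc (flowS.{r} i) (jetVars k) a x) p
      (extConc (tailK R) (flowLin R i k) A X) :=
  denOp_cast (denOp_conc den_extDeriv (denPartials_flowS i k) ha h) (concVal_partials _ _ _ _ _ _)

theorem denExt_leib (i k : Fin 2) {a : SPoly} {A : ExtPoly R 2} (ha : Den (extVal R) a A)
    (h : DenExt x p X) : DenExt (opLeib (flowS.{r} i) (jetVars k) a x) p
      ((flowLin R i k).leib (embHom R 2) (extDeriv (tailK R)) A X) :=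
  denOp_cast (denOp_leib den_extDeriv (denPartials_flowS i k) ha h) (leibVal_partials _ _ _ _ _ _)

theorem denExt_adjS {K : Fin 2 → Fin 2 → List SPoly → List SPoly}
    {M : Fin 2 → Fin 2 → DiffOp R} (hK : ∀ i j {x} {p X : ExtPoly R 2}, DenExt x p X →
      DenExt (K i j x) p (extAct (tailK R) (M i j) X)) (i j : Fin 2) (p : ExtPoly R 2) :
    DenExt (adjS.{r} K i j) p
      (∑ k, extAct (tailK R) (M i k) (extAct (tailK R) (flowLin R j k).adjoint p)) := by
  rw [Fin.sum_univ_two, adjS]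
  exact denOp_add (hK i 0 (denExt_adj j 0 denOp_one)) (hK i 1 (denExt_adj j 1 denOp_one))

theorem denExt_linS {K : Fin 2 → Fin 2 → List SPoly → List SPoly}
    {M : Fin 2 → Fin 2 → DiffOp R} (hK : ∀ i j {x} {p X : ExtPoly R 2}, DenExt x p X →
      DenExt (K i j x) p (extAct (tailK R) (M i j) X)) (i j : Fin 2) (p : ExtPoly R 2) :
    DenExt (linS.{r} K i j) p
      (∑ k, extAct (tailK R) (flowLin R i k) (extAct (tailK R) (M k j) p)) := by
  rw [Fin.sum_univ_two, linS]
  exact denOp_add (denExt_lin i 0 (hK 0 j denOp_one)) (denExt_lin i 1 (hK 1 j denOp_one))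

theorem denExt_concS (a b i j : Fin 2) (p : ExtPoly R 2) :
    DenExt (concS.{r} a b i j) p ((4 : R) • (emb R 2 (tailK R a i) *
      ∑ k, extConc (tailK R) (flowLin R j k) (emb R 2 (tailK R b k)) p)) := by
  refine denOp_cast (denOp_scale (den_ofNat 4) (denOp_scale (den_tailS a i)
    (denOp_add (denExt_conc j 0 (den_tailS b 0) denOp_one)
      (denExt_conc j 1 (den_tailS b 1) denOp_one)))) ?_
  rw [Fin.sum_univ_two, Algebra.smul_def, map_ofNat]
  rfl

theorem denExt_leibS (a b i j : Fin 2) (p : ExtPoly R 2) :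
    DenExt (leibS.{r} a b i j) p ((4 : R) • ∑ k, (flowLin R i k).leib (embHom R 2)
      (extDeriv (tailK R)) (emb R 2 (tailK R a k)) (emb R 2 (tailK R b j) * p)) := by
  refine denOp_cast (denOp_scale (den_ofNat 4)
    (denOp_add (denExt_leib i 0 (den_tailS a 0) (denOp_scale (den_tailS b j) denOp_one))
      (denExt_leib i 1 (den_tailS a 1) (denOp_scale (den_tailS b j) denOp_one)))) ?_
  rw [Fin.sum_univ_two, Algebra.smul_def, map_ofNat]
  rfl

theorem denExt_evol (i j : Fin 2) (s : Fin 3) (k : Fin 2) :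
    DenExt (opDer evolTable.{r} (opKS.{r} i j [const 1])) (cov R 2 s k)
      (evol (tailK R) (fun i => emb R 2 (flow R i))
        (extAct (tailK R) ((opK R).loc i j) (cov R 2 s k))) := by
  refine denOp_der goodTable_evolTable den_evolTable (fun n => ?_) (denExt_opKS i j denOp_one)
  rw [iterate_extDeriv_cov, evol_cov]

end

end SPoly


/-! ### Evaluation of the defects in the kernel -/

namespace SPoly

universe r

open WNLOp

/-- The operator `J`. -/
def opJS (i j : Fin 2) (x : List SPoly) : List SPoly :=
  Fin.cases (Fin.cases (opScale (const 3) (opDeriv x)) (fun _ => []) j)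
    (fun _ => Fin.cases [] (fun _ => opDeriv x) j) i

/-- The defect of the invariance of `J` under the flow. -/
def defectJ (i j : Fin 2) : List SPoly :=
  opAdd (opDer evolTable.{r} (opJS i j [const 1]))
    (opNeg (opAdd (adjS.{r} opJS i j) (linS.{r} opJS i j)))

set_option maxRecDepth 1000000

theorem opIsZero_defectJ (i j : Fin 2) : opIsZero (defectJ.{r} i j) = true := by
  fin_cases i <;> fin_cases j <;> decide +kernel

/-- The computational core: entry by entry, `K_t = L K + K L*` becomes the vanishing of finitely
many integer polynomials. -/
theorem opIsZero_defect_zero_zero : opIsZero (defect.{r} 0 0) = true := by decide +kernel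

theorem opIsZero_defect_zero_one : opIsZero (defect.{r} 0 1) = true := by decide +kernel

theorem opIsZero_defect_one_zero : opIsZero (defect.{r} 1 0) = true := by decide +kernel

theorem opIsZero_defect_one_one : opIsZero (defect.{r} 1 1) = true := by decide +kernel

theorem opIsZero_defect (i j : Fin 2) : opIsZero (defect.{r} i j) = true := by
  fin_cases i
  · fin_cases j
    · exact opIsZero_defect_zero_zero
    · exact opIsZero_defect_zero_one
  · fin_cases j
    · exact opIsZero_defect_one_zero
    · exact opIsZero_defect_one_one

variable {R : Type r} [CommRing R]

theorem denExt_opJS (i j : Fin 2) {p X : ExtPoly R 2} {x : List SPoly} (h : DenExt x p X) :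
    DenExt (opJS i j x) p (extAct (tailK R) (opJ R i j) X) := by
  fin_cases i
  · fin_cases j
    · refine denOp_cast (denOp_scale (den_ofNat 3) (denOp_deriv den_extDeriv h)) ?_
      change _ = embHom R 2 3 * extDeriv (tailK R) X
      rw [map_ofNat]
    · exact (DiffOp.act_zero (embHom R 2) (extDeriv (tailK R)) X)
  · fin_cases j
    · exact (DiffOp.act_zero (embHom R 2) (extDeriv (tailK R)) X)
    · exact denOp_deriv den_extDeriv h

/-! ### The flow -/

/-- A polynomial in `u_{nx}` and `v_{nx}` with `n ≤ 5` does not depend on higher derivatives. -/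
theorem pderiv_eq_zero_of_supported {f : SPoly} {F : DiffPoly R} (hf : Den (jetVal (jet R)) f F)
    (hs : supported (bound (derTable.take 12)) f = true) (k : Fin 2) (n : ℕ) (hn : 6 ≤ n) :
    pderiv (k, n) F = 0 := by
  have ht : GoodTable (derTable.take 12) :=
    ⟨goodTable_derTable.1.sublist ((List.take_sublist 12 _).map _),
      fun p hp => goodTable_derTable.2 p (((List.take_sublist 12 _).map _).subset hp)⟩
  obtain ⟨q, -, hq⟩ := exists_partialDeriv (pderiv (k, n)) ht hf hs
  rw [hq]
  refine Finset.sum_eq_zero fun p hp => ?_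
  have h1 : ∀ p ∈ (derTable.take 12).map Prod.fst, (jetIdx p).2 < 6 := by decide +kernel
  rw [jetVal_jet, pderiv_X_of_ne, mul_zero]
  intro h
  have := h1 p (by simpa using hp)
  rw [h] at this
  exact absurd hn (not_le.2 this)

theorem pderiv_flow_eq_zero (i k : Fin 2) (n : ℕ) (hn : 6 ≤ n) : pderiv (k, n) (flow R i) = 0 :=
  pderiv_eq_zero_of_supported (den_flowS i) (by fin_cases i <;> decide +kernel) k n hn

theorem den_pderiv_flow (i : Fin 2) {p : ℕ} (hp : p ∈ derTable.map Prod.fst) :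
    Den (jetVal (jet R)) (partialDeriv p (flowS.{r} i)) (pderiv (jetIdx p) (flow R i)) :=
  den_pderiv (den_flowS i) (supported_flowS i) hp

theorem eq_of_isZero {B : Type*} [CommRing B] {ρ : ℕ → B} {f g : SPoly} {x y : B}
    (hf : Den ρ f x) (hg : Den ρ g y) (h : isZero (merge f (neg g)) = true) : x = y :=
  sub_eq_zero.1 (eq_zero_of_isZero (den_sub hf hg) h)

end SPoly

/-! ### The system: symmetries, invariance, dispersion -/

namespace WNLOp

universe r

open SPoly

variable {R : Type r} [CommRing R]

/-- The linearization of `(u_x, v_x)`. -/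
def derLin (R : Type*) [CommRing R] (i j : Fin 2) : DiffOp R := if i = j then .der else 0

theorem extAct_derLin {m : ℕ} (w : Fin m → Fin 2 → DiffPoly R) (i : Fin 2)
    (Q : Fin 2 → ExtPoly R m) : ∑ j, extAct w (derLin R i j) (Q j) = extDeriv w (Q i) := by
  have h0 : ∀ f, extAct w (0 : DiffOp R) f = 0 := DiffOp.act_zero (embHom R m) (extDeriv w)
  fin_cases i
  · rw [Fin.sum_univ_two]
    change extDeriv w (Q 0) + extAct w 0 (Q 1) = _
    rw [h0, add_zero]
    rfl
  · rw [Fin.sum_univ_two]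
    change extAct w 0 (Q 0) + extDeriv w (Q 1) = _
    rw [h0, zero_add]
    rfl

/-- The linearization of a translation is `D_x` in each component. It has constant coefficients, and
evolutionary fields of differential polynomials commute with it. -/
theorem isSymmetry_tailK_zero : IsSymmetry (tailK R) (tailK R 0) (derLin R) := by
  have h0 : tailK R 0 = fun i => jet R i 1 := by
    funext i
    fin_cases i <;> rfl
  have hl : ∀ (Q : Fin 2 → ExtPoly R 2) i,
      evol (tailK R) Q (emb R 2 (jet R i 1)) = extDeriv (tailK R) (Q i) := fun Q i => by
    rw [emb_jet, evol_fld]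
    rfl
  refine ⟨fun Q i => ?_, fun a j => ?_, fun Q Q' i => ?_⟩
  · rw [h0, hl, extAct_derLin]
  · simp only [h0]
    rw [hl, evol_jet_one]
  · have : ∀ (δ : Derivation R (ExtPoly R 2) (ExtPoly R 2)) k f,
        extVary (tailK R) δ (derLin R i k) f = 0 := by
      intro δ k f
      rw [derLin]
      split_ifs
      · rfl
      · change δ (embHom R 2 0) * f = 0
        rw [map_zero, map_zero, zero_mul]
    simp only [this]

theorem isSymmetry_tailK_one : IsSymmetry (tailK R) (tailK R 1) (flowLin R) := by
  refine isSymmetry_linOp (W := flow R) (fun i k n hn => pderiv_flow_eq_zero i k n hn)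
    fun a j => ?_
  fin_cases a
  · exact (isSymmetry_tailK_zero.comm 1 j).symm
  · rfl

theorem extAct_derLin_adjoint {m : ℕ} (w : Fin m → Fin 2 → DiffPoly R) (j i : Fin 2)
    (f : ExtPoly R m) :
    extAct w (derLin R j i).adjoint f = if j = i then -extDeriv w f else 0 := by
  rw [derLin, apply_ite DiffOp.adjoint]
  split_ifs
  · exact DiffOp.act_neg (embHom R m) (extDeriv w) .der f
  · exact DiffOp.act_zero (embHom R m) (extDeriv w) f

/-- Since `D_x* = -D_x`, covectors evolve by `D_x P`, and each potential by its own `x`-derivative.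
-/
theorem lieDeriv_derLin {m : ℕ} (w : Fin m → Fin 2 → DiffPoly R) :
    lieDeriv w (fun i => jet R i 1) (derLin R) = extDeriv w := by
  apply derivation_ext
  intro v
  cases v with
  | fld i n => rw [lieDeriv_fld, extDeriv_fld, emb_jet, iterate_extDeriv_fld, add_comm]
  | cov s i n =>
    have h : -adjCov w (derLin R) s i = extDeriv w (cov R m s i) := by
      simp only [adjCov, extAct_derLin_adjoint]
      rw [Finset.sum_ite_eq', if_pos (Finset.mem_univ i), neg_neg]
    rw [lieDeriv_cov_var, extDeriv_cov, h, ← Function.iterate_succ_apply,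
      iterate_extDeriv_cov]
  | pot s a =>
    rw [lieDeriv_pot, extDeriv_pot, potConc]
    refine Finset.sum_congr rfl fun j _ => ?_
    have h : ∀ i, extConc w (derLin R j i) (emb R m (w a i)) (cov R m s j) =
        if j = i then emb R m (w a i) * cov R m s j else 0 := by
      intro i
      simp only [derLin]
      split_ifs <;> rfl
    simp only [h]
    rw [Finset.sum_ite_eq, if_pos (Finset.mem_univ j)]

theorem tailK_zero : tailK R 0 = fun i => jet R i 1 := by
  funext i
  fin_cases i <;> rfl

theorem isInvariant_derLin (K : WNLOp (tailK R)) : K.IsInvariant (tailK R 0) (derLin R) := by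
  intro s i
  rw [extAct_derLin, tailK_zero, lieDeriv_derLin]

theorem isInvariant_opK_flow : (opK R).IsInvariant (tailK R 1) (flowLin R) := by
  refine isInvariant_of_loc isSymmetry_tailK_one fun s i j => ?_
  have h := eq_zero_of_opIsZero (denOp_add (denOp_add (denExt_evol i j s j)
    (denOp_add (denExt_concS 0 1 i j (cov R 2 s j)) (denExt_concS 1 0 i j (cov R 2 s j))))
    (denOp_neg (denOp_add (denExt_adjS (M := (opK R).loc) (fun i j => denExt_opKS i j) i j _)
      (denOp_add (denExt_linS (M := (opK R).loc) (fun i j => denExt_opKS i j) i j _)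
      (denOp_add (denExt_leibS 0 1 i j (cov R 2 s j)) (denExt_leibS 1 0 i j (cov R 2 s j)))))))
    (opIsZero_defect i j)
  rw [← sub_eq_add_neg, sub_eq_zero] at h
  have ht : ∀ g : Fin 2 → Fin 2 → ExtPoly R 2, ∑ a, ∑ b, (opK R).tail a b • g a b =
      (4 : R) • g 0 1 + (4 : R) • g 1 0 := by
    intro g
    simp [Fin.sum_univ_two, opK]
  rw [ht, ht]
  exact h

theorem isInvariant_opJ_flow :
    (ofLocal (tailK R) (opJ R)).IsInvariant (tailK R 1) (flowLin R) := by
  refine isInvariant_of_loc isSymmetry_tailK_one fun s i j => ?_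
  have h := eq_zero_of_opIsZero (denOp_add
    (denOp_der goodTable_evolTable den_evolTable (fun n => by
      rw [iterate_extDeriv_cov, evol_cov]) (denExt_opJS i j (denOp_one (p := cov R 2 s j))))
    (denOp_neg (denOp_add (denExt_adjS (M := opJ R) (fun i j => denExt_opJS i j) i j _)
      (denExt_linS (M := opJ R) (fun i j => denExt_opJS i j) i j _))))
    (opIsZero_defectJ i j)
  rw [← sub_eq_add_neg, sub_eq_zero] at h
  have ht : ∀ g : Fin 2 → Fin 2 → ExtPoly R 2,
      ∑ a, ∑ b, (ofLocal (tailK R) (opJ R)).tail a b • g a b = 0 := by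
    intro g
    simp [ofLocal]
  rw [ht, ht, add_zero, add_zero]
  exact h

/-- The constants `1` and `-9` are the coefficients of `u_{5x}` and `v_{5x}`; neither equation
contains the fifth derivative of the other variable. -/
theorem pderiv_five_flow (i j : Fin 2) :
    pderiv (j, 5) (flow R i) = if j = i then C (![1, -9] i) else 0 := by
  fin_cases i
  · fin_cases j
    · refine eq_of_isZero (den_pderiv_flow 0 (p := 31) (by decide)) (den_cast (den_const 1) ?_)
        (by decide +kernel)
      simp
    · exact eq_zero_of_isZero (den_pderiv_flow 0 (p := 37) (by decide)) (by decide +kernel)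
  · fin_cases j
    · exact eq_zero_of_isZero (den_pderiv_flow 1 (p := 31) (by decide)) (by decide +kernel)
    · refine eq_of_isZero (den_pderiv_flow 1 (p := 37) (by decide))
        (den_cast (den_neg (den_const 9)) ?_) (by decide +kernel)
      change -((9 : ℕ) : DiffPoly R) = C (-9)
      rw [map_neg, Nat.cast_ofNat, map_ofNat]

theorem isDispersive_flow [CharZero R] : IsDispersive (flow R) (flowLin R) ![1, -9] where
  lin _ _ := rfl
  lead i j := pderiv_five_flow i j
  sub i := by
    fin_cases i
    · exact eq_zero_of_isZero (den_pderiv_flow 0 (p := 23) (by decide)) (by decide +kernel)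
    · exact eq_zero_of_isZero (den_pderiv_flow 1 (p := 29) (by decide)) (by decide +kernel)
  ne_zero i := by
    fin_cases i
    · simp
    · simp
  ne := by
    change (1 : R) ≠ -9
    intro h
    have h1 : ((10 : ℕ) : R) = 0 := by
      push_cast
      linear_combination h
    exact absurd (Nat.cast_eq_zero.1 h1) (by norm_num)

theorem tailIndep_tailK [IsDomain R] [CharZero R] : TailIndep (tailK R) := by
  intro k hk
  have h0 := hk 0
  have h1 := hk 1
  rw [Fin.sum_univ_two] at h0 h1
  change emb R 2 (jet R 0 1) * k 0 + emb R 2 (flow R 0) * k 1 = 0 at h0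
  change emb R 2 (jet R 1 1) * k 0 + emb R 2 (flow R 1) * k 1 = 0 at h1
  have hinj : Function.Injective (emb R 2) := rename_injective _ fun a b h => by
    injection h with h1 h2
    exact Prod.ext h1 h2
  -- The determinant of the two tail vectors is nonzero, because its derivative in `v_{5x}` is `-9
  -- u_x`.
  have hdet : jet R 0 1 * flow R 1 - jet R 1 1 * flow R 0 ≠ 0 := by
    intro h
    have h2 := congrArg (pderiv (1, 5)) h
    rw [map_sub, Derivation.leibniz, Derivation.leibniz, pderiv_five_flow, pderiv_five_flow,
      jet, jet, pderiv_X_of_ne (by decide), pderiv_X_of_ne (by decide), map_zero] at h2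
    simp at h2
  have hk1 : k 1 = 0 := by
    have h2 : emb R 2 (jet R 0 1 * flow R 1 - jet R 1 1 * flow R 0) * k 1 = 0 := by
      rw [map_sub, map_mul, map_mul]
      linear_combination emb R 2 (jet R 0 1) * h1 - emb R 2 (jet R 1 1) * h0
    refine (mul_eq_zero.1 h2).resolve_left fun h => hdet (hinj ?_)
    rw [h, map_zero]
  have hk0 : k 0 = 0 := by
    rw [hk1, mul_zero, add_zero] at h0
    refine (mul_eq_zero.1 h0).resolve_left fun h => X_ne_zero (R := R) ((0 : Fin 2), 1) (hinj ?_)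
    rw [map_zero]
    exact h
  funext a
  fin_cases a
  · exact hk0
  · exact hk1

/-! ### Skewness -/

/-- The diagonal entries are sums `α Dᵏ + Dᵏ α` with odd `k`, plus a constant multiple of `D⁷`; the
off-diagonal entries are minus each other's adjoint by construction. -/
theorem isSkew_opK : (opK R).IsSkew where
  loc i j f := by
    fin_cases i
    · fin_cases j
      · change extAct (tailK R) (opK1 R).adjoint f = -extAct (tailK R) (opK1 R) f
        simp only [opK1, extAct, DiffOp.adjoint_add, DiffOp.adjoint_mul, DiffOp.adjoint_coeff,
          DiffOp.adjoint_der, DiffOp.act_neg, DiffOp.act_add, DiffOp.act_mul, DiffOp.act_coeff,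
          act_adjoint_pow_der, DiffOp.act_pow, DiffOp.act_der, Function.iterate_succ_apply,
          Function.iterate_zero, id, map_ofNat, deriv_ofNat_mul]
        ring
      · change extAct (tailK R) (opK2 R).adjoint f = -extAct (tailK R) (-(opK2 R).adjoint) f
        simp only [extAct, DiffOp.act_neg, neg_neg]
    · fin_cases j
      · change extAct (tailK R) (-(opK2 R).adjoint).adjoint f = -extAct (tailK R) (opK2 R) f
        simp only [extAct, DiffOp.act_adjoint_neg, DiffOp.act_adjoint_adjoint]
      · change extAct (tailK R) (opK4 R).adjoint f = -extAct (tailK R) (opK4 R) f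
        simp only [opK4, extAct, DiffOp.adjoint_add, DiffOp.adjoint_mul, DiffOp.adjoint_coeff,
          DiffOp.adjoint_der, DiffOp.act_neg, DiffOp.act_add, DiffOp.act_mul, DiffOp.act_coeff,
          act_adjoint_pow_der, DiffOp.act_pow, DiffOp.act_der, Function.iterate_succ_apply,
          Function.iterate_zero, id, map_ofNat, neg_mul, map_neg, deriv_ofNat_mul]
        ring
  tail a b := by
    fin_cases a <;> fin_cases b <;> rfl

theorem isSkew_opJ {m : ℕ} (w : Fin m → Fin 2 → DiffPoly R) : (ofLocal w (opJ R)).IsSkew where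
  loc i j f := by
    have h0 : extAct w (0 : DiffOp R).adjoint f = -extAct w 0 f := by
      rw [DiffOp.adjoint_zero, extAct, DiffOp.act_zero, neg_zero]
    fin_cases i
    · fin_cases j
      · change extAct w (.coeff 3 * .der : DiffOp R).adjoint f =
          -extAct w (.coeff 3 * .der : DiffOp R) f
        simp only [extAct, DiffOp.adjoint_mul, DiffOp.adjoint_coeff, DiffOp.adjoint_der,
          DiffOp.act_neg, DiffOp.act_mul, DiffOp.act_coeff, DiffOp.act_der, map_ofNat,
          deriv_ofNat_mul]
      · exact h0
    · fin_cases j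
      · exact h0
      · exact DiffOp.act_neg (embHom R m) (extDeriv w) .der f
  tail _ _ := rfl

/-! ### Hamiltonian operators -/

/-- Only the flow has to be tested: invariance under the other tail vector, the translation, holds
for every operator. -/
theorem isHamiltonian_of_isInvariant [IsDomain R] [CharZero R] {K : WNLOp (tailK R)}
    (hs : K.IsSkew) (hK : K.IsInvariant (tailK R 1) (flowLin R)) : K.IsHamiltonian := by
  refine ⟨isSkewAdjoint_of_isSkew hs, ?_⟩
  refine trivectorVanishes_of_isInvariant (Lw := ![derLin R, flowLin R]) (b := 1)
    (c := ![1, -9]) tailIndep_tailK (fun a => ?_) hs (fun a => ?_) isDispersive_flow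
  · fin_cases a
    · exact isSymmetry_tailK_zero
    · exact isSymmetry_tailK_one
  · fin_cases a
    · exact isInvariant_derLin K
    · exact hK

/-- The coefficients are constant and the tail is zero, so there is nothing to vary and the
trivector density vanishes identically. -/
theorem isHamiltonian_opJ {m : ℕ} (w : Fin m → Fin 2 → DiffPoly R) :
    (ofLocal w (opJ R)).IsHamiltonian := by
  refine ⟨isSkewAdjoint_of_isSkew (isSkew_opJ w), 0, ?_⟩
  have h1 : ∀ Q s i, evol w Q ((ofLocal w (opJ R)).locValue s i) = 0 := by
    intro Q s i
    rw [locValue, map_sum]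
    refine Finset.sum_eq_zero fun j _ => ?_
    have hd : evol w Q (extDeriv w (cov R m s j)) = 0 := by rw [cov, extDeriv_cov, evol_cov]
    have h0 : evol w Q (extAct w (0 : DiffOp R) (cov R m s j)) = 0 := by
      rw [extAct, DiffOp.act_zero, map_zero]
    fin_cases i
    · fin_cases j
      · change evol w Q (embHom R m 3 * extDeriv w (cov R m s 0)) = 0
        rw [map_ofNat, deriv_ofNat_mul]
        exact (congrArg _ hd).trans (mul_zero _)
      · exact h0
    · fin_cases j
      · exact h0
      · exact hd
  have h2 : ∀ t s r, (ofLocal w (opJ R)).variation t s r = 0 := by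
    intro t s r
    simp only [variation, h1]
    simp [ofLocal]
  rw [trivector, h2, h2, h2, map_zero, add_zero, add_zero]

end WNLOp


/-! ### Variational derivatives by sparse polynomials -/

namespace SPoly

universe r

open WNLOp

/-- The variational derivative. -/
def gradS (f : SPoly) (ps : List ℕ) : SPoly :=
  List.rec nil (fun p _ ih => merge (partialDeriv p f) (neg (deriv ih))) ps

theorem den_gradS {R B : Type*} [CommRing R] [CommRing B] [Algebra R B] {ρ : ℕ → B}
    {D : Derivation R B B} (hD : ∀ q ∈ derTable, Den ρ q.2 (D (ρ q.1))) {f : SPoly} {ps : List ℕ}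
    {fs : List B} (hf : DenPartials ρ f ps fs) : Den ρ (gradS f ps) (adjVal D fs 1) := by
  induction hf with
  | nil => rfl
  | cons h _ ih => exact den_cast (den_merge h (den_neg (den_deriv hD ih))) (by rw [adjVal, mul_one])

variable {R : Type r} [CommRing R]

/-- The variational derivative is the adjoint of the Fréchet derivative applied to `1`; six terms
suffice for a density of order at most five. -/
theorem varDeriv_eq {f : DiffPoly R} {i : Fin 2} (hf : ∀ n, 6 ≤ n → pderiv (i, n) f = 0) :
    varDeriv f i = (linOp f i 6).adjoint.act (RingHom.id _) (totalDeriv R) 1 := by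
  rw [act_adjoint_linOp, varDeriv, finsum_eq_sum_of_support_subset (s := Finset.range 6)]
  · simp only [RingHom.id_apply, mul_one]
  · intro n hn
    rw [Function.mem_support] at hn
    rw [Finset.coe_range, Set.mem_Iio]
    by_contra h
    refine hn ?_
    have h0 : (totalDeriv R)^[n] 0 = 0 := by
      induction n with
      | zero => rfl
      | succ n ih => rw [Function.iterate_succ_apply, map_zero, iterate_map_zero]
    rw [hf n (not_lt.1 h), h0, mul_zero]

theorem varDeriv_C_mul (c : R) {f : DiffPoly R} {i : Fin 2}
    (hf : ∀ n, 6 ≤ n → pderiv (i, n) f = 0) : varDeriv (C c * f) i = C c * varDeriv f i := by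
  rw [varDeriv_eq hf, varDeriv_eq fun n hn => by rw [pderiv_C_mul, hf n hn, mul_zero],
    act_adjoint_linOp, act_adjoint_linOp, Finset.mul_sum]
  refine Finset.sum_congr rfl fun n _ => ?_
  have h := DiffOp.act_map_smul (RingHom.id _) (totalDeriv R) ((DiffOp.der : DiffOp R) ^ n) c
    (pderiv (i, n) f)
  rw [DiffOp.act_pow, DiffOp.act_pow] at h
  rw [← C_mul', ← C_mul'] at h
  rw [pderiv_C_mul, RingHom.id_apply, RingHom.id_apply, mul_one, mul_one, mul_left_comm]
  exact congrArg _ h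

theorem pderiv_rho1_eq_zero (k : Fin 2) (n : ℕ) (hn : 6 ≤ n) :
    pderiv (k, n) (rho1 (jet R 0) (jet R 1)) = 0 :=
  pderiv_eq_zero_of_supported rho1Code.den (by decide +kernel) k n hn

theorem den_totalDeriv :
    ∀ q ∈ derTable, Den (jetVal (jet R)) q.2 (totalDeriv R (jetVal (jet R) q.1)) :=
  den_derTable (totalDeriv_jet (R := R))

theorem den_varDeriv_rho1 (i : Fin 2) : Den (jetVal (jet R)) (gradS rho1Code.{r}.1 (jetVars i))
    (varDeriv (rho1 (jet R 0) (jet R 1)) i) := by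
  have h : DenPartials (jetVal (jet R)) rho1Code.{r}.1 (jetVars i)
      (partials (RingHom.id _) (rho1 (jet R 0) (jet R 1)) i) :=
    denPartials_partials (RingHom.id _) rho1Code.den (by decide +kernel) i
  rw [varDeriv_eq (pderiv_rho1_eq_zero i), ← adjVal_partials]
  exact den_gradS den_totalDeriv h

end SPoly

/-! ### The Kupershmidt reduction and the two Hamiltonian forms -/

namespace WNLOp

universe r

open SPoly

section

variable {R : Type r} [CommRing R]

theorem applyLocal_opJ (G : Fin 2 → DiffPoly R) (i : Fin 2) :
    applyLocal (opJ R) G i = (![3, 1] i : DiffPoly R) * totalDeriv R (G i) := by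
  rw [applyLocal, Fin.sum_univ_two]
  fin_cases i
  · change 3 * totalDeriv R (G 0) + 0 * G 1 = 3 * totalDeriv R (G 0)
    rw [zero_mul, add_zero]
  · change 0 * G 0 + totalDeriv R (G 1) = 1 * totalDeriv R (G 1)
    rw [zero_mul, zero_add, one_mul]

/-- The normalization `1 / 18` is moved to the other side, so that the check has integer
coefficients and works over any commutative ring. -/
theorem opJ_varDeriv_rho1 (i : Fin 2) :
    applyLocal (opJ R) (varDeriv (rho1 (jet R 0) (jet R 1))) i = 18 * flow R i := by
  rw [applyLocal_opJ]
  have h1 := den_deriv den_totalDeriv (den_varDeriv_rho1 (R := R) i)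
  have h2 := den_mul (den_ofNat 18) (den_flowS (R := R) i)
  fin_cases i
  · exact eq_of_isZero (den_mul (den_ofNat 3) h1) h2 (by decide +kernel)
  · exact eq_of_isZero (den_mul (den_cast (den_const 1) Nat.cast_one) h1) h2 (by decide +kernel)

theorem setVZero_jet (i : Fin 2) (n : ℕ) :
    setVZero R (jet R i n) = if i = 0 then jet R i n else 0 := by
  rw [setVZero, jet, aeval_X]
  rfl

theorem setVZero_flow_zero : setVZero R (flow R 0) = kupershmidt (jet R 0) := by
  change setVZero R (flowU (jet R 0) (jet R 1)) = _
  simp only [flowU, kupershmidt, map_add, map_sub, map_mul, map_pow, map_ofNat, setVZero_jet,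
    if_pos, one_ne_zero, if_false]
  ring

theorem setVZero_flow_one : setVZero R (flow R 1) = 0 := by
  change setVZero R (flowV (jet R 0) (jet R 1)) = _
  simp only [flowV, map_add, map_sub, map_mul, map_pow, map_neg, map_ofNat, setVZero_jet,
    if_pos, one_ne_zero, if_false]
  ring

theorem varDeriv_C (c : R) : varDeriv (C c : DiffPoly R) = 0 := by
  funext i
  rw [varDeriv_eq fun n _ => pderiv_C, act_adjoint_linOp]
  refine Finset.sum_eq_zero fun n _ => ?_
  rw [pderiv_C, map_zero, zero_mul]
  have h := DiffOp.act_map_zero (RingHom.id _) (totalDeriv R) ((DiffOp.der : DiffOp R) ^ n)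
  rw [DiffOp.act_pow] at h
  exact (congrArg _ h).trans (mul_zero _)

end

variable {𝕜 : Type r} [Field 𝕜] [CharZero 𝕜]

theorem flow_eq_opJ : flow 𝕜 = applyLocal (opJ 𝕜)
    (varDeriv (C (1 / 18 : 𝕜) * rho1 (jet 𝕜 0) (jet 𝕜 1))) := by
  have h : varDeriv (C (1 / 18 : 𝕜) * rho1 (jet 𝕜 0) (jet 𝕜 1)) =
      fun i => C (1 / 18 : 𝕜) * varDeriv (rho1 (jet 𝕜 0) (jet 𝕜 1)) i :=
    funext fun i => varDeriv_C_mul _ (pderiv_rho1_eq_zero i)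
  funext i
  have h1 := opJ_varDeriv_rho1 (R := 𝕜) i
  have h2 : (C (1 / 18 : 𝕜) : DiffPoly 𝕜) * 18 = 1 := by
    rw [← map_ofNat C 18, ← C_mul, one_div, inv_mul_cancel₀ (by norm_num), C_1]
  rw [applyLocal_opJ] at h1 ⊢
  rw [h]
  dsimp only
  rw [C_mul', Derivation.map_smul, ← C_mul', mul_left_comm, h1, ← mul_assoc, h2, one_mul]

theorem isValue_opK (α : 𝕜) : (opK 𝕜).IsValue (varDeriv (C α)) (flow 𝕜) := by
  have h4 : (C (4 : 𝕜) : DiffPoly 𝕜) * C (1 / 4) = 1 := by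
    rw [← C_mul, one_div, mul_inv_cancel₀ (by norm_num), C_1]
  rw [varDeriv_C]
  -- The gradient is zero, so the primitives are free constants. Choosing `1 / 4` for the one that
  -- multiplies `4 (u_t, v_t)` and `0` for the other leaves exactly the flow.
  refine ⟨![C (1 / 4), 0], fun a => ?_, fun i => ?_⟩
  · fin_cases a
    · simp
    · simp
  · have h : applyLocal (opK 𝕜).loc 0 i = 0 := by
      refine Finset.sum_eq_zero fun j _ => ?_
      exact DiffOp.act_map_zero (RingHom.id _) (totalDeriv 𝕜) _
    rw [h, zero_add, Fin.sum_univ_two, Fin.sum_univ_two, Fin.sum_univ_two]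
    change flow 𝕜 i = C 0 * _ * _ + C 4 * _ * 0 + (C 4 * flow 𝕜 i * C (1 / 4) + C 0 * _ * 0)
    rw [C_0]
    linear_combination -flow 𝕜 i * h4

end WNLOp


end


theorem mainTheorem1 {𝕜 : Type*} [Field 𝕜] [CharZero 𝕜] :
    -- for `v = 0` the system reduces to the Kupershmidt equation
    (setVZero 𝕜 (flow 𝕜 0) = kupershmidt (jet 𝕜 0) ∧ setVZero 𝕜 (flow 𝕜 1) = 0) ∧
    -- the two Hamiltonian forms of the system
    flow 𝕜 = applyLocal (opJ 𝕜)
      (varDeriv (C (1 / 18 : 𝕜) * rho1 (jet 𝕜 0) (jet 𝕜 1))) ∧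
    (∀ α : 𝕜, (opK 𝕜).IsValue (varDeriv (C α)) (flow 𝕜)) ∧
    -- `J` and `K` are a compatible pair of Hamiltonian operators
    (WNLOp.ofLocal (Fin.elim0 : Fin 0 → Fin 2 → DiffPoly 𝕜) (opJ 𝕜)).IsHamiltonian ∧
    (opK 𝕜).IsHamiltonian ∧
    ∀ c : 𝕜, (opK 𝕜 + c • WNLOp.ofLocal (tailK 𝕜) (opJ 𝕜)).IsHamiltonian :=
  ⟨⟨WNLOp.setVZero_flow_zero, WNLOp.setVZero_flow_one⟩, WNLOp.flow_eq_opJ, WNLOp.isValue_opK,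
    WNLOp.isHamiltonian_opJ _,
    WNLOp.isHamiltonian_of_isInvariant WNLOp.isSkew_opK WNLOp.isInvariant_opK_flow,
    fun c => WNLOp.isHamiltonian_of_isInvariant
      (WNLOp.isSkew_opK.add_smul (WNLOp.isSkew_opJ _) c)
      (WNLOp.isInvariant_opK_flow.add_smul WNLOp.isInvariant_opJ_flow c)⟩
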